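/- **Conventions.** Let $A$ be a (not necessarily unital) $C^*$-algebra, $G$ a second-countable compact (Hausdorff) group with normalized Haar measure, and $\alpha\colon G\to\mathrm{Aut}(A)$ a continuous action (that is, $g\mapsto\alpha_g(a)$ is norm continuous for every $a\in A$). Write $A^\alpha=\{a\in A:\alpha_g(a)=a \text{ for all } g\in G\}$ for the fixed point algebra and $A\rtimes_\alpha G$ for the crossed product, i.e. the enveloping $C^*$-algebra of $L^1(G,A,\alpha)$. Say that $A$ is $\sigma$-unital if it has a countable approximate unit. *Rokhlin property.* Put $A_\infty=\ell^\infty(\mathbb N,A)/c_0(\mathbb N,A)$, and regard $A$ as a subalgebra of $A_\infty$ via constant sequences. For an $\alpha$-invariant $C^*$-subalgebra $D\subseteq A$ put $F(D,A)=(A_\infty\cap D')/\mathrm{Ann}(D,A_\infty)$, where $\mathrm{Ann}(D,A_\infty)=\{x\in A_\infty : xd=dx=0 \text{ for all } d\in D\}$; let $F(\alpha)$ be the action of $G$ on $F(D,A)$ induced by $\alpha$. Let $\ell^\infty_\alpha(\mathbb N,A)$ be the algebra of those $a\in\ell^\infty(\mathbb N,A)$ for which $g\mapsto(\alpha_g(a_n))_n$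 is norm continuous, let $A_{\infty,\alpha}$ be its image in $A_\infty$, and let $F_\alpha(D,A)$ be the image of $A_{\infty,\alpha}\cap D'$ in $F(D,A)$. If $A$ is $\sigma$-unital, then $\alpha$ has the *Rokhlin property* if for every separable $\alpha$-invariant $C^*$-subalgebra $D\subseteq A$ there is a unital $*$-homomorphism $C(G)\to F_\alpha(D,A)$ that is equivariant for the left translation action $(\mathtt{Lt}_g f)(h)=f(g^{-1}h)$ on $C(G)$ and the action $F(\alpha)$. *Classes of algebras.* A $C^*$-algebra $A$ is *purely infinite* (in the sense of Kirchberg and Rørdam) if there are no non-zero characters on $A$ and, for all positive $a,b\in A$ with $a$ in the closed two-sided ideal generated by $b$, there is a sequence $(x_n)$ in $A$ with $x_n^*bx_n\to a$. A *Kirchberg algebra* is a purely infinite, simple (in particular non-zero), separable, nuclear $C^*$-algebra. **Proposition.** Let $\alpha\colon G\to\mathrm{Aut}(A)$ be a continuous action of a second-countable compact group with the Rokhlin property. 1. If $A$ is $\sigma$-unital and purely infinite, then $A^\alpha$ and $A\rtimes_\alpha G$ are purely infinite. 2. If $A$ is a Kirchberg algebra, then $A^\alpha$ and $A\rtimes_\alpha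 G$ are Kirchberg algebras. -/

import Mathlib

open Filter Topology MeasureTheory
open scoped ENNReal

universe u v

set_option linter.unusedSectionVars false

noncomputable section

/-! ### Quotients of `*`-algebras -/

/-- A two-sided `*`-ideal of a (not necessarily unital) complex `*`-algebra. -/
structure StarIdeal (R : Type u) [NonUnitalRing R] [StarRing R] [Module ℂ R] extends
    Submodule ℂ R where
  mul_mem_left' : ∀ (x : R) {y : R}, y ∈ carrier → x * y ∈ carrier
  mul_mem_right' : ∀ (x : R) {y : R}, y ∈ carrier → y * x ∈ carrier
  star_mem' : ∀ {x : R}, x ∈ carrier → star x ∈ carrier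

namespace StarIdeal

variable {R : Type u} [NonUnitalRing R] [StarRing R] [Module ℂ R]

/-- The quotient `R / I`, as a `*`-algebra over `ℂ`. -/
def Quot (I : StarIdeal R) : Type u := R ⧸ I.toSubmodule

variable (I : StarIdeal R)

instance : AddCommGroup I.Quot := inferInstanceAs (AddCommGroup (R ⧸ I.toSubmodule))
instance : Module ℂ I.Quot := inferInstanceAs (Module ℂ (R ⧸ I.toSubmodule))

/-- The quotient map, as a linear map. -/
def mkₗ : R →ₗ[ℂ] I.Quot := I.toSubmodule.mkQ

theorem mkₗ_surjective : Function.Surjective I.mkₗ := I.toSubmodule.mkQ_surjective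

theorem mkₗ_eq_iff {x y : R} : I.mkₗ x = I.mkₗ y ↔ x - y ∈ I.toSubmodule :=
  Submodule.Quotient.eq I.toSubmodule

instance : Mul I.Quot where
  mul a b := Quotient.liftOn₂' a b (fun x y => I.mkₗ (x * y)) (by
    intro x₁ y₁ x₂ y₂ hx hy
    rw [Submodule.quotientRel_def] at hx hy
    rw [mkₗ_eq_iff]
    have h : x₁ * y₁ - x₂ * y₂ = (x₁ - x₂) * y₁ + x₂ * (y₁ - y₂) := by noncomm_ring
    rw [h]
    exact I.toSubmodule.add_mem (I.mul_mem_right' _ hx) (I.mul_mem_left' _ hy))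

instance : Star I.Quot where
  star a := Quotient.liftOn' a (fun x => I.mkₗ (star x)) (by
    intro x y hx
    rw [Submodule.quotientRel_def] at hx
    rw [mkₗ_eq_iff, ← star_sub]
    exact I.star_mem' hx)

theorem mkₗ_mul (x y : R) : I.mkₗ (x * y) = I.mkₗ x * I.mkₗ y := rfl
theorem mkₗ_star (x : R) : I.mkₗ (star x) = star (I.mkₗ x) := rfl

instance : NonUnitalRing I.Quot where
  left_distrib a b c := by
    obtain ⟨a, rfl⟩ := I.mkₗ_surjective a
    obtain ⟨b, rfl⟩ := I.mkₗ_surjective b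
    obtain ⟨c, rfl⟩ := I.mkₗ_surjective c
    simp only [← mkₗ_mul, ← map_add, mul_add]
  right_distrib a b c := by
    obtain ⟨a, rfl⟩ := I.mkₗ_surjective a
    obtain ⟨b, rfl⟩ := I.mkₗ_surjective b
    obtain ⟨c, rfl⟩ := I.mkₗ_surjective c
    simp only [← mkₗ_mul, ← map_add, add_mul]
  zero_mul a := by
    obtain ⟨a, rfl⟩ := I.mkₗ_surjective a
    rw [← map_zero I.mkₗ, ← mkₗ_mul, zero_mul]
  mul_zero a := by
    obtain ⟨a, rfl⟩ := I.mkₗ_surjective a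
    rw [← map_zero I.mkₗ, ← mkₗ_mul, mul_zero]
  mul_assoc a b c := by
    obtain ⟨a, rfl⟩ := I.mkₗ_surjective a
    obtain ⟨b, rfl⟩ := I.mkₗ_surjective b
    obtain ⟨c, rfl⟩ := I.mkₗ_surjective c
    simp only [← mkₗ_mul, mul_assoc]

instance : StarRing I.Quot where
  star_involutive a := by
    obtain ⟨a, rfl⟩ := I.mkₗ_surjective a
    simp only [← mkₗ_star, star_star]
  star_mul a b := by
    obtain ⟨a, rfl⟩ := I.mkₗ_surjective a
    obtain ⟨b, rfl⟩ := I.mkₗ_surjective b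
    simp only [← mkₗ_star, ← mkₗ_mul, star_mul]
  star_add a b := by
    obtain ⟨a, rfl⟩ := I.mkₗ_surjective a
    obtain ⟨b, rfl⟩ := I.mkₗ_surjective b
    simp only [← mkₗ_star, ← map_add, star_add]

instance [IsScalarTower ℂ R R] : IsScalarTower ℂ I.Quot I.Quot where
  smul_assoc c a b := by
    obtain ⟨a, rfl⟩ := I.mkₗ_surjective a
    obtain ⟨b, rfl⟩ := I.mkₗ_surjective b
    simp only [smul_eq_mul, ← mkₗ_mul, ← map_smul, smul_mul_assoc]

instance [SMulCommClass ℂ R R] : SMulCommClass ℂ I.Quot I.Quot where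
  smul_comm c a b := by
    obtain ⟨a, rfl⟩ := I.mkₗ_surjective a
    obtain ⟨b, rfl⟩ := I.mkₗ_surjective b
    simp only [smul_eq_mul, ← mkₗ_mul, ← map_smul, mul_smul_comm]

instance [StarModule ℂ R] : StarModule ℂ I.Quot where
  star_smul c a := by
    obtain ⟨a, rfl⟩ := I.mkₗ_surjective a
    simp only [← mkₗ_star, ← map_smul, star_smul]

/-- The quotient map `R → R / I`, as a `*`-homomorphism. -/
def quotMap : R →⋆ₙₐ[ℂ] I.Quot where
  toFun := I.mkₗ
  map_smul' c x := map_smul I.mkₗ c x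
  map_zero' := map_zero I.mkₗ
  map_add' := map_add I.mkₗ
  map_mul' := I.mkₗ_mul
  map_star' := I.mkₗ_star

/-- The `*`-homomorphism `R / I → S / J` induced by a `*`-homomorphism `f : R → S` with
`f I ⊆ J`. -/
def mapQuot {S : Type u} [NonUnitalRing S] [StarRing S] [Module ℂ S] (I : StarIdeal R)
    (J : StarIdeal S) (f : R →⋆ₙₐ[ℂ] S) (hf : ∀ x ∈ I.toSubmodule, f x ∈ J.toSubmodule) :
    I.Quot →⋆ₙₐ[ℂ] J.Quot :=
  let F : I.Quot →ₗ[ℂ] J.Quot :=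
    I.toSubmodule.mapQ J.toSubmodule (LinearMapClass.linearMap f) hf
  have hF : ∀ x : R, F (I.mkₗ x) = J.mkₗ (f x) := fun _ => rfl
  { toFun := F
    map_smul' := fun c x => map_smul F c x
    map_zero' := map_zero F
    map_add' := map_add F
    map_mul' := by
      intro a b
      obtain ⟨a, rfl⟩ := I.mkₗ_surjective a
      obtain ⟨b, rfl⟩ := I.mkₗ_surjective b
      simp only [← mkₗ_mul, hF, map_mul]
    map_star' := by
      intro a
      obtain ⟨a, rfl⟩ := I.mkₗ_surjective a
      simp only [← mkₗ_star, hF, map_star] }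

end StarIdeal

/-- A continuous action of a topological group `G` on a C⋆-algebra `A`: a homomorphism into the
group of `*`-automorphisms of `A` for which all orbit maps are norm continuous. -/
structure CStarAction (G : Type v) (A : Type u) [Group G] [TopologicalSpace G]
    [NonUnitalCStarAlgebra A] where
  toAut : G →* (A ≃⋆ₐ[ℂ] A)
  continuous_orbit : ∀ a : A, Continuous fun g : G => toAut g a

namespace CStarAction

variable {G : Type v} {A : Type u} [Group G] [TopologicalSpace G] [NonUnitalCStarAlgebra A]

theorem norm_toAut (α : CStarAction G A) (g : G) (a : A) : ‖α.toAut g a‖ = ‖a‖ :=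
  StarAlgEquiv.norm_map (α.toAut g) a

theorem toAut_mul (α : CStarAction G A) (g h : G) (a : A) :
    α.toAut (g * h) a = α.toAut g (α.toAut h a) := by
  rw [map_mul]; rfl

theorem toAut_map_mul (α : CStarAction G A) (g : G) (a b : A) :
    α.toAut g (a * b) = α.toAut g a * α.toAut g b := map_mul (α.toAut g) a b

theorem toAut_one (α : CStarAction G A) (a : A) : α.toAut 1 a = a := by
  rw [map_one]; rfl

theorem toAut_smul (α : CStarAction G A) (g : G) (c : ℂ) (a : A) :
    α.toAut g (c • a) = c • α.toAut g a := map_smul (α.toAut g) c a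

/-- The fixed point algebra `A^α`. -/
def fixedPoints (α : CStarAction G A) : NonUnitalStarSubalgebra ℂ A where
  carrier := {a | ∀ g : G, α.toAut g a = a}
  add_mem' ha hb g := by rw [map_add, ha g, hb g]
  zero_mem' g := map_zero _
  mul_mem' ha hb g := by rw [map_mul, ha g, hb g]
  smul_mem' c a ha g := by rw [α.toAut_smul, ha g]
  star_mem' ha g := by rw [map_star, ha g]

theorem isometry_toAut (α : CStarAction G A) (g : G) : Isometry (α.toAut g) :=
  AddMonoidHomClass.isometry_of_norm (α.toAut g) (α.norm_toAut g)

instance isClosed_fixedPoints (α : CStarAction G A) : IsClosed (α.fixedPoints : Set A) := by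
  have h : (α.fixedPoints : Set A) = ⋂ g : G, {a | α.toAut g a = a} := by
    ext a
    simp only [Set.mem_iInter]
    rfl
  rw [h]
  exact isClosed_iInter fun g => isClosed_eq (α.isometry_toAut g).continuous continuous_id

end CStarAction

/-! ### Sequence algebras -/

section SequenceAlgebras

/-- The C⋆-algebra `ℓ^∞(ℕ, A)` of bounded sequences in `A`. -/
abbrev BddSeq (A : Type u) [NonUnitalCStarAlgebra A] : Type u := lp (fun _ : ℕ => A) ∞

/-- The ideal `c₀(ℕ, A)` of `ℓ^∞(ℕ, A)`. -/
def nullSeq (A : Type u) [NonUnitalCStarAlgebra A] : StarIdeal (BddSeq A) where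
  carrier := {x | Tendsto (fun n => ‖x n‖) atTop (𝓝 0)}
  add_mem' {x y} hx hy :=
    squeeze_zero (fun _ => norm_nonneg _) (fun n => norm_add_le (x n) (y n))
      (by simpa using Tendsto.add hx hy)
  zero_mem' := by simp
  smul_mem' c x hx := by
    have h := Tendsto.const_mul ‖c‖ hx
    rw [mul_zero] at h
    exact squeeze_zero (fun _ => norm_nonneg _) (fun n => (norm_smul c (x n)).le) h
  mul_mem_left' x y hy := by
    have h := Tendsto.const_mul ‖x‖ hy
    rw [mul_zero] at h
    refine squeeze_zero (fun _ => norm_nonneg _) (fun n => ?_) h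
    exact (norm_mul_le (x n) (y n)).trans
      (mul_le_mul_of_nonneg_right (lp.norm_apply_le_norm (by simp) x n) (norm_nonneg _))
  mul_mem_right' x y hy := by
    have h := Tendsto.mul_const ‖x‖ hy
    rw [zero_mul] at h
    refine squeeze_zero (fun _ => norm_nonneg _) (fun n => ?_) h
    exact (norm_mul_le (y n) (x n)).trans
      (mul_le_mul_of_nonneg_left (lp.norm_apply_le_norm (by simp) x n) (norm_nonneg _))
  star_mem' {x} hx := by
    have h : ∀ n, ‖(star x : BddSeq A) n‖ = ‖x n‖ := fun n => norm_star (x n)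
    simpa only [Set.mem_ofPred_eq, h] using hx

/-- The sequence algebra `A_∞ = ℓ^∞(ℕ, A) / c₀(ℕ, A)`. -/
abbrev SeqAlg (A : Type u) [NonUnitalCStarAlgebra A] : Type u := (nullSeq A).Quot

variable {A : Type u} [NonUnitalCStarAlgebra A]

/-- The embedding of `A` into `ℓ^∞(ℕ, A)` as constant sequences. -/
def constSeq : A →⋆ₙₐ[ℂ] BddSeq A where
  toFun a := ⟨fun _ => a, memℓp_infty ⟨‖a‖, by rintro _ ⟨n, rfl⟩; exact le_rfl⟩⟩
  map_smul' _ _ := rfl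
  map_zero' := rfl
  map_add' _ _ := rfl
  map_mul' _ _ := rfl
  map_star' _ := rfl

/-- The embedding of `A` into `A_∞` as classes of constant sequences. -/
def constSeqAlg : A →⋆ₙₐ[ℂ] SeqAlg A := (nullSeq A).quotMap.comp constSeq

/-- The relative commutant `A_∞ ∩ D'`. -/
def relComm (D : NonUnitalStarSubalgebra ℂ A) : NonUnitalStarSubalgebra ℂ (SeqAlg A) :=
  NonUnitalStarSubalgebra.centralizer ℂ (constSeqAlg '' (D : Set A))

theorem mem_relComm {D : NonUnitalStarSubalgebra ℂ A} {x : SeqAlg A} :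
    x ∈ relComm D ↔ ∀ d ∈ D, constSeqAlg d * x = x * constSeqAlg d := by
  rw [relComm, NonUnitalStarSubalgebra.mem_centralizer_iff]
  constructor
  · intro h d hd
    exact (h _ ⟨d, hd, rfl⟩).1
  · rintro h _ ⟨d, hd, rfl⟩
    refine ⟨h d hd, ?_⟩
    rw [← map_star]
    exact h (star d) (star_mem hd)

/-- The annihilator `Ann(D, A_∞)`, as an ideal of `A_∞ ∩ D'`. -/
def annihil (D : NonUnitalStarSubalgebra ℂ A) : StarIdeal (relComm D) where
  carrier := {x | ∀ d ∈ D, (x : SeqAlg A) * constSeqAlg d = 0 ∧ constSeqAlg d * (x : SeqAlg A) = 0}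
  add_mem' {x y} hx hy d hd := by
    simp [add_mul, mul_add, (hx d hd).1, (hx d hd).2, (hy d hd).1, (hy d hd).2]
  zero_mem' d hd := by simp
  smul_mem' c x hx d hd := by
    simp [smul_mul_assoc, mul_smul_comm, (hx d hd).1, (hx d hd).2]
  mul_mem_left' x y hy d hd := by
    have hx := mem_relComm.1 x.2 d hd
    constructor
    · rw [NonUnitalStarSubalgebra.coe_mul, mul_assoc, (hy d hd).1, mul_zero]
    · rw [NonUnitalStarSubalgebra.coe_mul, ← mul_assoc, hx, mul_assoc, (hy d hd).2, mul_zero]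
  mul_mem_right' x y hy d hd := by
    have hx := mem_relComm.1 x.2 d hd
    constructor
    · rw [NonUnitalStarSubalgebra.coe_mul, mul_assoc, ← hx, ← mul_assoc, (hy d hd).1, zero_mul]
    · rw [NonUnitalStarSubalgebra.coe_mul, ← mul_assoc, (hy d hd).2, zero_mul]
  star_mem' {x} hx d hd := by
    have h := hx (star d) (star_mem hd)
    constructor
    · have h2 := congrArg star h.2
      rwa [star_mul, star_zero, ← map_star, star_star] at h2
    · have h1 := congrArg star h.1
      rwa [star_mul, star_zero, ← map_star, star_star] at h1

/-- The central sequence algebra `F(D, A) = (A_∞ ∩ D') / Ann(D, A_∞)`. -/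
abbrev CentralSeqAlg (D : NonUnitalStarSubalgebra ℂ A) : Type u := (annihil D).Quot

end SequenceAlgebras

namespace CStarAction

variable {G : Type v} {A : Type u} [Group G] [TopologicalSpace G] [NonUnitalCStarAlgebra A]

/-- The (not necessarily continuous) action `α^∞` on `ℓ^∞(ℕ, A)`, entry by entry. -/
def onBddSeq (α : CStarAction G A) (g : G) : BddSeq A →⋆ₙₐ[ℂ] BddSeq A where
  toFun x := ⟨fun n => α.toAut g (x n), memℓp_infty ⟨‖x‖, by
    rintro _ ⟨n, rfl⟩
    exact (α.norm_toAut g (x n)).trans_le (lp.norm_apply_le_norm (by simp) x n)⟩⟩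
  map_smul' c x := by ext n; exact α.toAut_smul g c (x n)
  map_zero' := by ext n; exact map_zero (α.toAut g)
  map_add' x y := by ext n; exact map_add (α.toAut g) (x n) (y n)
  map_mul' x y := by ext n; exact map_mul (α.toAut g) (x n) (y n)
  map_star' x := by ext n; exact map_star (α.toAut g) (x n)

/-- The action `α_∞` on `A_∞` induced by `α^∞`. -/
def onSeqAlg (α : CStarAction G A) (g : G) : SeqAlg A →⋆ₙₐ[ℂ] SeqAlg A :=
  StarIdeal.mapQuot (nullSeq A) (nullSeq A) (α.onBddSeq g) (by
    intro x hx
    have h : ∀ n, ‖α.onBddSeq g x n‖ = ‖x n‖ := fun n => α.norm_toAut g (x n)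
    change Tendsto (fun n => ‖α.onBddSeq g x n‖) atTop (𝓝 0)
    simp only [h]
    exact hx)

theorem onSeqAlg_const (α : CStarAction G A) (g : G) (a : A) :
    α.onSeqAlg g (constSeqAlg a) = constSeqAlg (α.toAut g a) := rfl

/-- `D` is an `α`-invariant subalgebra. -/
def IsInvariant (α : CStarAction G A) (D : NonUnitalStarSubalgebra ℂ A) : Prop :=
  ∀ g : G, ∀ d ∈ D, α.toAut g d ∈ D

theorem IsInvariant.exists_eq {α : CStarAction G A} {D : NonUnitalStarSubalgebra ℂ A}
    (hD : α.IsInvariant D) (g : G) {d : A} (hd : d ∈ D) : ∃ d' ∈ D, α.toAut g d' = d :=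
  ⟨α.toAut g⁻¹ d, hD _ _ hd, by rw [← α.toAut_mul, mul_inv_cancel, α.toAut_one]⟩

/-- The restriction of `α_∞` to `A_∞ ∩ D'`, for an `α`-invariant `D`. -/
def onRelComm (α : CStarAction G A) (D : NonUnitalStarSubalgebra ℂ A) (hD : α.IsInvariant D)
    (g : G) : relComm D →⋆ₙₐ[ℂ] relComm D :=
  NonUnitalStarAlgHom.codRestrict
    ((α.onSeqAlg g).comp (NonUnitalStarSubalgebraClass.subtype (relComm D))) (relComm D) (by
      intro x
      rw [mem_relComm]
      intro d hd
      obtain ⟨d', hd', rfl⟩ := hD.exists_eq g hd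
      have h := congrArg (α.onSeqAlg g) (mem_relComm.1 x.2 d' hd')
      rw [map_mul, map_mul, onSeqAlg_const] at h
      exact h)

/-- The action `F(α)` on `F(D, A)`, for an `α`-invariant `D`. -/
def onCentralSeqAlg (α : CStarAction G A) (D : NonUnitalStarSubalgebra ℂ A)
    (hD : α.IsInvariant D) (g : G) : CentralSeqAlg D →⋆ₙₐ[ℂ] CentralSeqAlg D :=
  StarIdeal.mapQuot (annihil D) (annihil D) (α.onRelComm D hD g) (by
    intro x hx d hd
    obtain ⟨d', hd', rfl⟩ := hD.exists_eq g hd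
    have h1 := congrArg (α.onSeqAlg g) (hx d' hd').1
    have h2 := congrArg (α.onSeqAlg g) (hx d' hd').2
    rw [map_mul, map_zero, onSeqAlg_const] at h1 h2
    exact ⟨h1, h2⟩)

/-- The algebra `ℓ^∞_α(ℕ, A)` of those bounded sequences on which `α^∞` acts continuously. -/
def contBddSeq (α : CStarAction G A) : NonUnitalStarSubalgebra ℂ (BddSeq A) where
  carrier := {x | Continuous fun g : G => α.onBddSeq g x}
  add_mem' {x y} hx hy := by
    simp only [Set.mem_ofPred_eq, map_add] at hx hy ⊢; exact hx.add hy
  zero_mem' := by simpa only [Set.mem_ofPred_eq, map_zero] using continuous_const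
  mul_mem' {x y} hx hy := by
    simp only [Set.mem_ofPred_eq, map_mul] at hx hy ⊢; exact hx.mul hy
  smul_mem' c x hx := by
    simp only [Set.mem_ofPred_eq, map_smul] at hx ⊢; exact hx.const_smul c
  star_mem' {x} hx := by
    simp only [Set.mem_ofPred_eq, map_star] at hx ⊢; exact hx.star

/-- The algebra `A_{∞,α}`, the image of `ℓ^∞_α(ℕ, A)` in `A_∞`. -/
def contSeqAlg (α : CStarAction G A) : NonUnitalStarSubalgebra ℂ (SeqAlg A) :=
  α.contBddSeq.map (nullSeq A).quotMap

/-- The algebra `F_α(D, A)`, the image of `A_{∞,α} ∩ D'` in `F(D, A)`. -/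
def contCentralSeqAlg (α : CStarAction G A) (D : NonUnitalStarSubalgebra ℂ A) :
    NonUnitalStarSubalgebra ℂ (CentralSeqAlg D) :=
  (α.contSeqAlg.comap (NonUnitalStarSubalgebraClass.subtype (relComm D))).map (annihil D).quotMap

/-- The action `Lt` of `G` on `C(G)` by left translation, `(Lt_g f)(h) = f (g⁻¹ h)`. -/
def leftTranslate [IsTopologicalGroup G] (g : G) (f : C(G, ℂ)) : C(G, ℂ) :=
  f.comp ⟨fun h => g⁻¹ * h, by fun_prop⟩

/-- The Rokhlin property: for every separable `α`-invariant C⋆-subalgebra `D` of `A` there is a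
unital equivariant `*`-homomorphism `C(G) → F_α(D, A)`. -/
def HasRokhlinProperty [IsTopologicalGroup G] [CompactSpace G] (α : CStarAction G A) : Prop :=
  ∀ (D : NonUnitalStarSubalgebra ℂ A) (hD : α.IsInvariant D), IsClosed (D : Set A) →
    TopologicalSpace.IsSeparable (D : Set A) →
    ∃ φ : C(G, ℂ) →⋆ₙₐ[ℂ] α.contCentralSeqAlg D,
      (∀ y : α.contCentralSeqAlg D, φ 1 * y = y ∧ y * φ 1 = y) ∧
      ∀ (g : G) (f : C(G, ℂ)),
        (φ (leftTranslate g f) : CentralSeqAlg D) = α.onCentralSeqAlg D hD g (φ f)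

end CStarAction

/-! ### Completion of a `*`-algebra in a C⋆-seminorm -/

/-- A C⋆-seminorm on a complex `*`-algebra. -/
structure CStarSeminorm (R : Type u) [NonUnitalRing R] [StarRing R] [Module ℂ R] extends
    Seminorm ℂ R where
  mul_le' : ∀ x y : R, toFun (x * y) ≤ toFun x * toFun y
  star_mul_self' : ∀ x : R, toFun (star x * x) = toFun x ^ 2

namespace CStarSeminorm

variable {R : Type u} [NonUnitalRing R] [StarRing R] [Module ℂ R]

theorem le_star (p : CStarSeminorm R) (x : R) : p.toSeminorm x ≤ p.toSeminorm (star x) := by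
  have h1 : p.toSeminorm (star x * x) = p.toSeminorm x ^ 2 := p.star_mul_self' x
  have h2 : p.toSeminorm (star x * x) ≤ p.toSeminorm (star x) * p.toSeminorm x := p.mul_le' _ _
  have h3 : 0 ≤ p.toSeminorm x := apply_nonneg _ _
  have h4 : 0 ≤ p.toSeminorm (star x) := apply_nonneg _ _
  by_contra! h
  nlinarith

theorem apply_star (p : CStarSeminorm R) (x : R) : p.toSeminorm (star x) = p.toSeminorm x :=
  le_antisymm (by simpa using p.le_star (star x)) (p.le_star x)

/-- The algebra `R`, regarded as a seminormed space with the seminorm `p`. -/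
def Space (_p : CStarSeminorm R) : Type u := R

variable (p : CStarSeminorm R)

instance : NonUnitalRing p.Space := inferInstanceAs (NonUnitalRing R)
instance : StarRing p.Space := inferInstanceAs (StarRing R)
instance : Module ℂ p.Space := inferInstanceAs (Module ℂ R)

/-- The seminorm `p`, on `p.Space`. -/
def addGroupSeminorm : AddGroupSeminorm p.Space := p.toSeminorm.toAddGroupSeminorm

instance : SeminormedAddCommGroup p.Space :=
  AddGroupSeminorm.toSeminormedAddCommGroup p.addGroupSeminorm

theorem norm_def (x : p.Space) : ‖x‖ = p.toSeminorm x := rfl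

instance : NonUnitalSeminormedRing p.Space where
  dist_eq := dist_eq_norm_neg_add
  norm_mul_le := p.mul_le'

instance : NormedSpace ℂ p.Space where
  toModule := inferInstance
  norm_smul_le c x := (map_smul_eq_mul p.toSeminorm c x).le

instance [IsScalarTower ℂ R R] : IsScalarTower ℂ p.Space p.Space :=
  inferInstanceAs (IsScalarTower ℂ R R)
instance [SMulCommClass ℂ R R] : SMulCommClass ℂ p.Space p.Space :=
  inferInstanceAs (SMulCommClass ℂ R R)
instance [StarModule ℂ R] : StarModule ℂ p.Space := inferInstanceAs (StarModule ℂ R)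

theorem isometry_star : Isometry (star : p.Space → p.Space) :=
  AddMonoidHomClass.isometry_of_norm (starAddEquiv : p.Space ≃+ p.Space) p.apply_star

/-- The Hausdorff completion of `R` in the seminorm `p`. -/
def Completion : Type u := UniformSpace.Completion p.Space

instance : NormedAddCommGroup p.Completion :=
  inferInstanceAs (NormedAddCommGroup (UniformSpace.Completion p.Space))
instance : NormedSpace ℂ p.Completion :=
  inferInstanceAs (NormedSpace ℂ (UniformSpace.Completion p.Space))
instance : CompleteSpace p.Completion :=
  inferInstanceAs (CompleteSpace (UniformSpace.Completion p.Space))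

/-- The canonical map of `R` into its completion. -/
def toCompl : p.Space →+ p.Completion := UniformSpace.Completion.toCompl

theorem isDenseInducing_toCompl : IsDenseInducing p.toCompl :=
  UniformSpace.Completion.isDenseInducing_coe

theorem continuous_toCompl : Continuous p.toCompl := p.isDenseInducing_toCompl.continuous

theorem norm_toCompl (x : p.Space) : ‖p.toCompl x‖ = ‖x‖ := UniformSpace.Completion.norm_coe x

theorem toCompl_smul (c : ℂ) (x : p.Space) : p.toCompl (c • x) = c • p.toCompl x :=
  UniformSpace.Completion.coe_smul c x

/-- The multiplication of `R`, followed by the map into the completion, as a biadditive map. -/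
def mulBi : p.Space →+ p.Space →+ p.Completion :=
  (AddMonoidHom.mul : p.Space →+ p.Space →+ p.Space).compr₂ p.toCompl

theorem mulBi_apply (x y : p.Space) : p.mulBi x y = p.toCompl (x * y) := rfl

theorem continuous_mulBi : Continuous fun q : p.Space × p.Space => p.mulBi q.1 q.2 := by
  simp only [mulBi_apply]
  exact p.continuous_toCompl.comp continuous_mul

/-- The continuous extension of the multiplication of `R` to the completion. -/
@[irreducible] def mulExt : p.Completion × p.Completion → p.Completion :=
  (p.isDenseInducing_toCompl.prodMap p.isDenseInducing_toCompl).extend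
    fun q : p.Space × p.Space => p.mulBi q.1 q.2

theorem continuous_mulExt : Continuous p.mulExt := by
  unfold mulExt
  exact p.isDenseInducing_toCompl.extend_Z_bilin p.isDenseInducing_toCompl p.continuous_mulBi

instance : Mul p.Completion where
  mul a b := p.mulExt (a, b)

theorem toCompl_mul (x y : p.Space) : p.toCompl (x * y) = p.toCompl x * p.toCompl y := by
  change p.mulBi x y = p.mulExt (p.toCompl x, p.toCompl y)
  unfold mulExt
  exact ((p.isDenseInducing_toCompl.prodMap p.isDenseInducing_toCompl).extend_eq
    p.continuous_mulBi (x, y)).symm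

instance : ContinuousMul p.Completion where
  continuous_mul := p.continuous_mulExt

/-- The continuous extension of the involution of `R` to the completion. -/
@[irreducible] def starExt : p.Completion → p.Completion :=
  UniformSpace.Completion.map (star : p.Space → p.Space)

theorem continuous_starExt : Continuous p.starExt := by
  unfold starExt
  exact UniformSpace.Completion.continuous_map

instance : Star p.Completion where
  star := p.starExt

instance : ContinuousStar p.Completion where
  continuous_star := p.continuous_starExt

theorem toCompl_star (x : p.Space) : p.toCompl (star x) = star (p.toCompl x) := by
  change _ = p.starExt (p.toCompl x)
  unfold starExt
  exact (UniformSpace.Completion.map_coe p.isometry_star.uniformContinuous x).symm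

theorem induction_on {P : p.Completion → Prop} (a : p.Completion)
    (hc : IsClosed {a | P a}) (h : ∀ x, P (p.toCompl x)) : P a :=
  UniformSpace.Completion.induction_on a hc h

theorem compl_mul_assoc (a b c : p.Completion) : a * b * c = a * (b * c) := by
  induction a using p.induction_on with
  | hc => exact isClosed_eq (by fun_prop) (by fun_prop)
  | h a =>
  induction b using p.induction_on with
  | hc => exact isClosed_eq (by fun_prop) (by fun_prop)
  | h b =>
  induction c using p.induction_on with
  | hc => exact isClosed_eq (by fun_prop) (by fun_prop)
  | h c => simp only [← toCompl_mul, mul_assoc]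

theorem compl_smul_mul [IsScalarTower ℂ R R] (c : ℂ) (a b : p.Completion) :
    (c • a) * b = c • (a * b) := by
  have hc : Continuous fun x : p.Completion => c • x := continuous_const_smul c
  induction a using p.induction_on with
  | hc => exact isClosed_eq (hc.mul continuous_const) (hc.comp (continuous_id.mul continuous_const))
  | h a =>
  induction b using p.induction_on with
  | hc =>
    exact isClosed_eq (continuous_const.mul continuous_id)
      (hc.comp (continuous_const.mul continuous_id))
  | h b => rw [← toCompl_mul, ← toCompl_smul, ← toCompl_smul, ← toCompl_mul, smul_mul_assoc]

theorem compl_mul_smul [SMulCommClass ℂ R R] (c : ℂ) (a b : p.Completion) :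
    a * (c • b) = c • (a * b) := by
  have hc : Continuous fun x : p.Completion => c • x := continuous_const_smul c
  induction a using p.induction_on with
  | hc =>
    exact isClosed_eq (continuous_id.mul continuous_const)
      (hc.comp (continuous_id.mul continuous_const))
  | h a =>
  induction b using p.induction_on with
  | hc => exact isClosed_eq (continuous_const.mul hc) (hc.comp (continuous_const.mul continuous_id))
  | h b => rw [← toCompl_mul, ← toCompl_smul, ← toCompl_smul, ← toCompl_mul, mul_smul_comm]

theorem compl_star_smul [StarModule ℂ R] (c : ℂ) (a : p.Completion) :
    star (c • a) = star c • star a := by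
  have hc : ∀ c : ℂ, Continuous fun x : p.Completion => c • x := continuous_const_smul
  induction a using p.induction_on with
  | hc => exact isClosed_eq (hc c).star ((hc (star c)).comp continuous_star)
  | h a => rw [← toCompl_star, ← toCompl_smul, ← toCompl_smul, ← toCompl_star, star_smul]

theorem compl_norm_mul_le (a b : p.Completion) : ‖a * b‖ ≤ ‖a‖ * ‖b‖ := by
  induction a using p.induction_on with
  | hc =>
    exact isClosed_le (continuous_id.mul continuous_const).norm
      (continuous_norm.mul continuous_const)
  | h a =>
  induction b using p.induction_on with
  | hc =>
    exact isClosed_le (continuous_const.mul continuous_id).norm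
      (continuous_const.mul continuous_norm)
  | h b => simpa only [← toCompl_mul, norm_toCompl] using norm_mul_le a b

theorem compl_norm_mul_self_le (a : p.Completion) : ‖a‖ * ‖a‖ ≤ ‖star a * a‖ := by
  induction a using p.induction_on with
  | hc =>
    exact isClosed_le (continuous_norm.mul continuous_norm)
      (continuous_star.mul continuous_id).norm
  | h a =>
    rw [← toCompl_star, ← toCompl_mul, norm_toCompl, norm_toCompl, norm_def, norm_def, ← sq]
    exact (p.star_mul_self' a).ge

instance : NonUnitalRing p.Completion where
  left_distrib a b c := by
    induction a using p.induction_on with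
    | hc => exact isClosed_eq (by fun_prop) (by fun_prop)
    | h a =>
    induction b using p.induction_on with
    | hc => exact isClosed_eq (by fun_prop) (by fun_prop)
    | h b =>
    induction c using p.induction_on with
    | hc => exact isClosed_eq (by fun_prop) (by fun_prop)
    | h c => simp only [← toCompl_mul, ← map_add, mul_add]
  right_distrib a b c := by
    induction a using p.induction_on with
    | hc => exact isClosed_eq (by fun_prop) (by fun_prop)
    | h a =>
    induction b using p.induction_on with
    | hc => exact isClosed_eq (by fun_prop) (by fun_prop)
    | h b =>
    induction c using p.induction_on with
    | hc => exact isClosed_eq (by fun_prop) (by fun_prop)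
    | h c => simp only [← toCompl_mul, ← map_add, add_mul]
  zero_mul a := by
    induction a using p.induction_on with
    | hc => exact isClosed_eq (by fun_prop) (by fun_prop)
    | h a => rw [← map_zero p.toCompl, ← toCompl_mul, zero_mul]
  mul_zero a := by
    induction a using p.induction_on with
    | hc => exact isClosed_eq (by fun_prop) (by fun_prop)
    | h a => rw [← map_zero p.toCompl, ← toCompl_mul, mul_zero]
  mul_assoc := p.compl_mul_assoc

instance : StarRing p.Completion where
  star_involutive a := by
    induction a using p.induction_on with
    | hc => exact isClosed_eq (by fun_prop) (by fun_prop)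
    | h a => simp only [← toCompl_star, star_star]
  star_mul a b := by
    induction a using p.induction_on with
    | hc => exact isClosed_eq (by fun_prop) (by fun_prop)
    | h a =>
    induction b using p.induction_on with
    | hc => exact isClosed_eq (by fun_prop) (by fun_prop)
    | h b => simp only [← toCompl_mul, ← toCompl_star, star_mul]
  star_add a b := by
    induction a using p.induction_on with
    | hc => exact isClosed_eq (by fun_prop) (by fun_prop)
    | h a =>
    induction b using p.induction_on with
    | hc => exact isClosed_eq (by fun_prop) (by fun_prop)
    | h b => simp only [← map_add, ← toCompl_star, star_add]

/-- The completion of a `*`-algebra in a C⋆-seminorm is a C⋆-algebra. -/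
instance [IsScalarTower ℂ R R] [SMulCommClass ℂ R R] [StarModule ℂ R] :
    NonUnitalCStarAlgebra p.Completion where
  toModule := inferInstance
  dist_eq := dist_eq_norm_neg_add
  norm_mul_le := p.compl_norm_mul_le
  norm_mul_self_le := p.compl_norm_mul_self_le
  norm_smul_le c a := norm_smul_le c a
  smul_assoc := p.compl_smul_mul
  smul_comm c a b := (p.compl_mul_smul c a b).symm
  star_smul := p.compl_star_smul

/-- The set of the C⋆-seminorms that are dominated by the seminorm `N`. -/
def dominated (N : Seminorm ℂ R) : Set (Seminorm ℂ R) :=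
  {q | q ≤ N ∧ ∃ p : CStarSeminorm R, p.toSeminorm = q}

theorem bddAbove_dominated (N : Seminorm ℂ R) : BddAbove (dominated N) := ⟨N, fun _ hq => hq.1⟩

theorem le_sSup_dominated {N q : Seminorm ℂ R} (hq : q ∈ dominated N) (x : R) :
    q x ≤ sSup (dominated N) x := le_csSup (bddAbove_dominated N) hq x

theorem sSup_dominated_le (N : Seminorm ℂ R) (x : R) {r : ℝ} (hr : 0 ≤ r)
    (h : ∀ q ∈ dominated N, q x ≤ r) : sSup (dominated N) x ≤ r := by
  rw [Seminorm.sSup_apply (bddAbove_dominated N)]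
  exact Real.iSup_le (fun q => h q.1 q.2) hr

/-- The largest C⋆-seminorm dominated by the seminorm `N`: the pointwise supremum of all
C⋆-seminorms dominated by `N`. -/
def enveloping (N : Seminorm ℂ R) : CStarSeminorm R where
  toSeminorm := sSup (dominated N)
  mul_le' x y := by
    change sSup (dominated N) (x * y) ≤ sSup (dominated N) x * sSup (dominated N) y
    refine sSup_dominated_le N _ (mul_nonneg (apply_nonneg _ _) (apply_nonneg _ _)) ?_
    rintro q hq
    obtain ⟨-, p, rfl⟩ := id hq
    exact (p.mul_le' x y).trans (mul_le_mul (le_sSup_dominated hq x) (le_sSup_dominated hq y)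
      (apply_nonneg p.toSeminorm _) (apply_nonneg _ _))
  star_mul_self' x := by
    change sSup (dominated N) (star x * x) = sSup (dominated N) x ^ 2
    apply le_antisymm
    · refine sSup_dominated_le N _ (sq_nonneg _) ?_
      rintro q hq
      obtain ⟨-, p, rfl⟩ := id hq
      have h : p.toSeminorm (star x * x) = p.toSeminorm x ^ 2 := p.star_mul_self' x
      rw [h]
      exact pow_le_pow_left₀ (apply_nonneg _ _) (le_sSup_dominated hq x) 2
    · refine (Real.le_sqrt (apply_nonneg _ _) (apply_nonneg _ _)).1 ?_
      refine sSup_dominated_le N _ (Real.sqrt_nonneg _) ?_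
      rintro q hq
      obtain ⟨-, p, rfl⟩ := id hq
      refine (Real.le_sqrt (apply_nonneg _ _) (apply_nonneg _ _)).2 ?_
      have h : p.toSeminorm (star x * x) = p.toSeminorm x ^ 2 := p.star_mul_self' x
      rw [← h]
      exact le_sSup_dominated hq (star x * x)

end CStarSeminorm

/-! ### The crossed product -/

/-- The normalized Haar measure of a compact group. -/
def haarProb (G : Type v) [Group G] [TopologicalSpace G] [IsTopologicalGroup G] [CompactSpace G]
    [MeasurableSpace G] [BorelSpace G] : Measure G :=
  Measure.haarMeasure ⊤

namespace haarProb

variable {G : Type v} [Group G] [TopologicalSpace G] [IsTopologicalGroup G] [CompactSpace G]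
  [MeasurableSpace G] [BorelSpace G]

instance : (haarProb G).IsHaarMeasure := inferInstanceAs (Measure.haarMeasure ⊤).IsHaarMeasure

instance : IsProbabilityMeasure (haarProb G) where
  measure_univ := Measure.haarMeasure_self (K₀ := (⊤ : TopologicalSpace.PositiveCompacts G))

end haarProb

namespace CStarAction

variable {G : Type v} {A : Type u} [Group G] [TopologicalSpace G] [NonUnitalCStarAlgebra A]

theorem continuous_toAut (α : CStarAction G A) :
    Continuous fun q : G × A => α.toAut q.1 q.2 := by
  rw [continuous_iff_continuousAt]
  rintro ⟨g, a⟩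
  rw [ContinuousAt, tendsto_iff_norm_sub_tendsto_zero]
  have h1 : Tendsto (fun q : G × A => ‖q.2 - a‖ + ‖α.toAut q.1 a - α.toAut g a‖)
      (𝓝 (g, a)) (𝓝 0) := by
    have h : Continuous fun q : G × A => ‖q.2 - a‖ + ‖α.toAut q.1 a - α.toAut g a‖ :=
      (continuous_snd.sub continuous_const).norm.add
        (((α.continuous_orbit a).comp continuous_fst).sub continuous_const).norm
    simpa using h.tendsto (g, a)
  refine squeeze_zero (fun _ => norm_nonneg _) (fun q => ?_) h1
  have h2 : α.toAut q.1 q.2 - α.toAut g a =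
      α.toAut q.1 (q.2 - a) + (α.toAut q.1 a - α.toAut g a) := by
    rw [map_sub]; abel
  rw [h2]
  exact (norm_add_le _ _).trans_eq (by rw [α.norm_toAut])

theorem continuous_toAut_comp (α : CStarAction G A) {X : Type*} [TopologicalSpace X] {s : X → G}
    {f : X → A} (hs : Continuous s) (hf : Continuous f) :
    Continuous fun x => α.toAut (s x) (f x) :=
  α.continuous_toAut.comp (hs.prodMk hf)

/-- The automorphism `α_g` as a continuous linear map. -/
def toCLM (α : CStarAction G A) (g : G) : A →L[ℂ] A where
  toFun := α.toAut g
  map_add' := map_add (α.toAut g)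
  map_smul' c a := α.toAut_smul g c a
  cont := (α.isometry_toAut g).continuous

/-- The convolution algebra `C(G, A)`: the continuous functions `G → A`, with the product
`(f * h)(s) = ∫ f(t) α_t(h(t⁻¹ s)) dt` and the involution `f*(s) = α_s(f(s⁻¹)*)`. -/
def ConvAlg (_α : CStarAction G A) : Type max u v := C(G, A)

instance (α : CStarAction G A) : AddCommGroup α.ConvAlg := inferInstanceAs (AddCommGroup C(G, A))
instance (α : CStarAction G A) : Module ℂ α.ConvAlg := inferInstanceAs (Module ℂ C(G, A))
instance (α : CStarAction G A) : FunLike α.ConvAlg G A := inferInstanceAs (FunLike C(G, A) G A)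

namespace ConvAlg

variable {α : CStarAction G A}

theorem continuous (f : α.ConvAlg) : Continuous f := ContinuousMap.continuous (f : C(G, A))

@[ext] theorem ext {f h : α.ConvAlg} (hfh : ∀ s, f s = h s) : f = h :=
  ContinuousMap.ext (f := (f : C(G, A))) hfh

theorem add_apply (f h : α.ConvAlg) (s : G) : (f + h) s = f s + h s := rfl
theorem zero_apply (s : G) : (0 : α.ConvAlg) s = 0 := rfl
theorem smul_apply (c : ℂ) (f : α.ConvAlg) (s : G) : (c • f) s = c • f s := rfl

variable [IsTopologicalGroup G] [CompactSpace G] [SecondCountableTopology G]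
  [MeasurableSpace G] [BorelSpace G]

theorem integrable_of_continuous {E : Type*} [NormedAddCommGroup E] {f : G → E}
    (hf : Continuous f) : Integrable f (haarProb G) :=
  hf.integrable_of_hasCompactSupport (HasCompactSupport.of_compactSpace f)

theorem continuous_integrand (f h : α.ConvAlg) :
    Continuous fun q : G × G => f q.2 * α.toAut q.2 (h (q.2⁻¹ * q.1)) :=
  (f.continuous.comp continuous_snd).mul
    (α.continuous_toAut_comp continuous_snd (h.continuous.comp (by fun_prop)))

theorem integrable_integrand (f h : α.ConvAlg) (s : G) :
    Integrable (fun t => f t * α.toAut t (h (t⁻¹ * s))) (haarProb G) :=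
  integrable_of_continuous ((continuous_integrand f h).comp (Continuous.prodMk_right s))

instance : Mul α.ConvAlg where
  mul f h := (⟨fun s => ∫ t, f t * α.toAut t (h (t⁻¹ * s)) ∂(haarProb G), by
    have hc := continuous_parametric_integral_of_continuous (μ := haarProb G)
      (f := fun s t => f t * α.toAut t (h (t⁻¹ * s))) (continuous_integrand f h) isCompact_univ
    simpa only [Measure.restrict_univ] using hc⟩ : C(G, A))

instance : Star α.ConvAlg where
  star f := (⟨fun s => α.toAut s (star (f s⁻¹)),
    α.continuous_toAut_comp continuous_id (f.continuous.comp continuous_inv).star⟩ : C(G, A))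

theorem mul_apply (f h : α.ConvAlg) (s : G) :
    (f * h) s = ∫ t, f t * α.toAut t (h (t⁻¹ * s)) ∂(haarProb G) := rfl

theorem star_apply (f : α.ConvAlg) (s : G) : star f s = α.toAut s (star (f s⁻¹)) := rfl

theorem toAut_integral (g : G) {f : G → A} (hf : Continuous f) :
    α.toAut g (∫ t, f t ∂(haarProb G)) = ∫ t, α.toAut g (f t) ∂(haarProb G) :=
  ((α.toCLM g).integral_comp_comm (integrable_of_continuous hf)).symm

theorem star_integral (f : G → A) :
    star (∫ t, f t ∂(haarProb G)) = ∫ t, star (f t) ∂(haarProb G) :=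
  ((starL' ℝ : A ≃L[ℝ] A).integral_comp_comm f).symm

theorem mul_integral (a : A) {f : G → A} (hf : Continuous f) :
    a * (∫ t, f t ∂(haarProb G)) = ∫ t, a * f t ∂(haarProb G) :=
  ((ContinuousLinearMap.mul ℝ A a).integral_comp_comm (integrable_of_continuous hf)).symm

theorem integral_mul (a : A) {f : G → A} (hf : Continuous f) :
    (∫ t, f t ∂(haarProb G)) * a = ∫ t, f t * a ∂(haarProb G) :=
  (((ContinuousLinearMap.mul ℝ A).flip a).integral_comp_comm (integrable_of_continuous hf)).symm

theorem conv_assoc (f h k : α.ConvAlg) : f * h * k = f * (h * k) := by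
  ext s
  have hF : Continuous fun q : G × G => f q.2 * (α.toAut q.2 (h (q.2⁻¹ * q.1)) *
      α.toAut q.1 (k (q.1⁻¹ * s))) :=
    (f.continuous.comp continuous_snd).mul ((α.continuous_toAut_comp continuous_snd
      (h.continuous.comp (by fun_prop))).mul (α.continuous_toAut_comp continuous_fst
        (k.continuous.comp (by fun_prop))))
  have hH : Continuous fun q : G × G => h q.2 * α.toAut q.2 (k (q.2⁻¹ * q.1)) :=
    continuous_integrand h k
  calc (f * h * k) s
      = ∫ t, ∫ r, f r * (α.toAut r (h (r⁻¹ * t)) * α.toAut t (k (t⁻¹ * s)))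
          ∂(haarProb G) ∂(haarProb G) := by
        rw [mul_apply]
        refine integral_congr_ae (.of_forall fun t => ?_)
        have hc : Continuous fun r => f r * α.toAut r (h (r⁻¹ * t)) :=
          (continuous_integrand f h).comp (Continuous.prodMk_right t)
        dsimp only
        rw [mul_apply, integral_mul _ hc]
        simp only [mul_assoc]
    _ = ∫ r, ∫ t, f r * (α.toAut r (h (r⁻¹ * t)) * α.toAut t (k (t⁻¹ * s)))
          ∂(haarProb G) ∂(haarProb G) :=
        integral_integral_swap_of_hasCompactSupport hF (HasCompactSupport.of_compactSpace _)
    _ = ∫ r, ∫ t, f r * (α.toAut r (h t) * α.toAut (r * t) (k ((r * t)⁻¹ * s)))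
          ∂(haarProb G) ∂(haarProb G) := by
        refine integral_congr_ae (.of_forall fun r => ?_)
        dsimp only
        rw [← integral_mul_left_eq_self _ r]
        simp only [inv_mul_cancel_left]
    _ = (f * (h * k)) s := by
        rw [mul_apply]
        refine integral_congr_ae (.of_forall fun r => ?_)
        have hc : Continuous fun t => h t * α.toAut t (k (t⁻¹ * (r⁻¹ * s))) :=
          hH.comp (Continuous.prodMk_right (r⁻¹ * s))
        have hc' : Continuous fun t => α.toAut r (h t * α.toAut t (k (t⁻¹ * (r⁻¹ * s)))) :=
          (α.isometry_toAut r).continuous.comp hc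
        dsimp only
        rw [mul_apply, toAut_integral r hc, mul_integral _ hc']
        simp only [α.toAut_map_mul, α.toAut_mul, mul_inv_rev, mul_assoc]

theorem conv_star_mul (f h : α.ConvAlg) : star (f * h) = star h * star f := by
  ext s
  have hc : Continuous fun t => f t * α.toAut t (h (t⁻¹ * s⁻¹)) :=
    (continuous_integrand f h).comp (Continuous.prodMk_right s⁻¹)
  rw [star_apply, mul_apply, star_integral, toAut_integral s hc.star, mul_apply,
    ← integral_mul_left_eq_self (fun t => star h t * α.toAut t (star f (t⁻¹ * s))) s]
  refine integral_congr_ae (.of_forall fun t => ?_)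
  simp only [star_apply, star_mul, α.toAut_map_mul, map_star, ← α.toAut_mul]
  congr 2
  · simp only [mul_inv_rev]
  · simp only [mul_inv_rev, inv_inv, mul_assoc, inv_mul_cancel, mul_inv_cancel,
      mul_one]

instance : NonUnitalRing α.ConvAlg where
  left_distrib f h k := by
    ext s
    simp only [mul_apply, add_apply, map_add, mul_add]
    exact integral_add (integrable_integrand f h s) (integrable_integrand f k s)
  right_distrib f h k := by
    ext s
    simp only [mul_apply, add_apply, add_mul]
    exact integral_add (integrable_integrand f k s) (integrable_integrand h k s)
  zero_mul f := by
    ext s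
    simp [mul_apply, zero_apply]
  mul_zero f := by
    ext s
    simp [mul_apply, zero_apply]
  mul_assoc := conv_assoc

instance : StarRing α.ConvAlg where
  star_involutive f := by
    ext s
    simp only [star_apply, inv_inv, map_star, star_star, ← α.toAut_mul, mul_inv_cancel,
      α.toAut_one]
  star_mul := conv_star_mul
  star_add f h := by
    ext s
    simp only [star_apply, add_apply, star_add, map_add]

instance : IsScalarTower ℂ α.ConvAlg α.ConvAlg where
  smul_assoc c f h := by
    ext s
    simp only [smul_eq_mul, smul_apply, mul_apply, smul_mul_assoc]
    exact integral_smul c _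

instance : SMulCommClass ℂ α.ConvAlg α.ConvAlg where
  smul_comm c f h := by
    ext s
    simp only [smul_eq_mul, smul_apply, mul_apply, α.toAut_smul, mul_smul_comm]
    exact (integral_smul c _).symm

instance : StarModule ℂ α.ConvAlg where
  star_smul c f := by
    ext s
    simp only [star_apply, smul_apply, star_smul, α.toAut_smul]

/-- The norm `‖f‖₁ = ∫ ‖f(t)‖ dt` of `L¹(G, A, α)`, on `C(G, A)`. -/
def normL1 (α : CStarAction G A) : Seminorm ℂ α.ConvAlg :=
  Seminorm.of (fun f => ∫ t, ‖f t‖ ∂(haarProb G))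
    (fun f h => by
      rw [← integral_add (integrable_of_continuous f.continuous.norm)
        (integrable_of_continuous h.continuous.norm)]
      exact integral_mono (integrable_of_continuous (f + h).continuous.norm)
        ((integrable_of_continuous f.continuous.norm).add
          (integrable_of_continuous h.continuous.norm)) fun t => norm_add_le (f t) (h t))
    (fun c f => by
      simp only [smul_apply, norm_smul]
      exact integral_const_mul _ _)

end ConvAlg

variable [IsTopologicalGroup G] [CompactSpace G] [SecondCountableTopology G]
  [MeasurableSpace G] [BorelSpace G]

/-- The (full) crossed product `A ⋊_α G`, that is, the enveloping C⋆-algebra of `L¹(G, A, α)`: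
the completion of the convolution algebra `C(G, A)` in the largest C⋆-seminorm dominated by the
`L¹`-norm. -/
abbrev CrossedProduct (α : CStarAction G A) : Type max u v :=
  (CStarSeminorm.enveloping (ConvAlg.normL1 α)).Completion

end CStarAction

/-! ### Classes of C⋆-algebras -/

section Classes

variable (A : Type u) [NonUnitalCStarAlgebra A]

/-- `A` is σ-unital: it has a countable approximate unit (consisting of positive contractions). -/
def IsSigmaUnital : Prop :=
  ∃ e : ℕ → A, (∀ n, ‖e n‖ ≤ 1 ∧ ∃ c : A, e n = star c * c) ∧
    ∀ a : A, Tendsto (fun n => e n * a) atTop (𝓝 a) ∧ Tendsto (fun n => a * e n) atTop (𝓝 a)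

/-- `A` is purely infinite (in the sense of Kirchberg and Rørdam): there are no non-zero characters
on `A`, and, whenever `a` and `b` are positive with `a` in the closed two-sided ideal generated by
`b`, then `a` is the limit of a sequence `xₙ* b xₙ`. An element is positive if and only if it is
of the form `c* c`. -/
def IsPurelyInfinite : Prop :=
  (∀ χ : A →⋆ₙₐ[ℂ] ℂ, χ = 0) ∧
  ∀ a b : A, (∃ c : A, a = star c * c) → (∃ c : A, b = star c * c) →
    a ∈ closure (TwoSidedIdeal.span {b} : Set A) →
    ∃ x : ℕ → A, Tendsto (fun n => star (x n) * b * x n) atTop (𝓝 a)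

/-- `A` is simple: it is non-zero and has no closed two-sided ideals besides `0` and `A`. -/
def IsSimpleCStar : Prop :=
  Nontrivial A ∧ ∀ I : TwoSidedIdeal A, IsClosed (I : Set A) → I = ⊥ ∨ I = ⊤

open scoped CStarAlgebra ComplexOrder in
/-- `A` is nuclear: the identity map of `A` is a point-norm limit of completely positive
contractions that factor through full matrix algebras by completely positive contractions. -/
def IsNuclearCStar : Prop :=
  letI : PartialOrder A := CStarAlgebra.spectralOrder A
  haveI : StarOrderedRing A := CStarAlgebra.spectralOrderedRing A
  ∀ (F : Finset A) (ε : ℝ), 0 < ε →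
    ∃ (k : ℕ) (φ : A →CP CStarMatrix (Fin k) (Fin k) ℂ) (ψ : CStarMatrix (Fin k) (Fin k) ℂ →CP A),
      (∀ a, ‖φ a‖ ≤ ‖a‖) ∧ (∀ m, ‖ψ m‖ ≤ ‖m‖) ∧ ∀ a ∈ F, ‖ψ (φ a) - a‖ < ε

/-- A Kirchberg algebra is a purely infinite, simple, separable and nuclear C⋆-algebra. -/
structure IsKirchberg : Prop where
  purelyInfinite : IsPurelyInfinite A
  simple : IsSimpleCStar A
  separable : TopologicalSpace.SeparableSpace A
  nuclear : IsNuclearCStar A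

end Classes

end

/-! The proof has three ingredients.

(1) The fixed point algebra is an approximate retract of `A`. For `a` in `A`, the function `s ↦
α_s(a)` on `G` is invariant under translation combined with `α`, and `a ↦ (s ↦ α_s(a))` is
multiplicative. A Rokhlin homomorphism of `C(G)` for a separable invariant `D` turns such functions
into elements of `A_∞`. With a partition of unity `p_g` and an invariant approximate unit `e`, the
image of `a` is `∑ N(p_g) e α_g(a) e`, where `N` is a lift of the homomorphism. Lifting this to
sequences, evaluating at one large index and averaging over `G` gives completely positive
contractions `A → A^α` that are almost multiplicative on a given finite set and almost the identity
on given fixed points (`exists_approx_mul_map`, `exists_approx_retraction`). Comparison of positive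
elements, simplicity and nuclearity are statements about finitely many approximate relations, so
such maps carry them from `A` to `A^α`.

(2) Positive elements `a` of a purely infinite algebra are properly infinite: `a ⊕ a` is Cuntz
subequivalent to `a` (`mem_absorbedSet_self`, after Kirchberg and Rørdam). The elements `z` with `a
⊕ z* z` subequivalent to `a` form a closed ideal. For `a = s²` it contains every square-zero element
of the hereditary subalgebra of `s`, hence all commutators there, and the absence of characters then
forces it to contain `s`. This excludes characters on `A^α` and also yields approximate isometries
`S_i` with `S_i* a S_j` close to `a` for `i = j` and to `0` otherwise.

(3) The crossed product is compressed to `A^α`. A constant function `a` in the convolution algebra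
is formally `a p`, where `p = ∫ u_g dg` is the averaging projection, and `p (A ⋊ G) p` is the copy
`A^α p` of the fixed point algebra (`star_const_mul_mul_const_mem`). That this copy is isometric is
seen from the representation of the crossed product on the Hilbert `A^α`-module `A` with inner
product `E(a* b)`. The Rokhlin property makes the corner full in a strong sense: finite sums `∑ a_i
p a_i*` act almost as a unit (`exists_sum_approx_unit`). The approximate isometries of (2), taken in
`A^α`, merge the columns `a_i p` into one contraction `x` with `x x*` almost a unit and `x* (A ⋊ G)
x` inside `A^α` (`exists_compression`). Hence the identity of the crossed product is approximated by
`c ↦ x (x* c x) x*`, which factors through `A^α`, and all the properties pass from `A^α` to `A ⋊ G`.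
-/

/-! ### Closed ideals of C⋆-algebras -/

section ClosedIdeals

open scoped CStarAlgebra

variable {B : Type u} [NonUnitalCStarAlgebra B] [PartialOrder B] [StarOrderedRing B]

/-- The element `S (S + δ)⁻¹` of a C⋆-algebra, for `S ≥ 0` and `δ > 0`. -/
noncomputable def CStarAlgebra.cutoff (δ : ℝ) (S : B) : B := cfcₙ (fun t : ℝ => t / (t + δ)) S

namespace CStarAlgebra

theorem continuousOn_div_add {s : Set ℝ} {δ : ℝ} (hδ : 0 < δ) (hs : ∀ t ∈ s, 0 ≤ t) :
    ContinuousOn (fun t : ℝ => t / (t + δ)) s :=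
  continuousOn_id.div (by fun_prop) fun t ht => by
    have := hs t ht
    positivity

theorem cutoff_isSelfAdjoint (δ : ℝ) (S : B) : IsSelfAdjoint (cutoff δ S) :=
  cfcₙ_predicate _ _

theorem star_cutoff (δ : ℝ) (S : B) : star (cutoff δ S) = cutoff δ S :=
  cutoff_isSelfAdjoint δ S

/-- This expresses the cutoff through `S` and products with `S`, without a unit, so that it lies in
every closed ideal containing `S`. -/
theorem smul_cutoff {δ : ℝ} {S : B} (hδ : 0 < δ) (hS : 0 ≤ S) :
    δ • cutoff δ S = S - S * cutoff δ S := by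
  have hq := quasispectrum_nonneg_of_nonneg (𝕜 := ℝ) S hS
  have hc := continuousOn_div_add hδ hq
  have hc2 : ContinuousOn (fun t : ℝ => t * (t / (t + δ))) (quasispectrum ℝ S) :=
    continuousOn_id.mul hc
  have hc3 : ContinuousOn (fun t : ℝ => δ • (t / (t + δ))) (quasispectrum ℝ S) :=
    hc.const_smul δ
  have h1 : δ • cutoff δ S = cfcₙ (fun t : ℝ => δ • (t / (t + δ))) S :=
    (cfcₙ_smul δ (fun t : ℝ => t / (t + δ)) S hc (by simp)).symm
  have h2 : S * cutoff δ S = cfcₙ (fun t : ℝ => t * (t / (t + δ))) S := by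
    conv_lhs => rw [← cfcₙ_id' ℝ S]
    rw [cutoff, cfcₙ_id' ℝ S, cfcₙ_mul (fun t : ℝ => t) _ S continuousOn_id rfl hc (by simp),
      cfcₙ_id' ℝ S]
  rw [h1, h2, eq_sub_iff_add_eq, ← cfcₙ_add (hf := hc3) (hf0 := by simp)
    (hg := hc2) (hg0 := by simp)]
  conv_rhs => rw [← cfcₙ_id' ℝ S]
  refine cfcₙ_congr fun t ht => ?_
  have := hq t ht
  have h3 : t + δ ≠ 0 := by positivity
  simp only [smul_eq_mul]
  field_simp
  ring

theorem cutoff_eq {δ : ℝ} {S : B} (hδ : 0 < δ) (hS : 0 ≤ S) :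
    cutoff δ S = δ⁻¹ • (S - S * cutoff δ S) := by
  rw [← smul_cutoff hδ hS, smul_smul, inv_mul_cancel₀ hδ.ne', one_smul]

theorem norm_cutoff_le {δ : ℝ} {S : B} (hδ : 0 < δ) (hS : 0 ≤ S) : ‖cutoff δ S‖ ≤ 1 := by
  refine norm_cfcₙ_le fun t ht => ?_
  have := quasispectrum_nonneg_of_nonneg (𝕜 := ℝ) S hS t ht
  rw [Real.norm_of_nonneg (by positivity), div_le_one (by positivity)]
  linarith

/-- `cutoff δ S * cutoff δ S = k S k` for some self-adjoint `k`. -/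
theorem exists_cutoff_mul_self {δ : ℝ} {S : B} (hδ : 0 < δ) (hS : 0 ≤ S) :
    ∃ k : B, IsSelfAdjoint k ∧ cutoff δ S * cutoff δ S = k * S * k := by
  have hq := quasispectrum_nonneg_of_nonneg (𝕜 := ℝ) S hS
  have hc := continuousOn_div_add hδ hq
  have hk : ContinuousOn (fun t : ℝ => √t / (t + δ)) (quasispectrum ℝ S) :=
    Real.continuous_sqrt.continuousOn.div (by fun_prop) fun t ht => by
      have := hq t ht
      positivity
  refine ⟨cfcₙ (fun t : ℝ => √t / (t + δ)) S, cfcₙ_predicate _ _, ?_⟩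
  have h1 : cfcₙ (fun t : ℝ => √t / (t + δ)) S * S =
      cfcₙ (fun t : ℝ => √t / (t + δ) * t) S := by
    rw [cfcₙ_mul (fun t : ℝ => √t / (t + δ)) (fun t => t) S hk (by simp) continuousOn_id rfl,
      cfcₙ_id' ℝ S]
  have hk2 : ContinuousOn (fun t : ℝ => √t / (t + δ) * t) (quasispectrum ℝ S) :=
    hk.mul continuousOn_id
  rw [h1, cutoff, ← cfcₙ_mul (hf := hc) (hf0 := by simp) (hg := hc) (hg0 := by simp),
    ← cfcₙ_mul (hf := hk2) (hf0 := by simp) (hg := hk) (hg0 := by simp)]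
  refine cfcₙ_congr fun t ht => ?_
  have := hq t ht
  have h3 : t + δ ≠ 0 := by positivity
  field_simp
  rw [Real.sq_sqrt this, sq]

/-- In the unitization `1 - cutoff δ S` is `q = δ (S + δ)⁻¹`, and `q x* x q ≤ q (S + m) q`. The
function `δ² (t + m) / (t + δ)²` is at most `m + δ` for `t ≥ 0`. The slack `m` allows `x* x` to be
dominated only up to a scalar, which is how approximate membership in an ideal is detected below. -/
theorem norm_sub_mul_cutoff_sq_le' {x S : B} {m δ : ℝ} (hS : 0 ≤ S) (hm : 0 ≤ m) (hδ : 0 < δ)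
    (h : star (x : B⁺¹) * x ≤ S + algebraMap ℝ B⁺¹ m) :
    ‖x - x * cutoff δ S‖ ^ 2 ≤ m + δ := by
  set s : B⁺¹ := (S : B⁺¹) with hs
  have hs0 : 0 ≤ s := Unitization.inr_nonneg_iff.2 hS
  have hq := spectrum_nonneg_of_nonneg (𝕜 := ℝ) hs0
  have hc : ContinuousOn (fun t : ℝ => δ / (t + δ)) (spectrum ℝ s) :=
    continuousOn_const.div (by fun_prop) fun t ht => by
      have := hq ht
      positivity
  set q : B⁺¹ := cfc (fun t : ℝ => δ / (t + δ)) s with hqdef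
  have hqs : star q = q := (cfc_predicate (R := ℝ) _ _ : IsSelfAdjoint q)
  have h1 : ((cutoff δ S : B) : B⁺¹) = 1 - q := by
    rw [cutoff, Unitization.real_cfcₙ_eq_cfc_inr _ _ (by simp), eq_sub_iff_add_eq, hqdef,
      ← cfc_add (hf := continuousOn_div_add hδ fun t ht => hq ht) (hg := hc), ← cfc_one ℝ s]
    refine cfc_congr fun t ht => ?_
    have := hq ht
    have h3 : t + δ ≠ 0 := by positivity
    simp only [Pi.one_apply]
    field_simp
  have h2 : ((x - x * cutoff δ S : B) : B⁺¹) = x * q := by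
    rw [Unitization.inr_sub, Unitization.inr_mul, h1]; noncomm_ring
  have h4 : q * (s + algebraMap ℝ B⁺¹ m) * q =
      cfc (fun t : ℝ => δ / (t + δ) * (t + m) * (δ / (t + δ))) s := by
    have hc2 : ContinuousOn (fun t : ℝ => δ / (t + δ) * (t + m)) (spectrum ℝ s) :=
      hc.mul (by fun_prop)
    rw [cfc_mul (hf := hc2) (hg := hc), cfc_mul (hf := hc) (hg := by fun_prop),
      cfc_add_const m (fun t => t) s, cfc_id' ℝ s]
  rw [← Unitization.norm_inr (𝕜 := ℂ), h2, sq, ← CStarRing.norm_star_mul_self]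
  have h5 : star ((x : B⁺¹) * q) * (x * q) = star q * (star (x : B⁺¹) * x) * q := by
    rw [star_mul]; noncomm_ring
  have h6 : star ((x : B⁺¹) * q) * (x * q) ≤ q * (s + algebraMap ℝ B⁺¹ m) * q := by
    rw [h5]
    calc _ ≤ star q * (s + algebraMap ℝ B⁺¹ m) * q := star_left_conjugate_le_conjugate h q
      _ = _ := by rw [hqs]
  refine (norm_le_norm_of_nonneg_of_le (star_mul_self_nonneg _) h6).trans ?_
  rw [h4]
  refine norm_cfc_le (by positivity) fun t ht => ?_
  have ht0 := hq ht
  rw [Real.norm_of_nonneg (by positivity)]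
  have e : δ / (t + δ) * (t + m) * (δ / (t + δ)) =
      (δ / (t + δ)) * (t / (t + δ)) * δ + (δ / (t + δ)) * (δ / (t + δ)) * m := by
    have h3 : t + δ ≠ 0 := by positivity
    field_simp
  have a1 : δ / (t + δ) ≤ 1 := by rw [div_le_one (by positivity)]; linarith
  have a2 : t / (t + δ) ≤ 1 := by rw [div_le_one (by positivity)]; linarith
  have b1 : (δ / (t + δ)) * (t / (t + δ)) ≤ 1 := mul_le_one₀ a1 (by positivity) a2
  have b2 : (δ / (t + δ)) * (δ / (t + δ)) ≤ 1 := mul_le_one₀ a1 (by positivity) a1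
  rw [e]
  nlinarith

theorem norm_sub_mul_cutoff_sq_le {x S : B} {δ : ℝ} (hδ : 0 < δ) (h : star x * x ≤ S) :
    ‖x - x * cutoff δ S‖ ^ 2 ≤ δ := by
  have hS : 0 ≤ S := (star_mul_self_nonneg x).trans h
  have := norm_sub_mul_cutoff_sq_le' (x := x) hS le_rfl hδ (by
    rw [map_zero, add_zero, ← Unitization.inr_star, ← Unitization.inr_mul]
    exact (Unitization.inr_le_iff _ _ (.star_mul_self x) (.of_nonneg hS)).2 h)
  simpa using this

/-- If `x* x ≤ S` then `x` is approximated by `x S (S + δ)⁻¹`. -/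
theorem exists_norm_sub_mul_cutoff_lt {x S : B} (h : star x * x ≤ S) {ε : ℝ} (hε : 0 < ε) :
    ∃ δ : ℝ, 0 < δ ∧ ‖x - x * cutoff δ S‖ < ε := by
  refine ⟨(ε / 2) ^ 2, by positivity, ?_⟩
  have h1 := norm_sub_mul_cutoff_sq_le (x := x) (S := S) (δ := (ε / 2) ^ 2) (by positivity) h
  have := abs_le_of_sq_le_sq h1 (by positivity)
  rw [abs_norm] at this
  linarith

theorem exists_norm_sub_mul_lt (x : B) {ε : ℝ} (hε : 0 < ε) :
    ∃ e : B, ‖e‖ ≤ 1 ∧ ‖x - x * e‖ < ε := by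
  obtain ⟨δ, hδ, h⟩ := exists_norm_sub_mul_cutoff_lt (x := x) le_rfl hε
  exact ⟨_, norm_cutoff_le hδ (star_mul_self_nonneg x), h⟩

theorem exists_norm_sub_mul_lt_left (x : B) {ε : ℝ} (hε : 0 < ε) :
    ∃ e : B, ‖e‖ ≤ 1 ∧ ‖x - e * x‖ < ε := by
  obtain ⟨e, he, h⟩ := exists_norm_sub_mul_lt (star x) hε
  refine ⟨star e, by rwa [norm_star], ?_⟩
  rw [← norm_star]
  simpa using h

/-- If `0 ≤ a ≤ S` then `a` is a limit of elements `u* S u`. -/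
theorem exists_norm_sub_conj_lt {a S : B} (ha : 0 ≤ a) (h : a ≤ S) {ε : ℝ} (hε : 0 < ε) :
    ∃ u : B, ‖a - star u * S * u‖ < ε := by
  have hS := ha.trans h
  set w := CFC.sqrt a with hw
  have hws : star w = w := (CFC.sqrt_nonneg a).isSelfAdjoint
  have hww : w * w = a := CFC.sqrt_mul_sqrt_self a
  obtain ⟨δ, hδ, hlt⟩ := exists_norm_sub_mul_cutoff_lt (x := w) (S := S) (by rwa [hws, hww])
    (ε := ε / (2 * (‖w‖ + 1))) (by positivity)
  obtain ⟨k, hk, hkS⟩ := exists_cutoff_mul_self hδ hS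
  set r := cutoff δ S with hr
  -- With `r² = k S k` the conjugate of `S` by `k w` is `w r² w`, and `w r` is close to `w = √a`.
  refine ⟨k * w, ?_⟩
  have hrs : star r = r := star_cutoff δ S
  have e1 : star (k * w) * S * (k * w) = w * (r * r) * w := by
    rw [star_mul, hk.star_eq, hws, hkS]; noncomm_ring
  have e2 : a - star (k * w) * S * (k * w) = (w - w * r) * w + w * r * star (w - w * r) := by
    rw [e1, star_sub, star_mul, hws, hrs, ← hww]; noncomm_ring
  rw [e2]
  have hr1 : ‖r‖ ≤ 1 := norm_cutoff_le hδ hS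
  have n1 : ‖w * r‖ ≤ ‖w‖ :=
    (norm_mul_le _ _).trans (by nlinarith [norm_nonneg w])
  calc _ ≤ ‖w - w * r‖ * ‖w‖ + ‖w * r‖ * ‖w - w * r‖ := by
        refine (norm_add_le _ _).trans (add_le_add (norm_mul_le _ _) ((norm_mul_le _ _).trans ?_))
        rw [norm_star]
    _ ≤ ‖w - w * r‖ * (2 * ‖w‖) := by nlinarith [norm_nonneg (w - w * r)]
    _ < ε := by
        rw [lt_div_iff₀ (by positivity)] at hlt
        nlinarith [norm_nonneg w, norm_nonneg (w - w * r)]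

end CStarAlgebra

/-! ### Closed two-sided ideals: stability under scalars and adjoints, heredity, generation by
conjugates. -/

namespace TwoSidedIdeal

open CStarAlgebra

theorem mem_of_forall_norm_sub_lt {I : TwoSidedIdeal B} (hI : IsClosed (I : Set B)) {x : B}
    (h : ∀ ε > 0, ∃ y ∈ I, ‖x - y‖ < ε) : x ∈ I := by
  have : x ∈ closure (I : Set B) := Metric.mem_closure_iff.2 fun ε hε => by
    obtain ⟨y, hy, hlt⟩ := h ε hε
    exact ⟨y, hy, by rwa [dist_eq_norm]⟩
  rwa [hI.closure_eq] at this

/-- A ring ideal need not be stable under scalars; a closed one is, because `c • x` is approximated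
by `x * (c • e)` with `e` almost a unit for `x`. -/
theorem smul_mem_of_isClosed {I : TwoSidedIdeal B} (hI : IsClosed (I : Set B)) (c : ℂ) {x : B}
    (hx : x ∈ I) : c • x ∈ I := by
  refine mem_of_forall_norm_sub_lt hI fun ε hε => ?_
  obtain ⟨e, -, he⟩ := exists_norm_sub_mul_lt x (ε := ε / (‖c‖ + 1)) (by positivity)
  refine ⟨x * (c • e), I.mul_mem_right _ _ hx, ?_⟩
  rw [mul_smul_comm, ← smul_sub, norm_smul]
  rw [lt_div_iff₀ (by positivity)] at he
  nlinarith [norm_nonneg (x - x * e)]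

theorem real_smul_mem_of_isClosed {I : TwoSidedIdeal B} (hI : IsClosed (I : Set B)) (c : ℝ) {x : B}
    (hx : x ∈ I) : c • x ∈ I := by
  simpa using smul_mem_of_isClosed hI (c : ℂ) hx

theorem cutoff_mem {I : TwoSidedIdeal B} (hI : IsClosed (I : Set B)) {δ : ℝ} (hδ : 0 < δ) {S : B}
    (hS : 0 ≤ S) (h : S ∈ I) : cutoff δ S ∈ I := by
  rw [cutoff_eq hδ hS]
  exact real_smul_mem_of_isClosed hI _ (I.sub_mem h (I.mul_mem_right _ _ h))

/-- `x` is the limit of `x S (S + δ)⁻¹`, and these products lie in the ideal. -/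
theorem mem_of_star_mul_self_le_mem {I : TwoSidedIdeal B} (hI : IsClosed (I : Set B)) {x S : B}
    (h : star x * x ≤ S) (hS : S ∈ I) : x ∈ I := by
  refine mem_of_forall_norm_sub_lt hI fun ε hε => ?_
  obtain ⟨δ, hδ, hlt⟩ := exists_norm_sub_mul_cutoff_lt h hε
  exact ⟨_, I.mul_mem_left _ _ (cutoff_mem hI hδ ((star_mul_self_nonneg x).trans h) hS), hlt⟩

theorem mem_of_star_mul_self_mem {I : TwoSidedIdeal B} (hI : IsClosed (I : Set B)) {x : B}
    (h : star x * x ∈ I) : x ∈ I := mem_of_star_mul_self_le_mem hI le_rfl h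

theorem star_mem_of_isClosed {I : TwoSidedIdeal B} (hI : IsClosed (I : Set B)) {x : B}
    (hx : x ∈ I) : star x ∈ I :=
  mem_of_star_mul_self_mem hI (by rw [star_star]; exact I.mul_mem_right _ _ hx)

theorem mem_of_mul_star_self_mem {I : TwoSidedIdeal B} (hI : IsClosed (I : Set B)) {x : B}
    (h : x * star x ∈ I) : x ∈ I := by
  have := star_mem_of_isClosed hI (mem_of_star_mul_self_mem (x := star x) hI (by rwa [star_star]))
  rwa [star_star] at this

/-- The closure of a two-sided ideal. -/
def closedSpan (s : Set B) : TwoSidedIdeal B :=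
  .mk' (closure (span s : Set B))
    (subset_closure (zero_mem _))
    (fun hx hy => map_mem_closure₂ continuous_add hx hy fun _ ha _ hb => add_mem _ ha hb)
    (fun hx => map_mem_closure continuous_neg hx fun _ ha => neg_mem _ ha)
    (fun {x _} hy => map_mem_closure (continuous_const_mul x) hy fun _ ha => mul_mem_left _ _ _ ha)
    (fun {_ y} hx => map_mem_closure (f := (· * y)) (continuous_mul_const y) hx
      fun _ ha => mul_mem_right _ _ _ ha)

theorem mem_closedSpan {s : Set B} {x : B} :
    x ∈ closedSpan s ↔ x ∈ closure (span s : Set B) :=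
  mem_mk' (closure (span s : Set B)) _ _ _ _ _ x

theorem coe_closedSpan (s : Set B) : (closedSpan s : Set B) = closure (span s : Set B) :=
  Set.ext fun _ => mem_closedSpan

theorem isClosed_closedSpan (s : Set B) : IsClosed (closedSpan s : Set B) := by
  rw [coe_closedSpan]; exact isClosed_closure

theorem subset_closedSpan (s : Set B) : s ⊆ closedSpan s := by
  rw [coe_closedSpan]; exact subset_span.trans subset_closure

theorem closedSpan_le {s : Set B} {I : TwoSidedIdeal B} (hI : IsClosed (I : Set B))
    (h : s ⊆ I) : closedSpan s ≤ I := by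
  intro x hx
  rw [mem_closedSpan] at hx
  exact closure_minimal (span_le.2 h) hI hx

/-- The closure of the set of sums `∑ u_i b v_i` is a closed ideal, and it contains `b` itself since
`b ≈ f b e` for approximate units `f`, `e`. -/
theorem exists_sum_of_mem_closedSpan {a b : B} (ha : a ∈ closedSpan {b}) {ε : ℝ} (hε : 0 < ε) :
    ∃ (n : ℕ) (u v : Fin n → B), ‖a - ∑ i, u i * b * v i‖ < ε := by
  let T : Set B := {x | ∃ (n : ℕ) (u v : Fin n → B), x = ∑ i, u i * b * v i}
  have hadd : ∀ x ∈ T, ∀ y ∈ T, x + y ∈ T := by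
    rintro _ ⟨n, u, v, rfl⟩ _ ⟨m, u', v', rfl⟩
    exact ⟨n + m, Fin.append u u', Fin.append v v', by simp [Fin.sum_univ_add]⟩
  let I : TwoSidedIdeal B := .mk' (closure T)
    (subset_closure ⟨0, 0, 0, by simp⟩)
    (fun hx hy => map_mem_closure₂ continuous_add hx hy hadd)
    (fun hx => map_mem_closure continuous_neg hx fun x ⟨n, u, v, h⟩ =>
      ⟨n, -u, v, by simp [h]⟩)
    (fun {x _} hy => map_mem_closure (continuous_const_mul x) hy fun y ⟨n, u, v, h⟩ =>
      ⟨n, fun i => x * u i, v, by simp [h, Finset.mul_sum, mul_assoc]⟩)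
    (fun {_ y} hx => map_mem_closure (f := (· * y)) (continuous_mul_const y) hx fun x ⟨n, u, v, h⟩ =>
      ⟨n, u, fun i => v i * y, by simp [h, Finset.sum_mul, mul_assoc]⟩)
  have hIc : (I : Set B) = closure T := Set.ext fun x => mem_mk' (closure T) _ _ _ _ _ x
  have hIcl : IsClosed (I : Set B) := by rw [hIc]; exact isClosed_closure
  have hb : b ∈ I := by
    refine mem_of_forall_norm_sub_lt hIcl fun ε hε => ?_
    obtain ⟨e, he, h1⟩ := exists_norm_sub_mul_lt b (half_pos hε)
    obtain ⟨f, hf, h2⟩ := exists_norm_sub_mul_lt_left b (half_pos hε)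
    refine ⟨f * b * e, ?_, ?_⟩
    · change f * b * e ∈ (I : Set B)
      rw [hIc]
      exact subset_closure ⟨1, fun _ => f, fun _ => e, by simp⟩
    · have : b - f * b * e = (b - f * b) + f * (b - b * e) := by noncomm_ring
      rw [this]
      refine (norm_add_le _ _).trans_lt ?_
      have := norm_mul_le f (b - b * e)
      nlinarith [norm_nonneg (b - b * e)]
  have hle := closedSpan_le hIcl (Set.singleton_subset_iff.2 hb) ha
  change a ∈ (I : Set B) at hle
  rw [hIc] at hle
  obtain ⟨_, ⟨n, u, v, rfl⟩, hy⟩ := Metric.mem_closure_iff.1 hle ε hε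
  exact ⟨n, u, v, by rwa [← dist_eq_norm]⟩

/-- The difference of the two sides is half of the sum of all `(w_i - w_j)* (w_i - w_j)`. -/
theorem star_sum_mul_sum_le {n : ℕ} (w : Fin n → B) :
    star (∑ i, w i) * ∑ i, w i ≤ (n : ℝ) • ∑ i, star (w i) * w i := by
  have key : (n : ℝ) • ∑ i, star (w i) * w i - star (∑ i, w i) * ∑ i, w i =
      (2⁻¹ : ℝ) • ∑ i, ∑ j, star (w i - w j) * (w i - w j) := by
    have : ∀ i j, star (w i - w j) * (w i - w j) =
        star (w i) * w i + star (w j) * w j - star (w i) * w j - star (w j) * w i := by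
      intro i j; rw [star_sub]; noncomm_ring
    simp only [this, Finset.sum_sub_distrib, Finset.sum_add_distrib, Finset.sum_const,
      Finset.card_univ, Fintype.card_fin, star_sum, Finset.sum_mul_sum]
    rw [Finset.sum_comm (f := fun x y => star (w y) * w x), ← Finset.smul_sum,
      Nat.cast_smul_eq_nsmul]
    module
  rw [← sub_nonneg, key]
  exact smul_nonneg (by norm_num)
    (Finset.sum_nonneg fun i _ => Finset.sum_nonneg fun j _ => star_mul_self_nonneg _)

/-- A positive element of the closed ideal generated by a positive element `b` is a limit of
finite sums of elements `v* b v`. -/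
theorem exists_sum_conj_of_mem_closedSpan {a b : B} (ha : 0 ≤ a) (hb : 0 ≤ b)
    (hab : a ∈ closedSpan {b}) {ε : ℝ} (hε : 0 < ε) :
    ∃ (n : ℕ) (v : Fin n → B), ‖a - ∑ i, star (v i) * b * v i‖ < ε := by
  set w := CFC.sqrt a with hw
  have hws : star w = w := (CFC.sqrt_nonneg a).isSelfAdjoint
  have hww : w * w = a := CFC.sqrt_mul_sqrt_self a
  have hwI : w ∈ closedSpan {b} :=
    mem_of_star_mul_self_mem (isClosed_closedSpan _) (by rwa [hws, hww])
  obtain ⟨n, u, v, huv⟩ := exists_sum_of_mem_closedSpan hwI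
    (ε := min 1 (ε / (2 * (2 * ‖w‖ + 1)))) (by positivity)
  set w' := ∑ i, u i * b * v i with hw'
  -- The scalar absorbs all constants of the estimate `w'* w' ≤ n ∑ v_i* b u_i* u_i b v_i ≤ ∑ n
  -- ‖u_i‖² ‖b‖ v_i* b v_i`. After that, `w'* w'` is approximated by a conjugate of a dominating sum
  -- of the required form.
  set V : Fin n → B := fun i => √(n * (‖u i‖ ^ 2 * ‖b‖)) • v i with hV
  have hle : star w' * w' ≤ ∑ i, star (V i) * b * V i := by
    refine (star_sum_mul_sum_le _).trans ?_
    rw [Finset.smul_sum]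
    refine Finset.sum_le_sum fun i _ => ?_
    have e1 : star (V i) * b * V i = (n : ℝ) • ((‖u i‖ ^ 2 * ‖b‖) • (star (v i) * b * v i)) := by
      simp only [hV, star_smul, star_trivial, smul_mul_assoc, mul_smul_comm, smul_smul]
      rw [Real.mul_self_sqrt (by positivity)]
    rw [e1]
    refine smul_le_smul_of_nonneg_left ?_ (by positivity)
    have e2 : star (u i * b * v i) * (u i * b * v i) =
        star (v i) * (b * (star (u i) * u i) * b) * v i := by
      rw [star_mul, star_mul, (IsSelfAdjoint.of_nonneg hb).star_eq]; noncomm_ring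
    have e3 : (‖u i‖ ^ 2 * ‖b‖) • (star (v i) * b * v i) =
        star (v i) * ((‖u i‖ ^ 2 * ‖b‖) • b) * v i := by
      simp only [smul_mul_assoc, mul_smul_comm]
    rw [e2, e3]
    refine star_left_conjugate_le_conjugate ?_ _
    have e4 : b * (star (u i) * u i) * b ≤ ‖star (u i) * u i‖ • (star b * b) := by
      have := CStarAlgebra.star_left_conjugate_le_norm_smul (a := b) (b := star (u i) * u i)
      rwa [(IsSelfAdjoint.of_nonneg hb).star_eq] at this ⊢
    refine e4.trans ?_
    rw [CStarRing.norm_star_mul_self, ← sq, mul_smul]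
    refine smul_le_smul_of_nonneg_left ?_ (by positivity)
    set r := CFC.sqrt b
    have hrs : star r = r := (CFC.sqrt_nonneg b).isSelfAdjoint
    have hrr : r * r = b := CFC.sqrt_mul_sqrt_self b
    have e5 := CStarAlgebra.star_left_conjugate_le_norm_smul (a := r) (b := b)
    rw [hrs, hrr] at e5
    rw [(IsSelfAdjoint.of_nonneg hb).star_eq]
    refine le_trans (le_of_eq ?_) e5
    nth_rw 1 2 3 [← hrr]
    noncomm_ring
  obtain ⟨z, hz⟩ := exists_norm_sub_conj_lt (star_mul_self_nonneg w') hle (half_pos hε)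
  refine ⟨n, fun i => V i * z, ?_⟩
  have e6 : ∑ i, star (V i * z) * b * (V i * z) = star z * (∑ i, star (V i) * b * V i) * z := by
    rw [Finset.mul_sum, Finset.sum_mul]
    refine Finset.sum_congr rfl fun i _ => ?_
    rw [star_mul]; noncomm_ring
  rw [e6]
  have e7 : a - star z * (∑ i, star (V i) * b * V i) * z = (star (w - w') * w +
      star w' * (w - w')) + (star w' * w' - star z * (∑ i, star (V i) * b * V i) * z) := by
    rw [star_sub, hws, ← hww]; noncomm_ring
  rw [e7]
  refine (norm_add_le _ _).trans_lt ?_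
  have h1 : ‖w - w'‖ < 1 := huv.trans_le (min_le_left _ _)
  have h2 : ‖w - w'‖ < ε / (2 * (2 * ‖w‖ + 1)) := huv.trans_le (min_le_right _ _)
  rw [lt_div_iff₀ (by positivity)] at h2
  have h3 : ‖w'‖ ≤ ‖w‖ + 1 := by
    have := norm_sub_norm_le w' w
    rw [norm_sub_rev] at this
    linarith
  have h4 : ‖star (w - w') * w + star w' * (w - w')‖ ≤ ‖w - w'‖ * (2 * ‖w‖ + 1) := by
    refine (norm_add_le _ _).trans ((add_le_add (norm_mul_le _ _) (norm_mul_le _ _)).trans ?_)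
    rw [norm_star, norm_star]
    nlinarith [norm_nonneg (w - w')]
  linarith

end TwoSidedIdeal

end ClosedIdeals

/-! ### Quotient seminorms and characters -/

/-- The canonical map of `R` into its completion in a C⋆-seminorm, as a `*`-homomorphism. -/
noncomputable def CStarSeminorm.toComplHom {R : Type u} [NonUnitalRing R] [StarRing R] [Module ℂ R]
    (p : CStarSeminorm R) : R →⋆ₙₐ[ℂ] p.Completion where
  toFun x := p.toCompl x
  map_smul' c x := p.toCompl_smul c x
  map_zero' := map_zero p.toCompl
  map_add' x y := map_add p.toCompl x y
  map_mul' x y := p.toCompl_mul x y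
  map_star' x := p.toCompl_star x

section QuotientSeminorm

open scoped CStarAlgebra

variable {B : Type u} [NonUnitalCStarAlgebra B]

namespace CStarAlgebra

/-- This is the nontrivial half of the C⋆-identity for the quotient norm. For `k` the real part of
`j` one has `x* x ≤ m + k`, where `m = ‖x* x - j‖`, and `k` is dominated by a positive element of
the ideal plus a small scalar; subtracting from `x` its product with the cutoff of that element
leaves norm squared at most `m + ε`. -/
theorem exists_norm_sub_mem_sq_le [PartialOrder B] [StarOrderedRing B] {I : TwoSidedIdeal B}
    (hI : IsClosed (I : Set B)) {x j : B} (hj : j ∈ I) {ε : ℝ} (hε : 0 < ε) :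
    ∃ i ∈ I, ‖x - i‖ ^ 2 ≤ ‖star x * x - j‖ + ε := by
  have hj' := TwoSidedIdeal.star_mem_of_isClosed hI hj
  set k : B := (2⁻¹ : ℝ) • (j + star j) with hk
  have hks : IsSelfAdjoint k := by
    rw [IsSelfAdjoint, hk, star_smul, star_add, star_star, star_trivial, add_comm]
  have hkI : k ∈ I := TwoSidedIdeal.real_smul_mem_of_isClosed hI _ (I.add_mem hj hj')
  have hm : ‖star x * x - k‖ ≤ ‖star x * x - j‖ := by
    have e : star x * x - k =
        (2⁻¹ : ℝ) • ((star x * x - j) + star (star x * x - j)) := by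
      rw [hk, star_sub, star_mul, star_star]; module
    rw [e, norm_smul]
    have := norm_add_le (star x * x - j) (star (star x * x - j))
    rw [norm_star] at this
    rw [Real.norm_of_nonneg (by norm_num : (0 : ℝ) ≤ 2⁻¹)]
    linarith
  set m := ‖star x * x - j‖
  set S : B := (2 * ε)⁻¹ • (star k * k) with hS
  have hS0 : 0 ≤ S := smul_nonneg (by positivity) (star_mul_self_nonneg k)
  have hSI : S ∈ I := TwoSidedIdeal.real_smul_mem_of_isClosed hI _ (I.mul_mem_left _ _ hkI)
  refine ⟨x * cutoff (ε / 2) S, I.mul_mem_left _ _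
    (TwoSidedIdeal.cutoff_mem hI (by positivity) hS0 hSI), ?_⟩
  have h1 : ((star x * x - k : B) : B⁺¹) ≤ algebraMap ℝ B⁺¹ m := by
    have hsa : IsSelfAdjoint ((star x * x - k : B) : B⁺¹) :=
      ((IsSelfAdjoint.star_mul_self x).sub hks).inr ℂ
    refine hsa.le_algebraMap_norm_self.trans ?_
    rw [Unitization.norm_inr]
    exact algebraMap_mono _ hm
  -- Completing the square, `(k / t - t / 2)² ≥ 0` with `t² = 2 ε`. This replaces `k` by a multiple
  -- of `k²`, which is positive and still in the ideal.
  have h2 : (k : B⁺¹) ≤ (S : B⁺¹) + algebraMap ℝ B⁺¹ (ε / 2) := by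
    set t : ℝ := √(2 * ε) with ht
    have htt : t * t = 2 * ε := Real.mul_self_sqrt (by positivity)
    have htp : t ≠ 0 := by positivity
    have h3 := star_mul_self_nonneg (t⁻¹ • (k : B⁺¹) - (t / 2) • (1 : B⁺¹))
    rw [star_sub, star_smul, star_smul, star_one, star_trivial (t⁻¹), star_trivial (t / 2),
      (hks.inr ℂ).star_eq] at h3
    rw [← sub_nonneg]
    refine h3.trans_eq ?_
    clear_value k
    rw [hS, hks.star_eq, Unitization.inr_smul, Unitization.inr_mul, Algebra.algebraMap_eq_smul_one]
    simp only [sub_mul, mul_sub, smul_sub, smul_mul_assoc, mul_smul_comm, smul_smul, mul_one, one_mul,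
      ← mul_inv, htt]
    have e1 : t / 2 * t⁻¹ = 2⁻¹ := by field_simp
    have e2 : t⁻¹ * (t / 2) = 2⁻¹ := by field_simp
    have e3 : t / 2 * (t / 2) = ε / 2 := by linarith
    rw [e1, e2, e3]
    module
  have h4 := norm_sub_mul_cutoff_sq_le' (x := x) (S := S) (m := m + ε / 2) (δ := ε / 2) hS0
    (by positivity) (by positivity) (by
      have h5 := add_le_add h1 h2
      rw [Unitization.inr_sub, sub_add_cancel, Unitization.inr_mul, Unitization.inr_star] at h5
      refine h5.trans_eq ?_
      rw [map_add]; abel)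
  linarith

/-- The quotient seminorm `x ↦ dist(x, I)` of a closed two-sided ideal is a C⋆-seminorm. -/
noncomputable def quotSeminorm (I : TwoSidedIdeal B) (hI : IsClosed (I : Set B)) :
    CStarSeminorm B :=
  letI : PartialOrder B := CStarAlgebra.spectralOrder B
  haveI : StarOrderedRing B := CStarAlgebra.spectralOrderedRing B
  let S : Submodule ℂ B :=
    { carrier := I
      add_mem' := I.add_mem
      zero_mem' := I.zero_mem
      smul_mem' := fun c _ hx => TwoSidedIdeal.smul_mem_of_isClosed hI c hx }
  have hle : ∀ x i : B, i ∈ I → ‖S.mkQ x‖ ≤ ‖x - i‖ := fun x i hi => by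
    have : S.mkQ x = S.mkQ (x - i) := by
      rw [map_sub, (LinearMap.mem_ker).1 ((S.ker_mkQ).ge hi : i ∈ S.mkQ.ker), sub_zero]
    rw [this]
    exact Submodule.Quotient.norm_mk_le S _
  have hlt : ∀ (x : B) {ε : ℝ}, 0 < ε → ∃ i ∈ I, ‖x - i‖ < ‖S.mkQ x‖ + ε := fun x ε hε => by
    obtain ⟨m, hm, h⟩ := Submodule.Quotient.norm_mk_lt (S.mkQ x) hε
    refine ⟨x - m, ?_, by simpa using h⟩
    exact (Submodule.Quotient.eq S).1 hm.symm
  have hmul : ∀ x y : B, ‖S.mkQ (x * y)‖ ≤ ‖S.mkQ x‖ * ‖S.mkQ y‖ := fun x y => by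
    have hT : Tendsto (fun ε : ℝ => (‖S.mkQ x‖ + ε) * (‖S.mkQ y‖ + ε)) (𝓝[>] 0)
        (𝓝 (‖S.mkQ x‖ * ‖S.mkQ y‖)) := by
      refine tendsto_nhdsWithin_of_tendsto_nhds ?_
      have : Continuous fun ε : ℝ => (‖S.mkQ x‖ + ε) * (‖S.mkQ y‖ + ε) := by fun_prop
      simpa using this.tendsto 0
    refine ge_of_tendsto hT (eventually_mem_nhdsWithin.mono fun ε hε => ?_)
    obtain ⟨i, hi, h1⟩ := hlt x hε
    obtain ⟨j, hj, h2⟩ := hlt y hε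
    refine (hle (x * y) (i * y + (x - i) * j)
      (I.add_mem (I.mul_mem_right _ _ hi) (I.mul_mem_left _ _ hj))).trans ?_
    have : x * y - (i * y + (x - i) * j) = (x - i) * (y - j) := by noncomm_ring
    rw [this]
    exact (norm_mul_le _ _).trans (mul_le_mul h1.le h2.le (norm_nonneg _)
      (add_nonneg (norm_nonneg _) (le_of_lt hε)))
  have hstar : ∀ x : B, ‖S.mkQ (star x)‖ ≤ ‖S.mkQ x‖ := fun x => by
    refine le_of_forall_pos_le_add fun ε hε => ?_
    obtain ⟨i, hi, h1⟩ := hlt x hε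
    refine (hle _ _ (TwoSidedIdeal.star_mem_of_isClosed hI hi)).trans ?_
    rw [← star_sub, norm_star]
    exact h1.le
  { toSeminorm := (normSeminorm ℂ (B ⧸ S)).comp S.mkQ
    mul_le' := hmul
    star_mul_self' := fun x => by
      change ‖S.mkQ (star x * x)‖ = ‖S.mkQ x‖ ^ 2
      apply le_antisymm
      · refine (hmul _ _).trans ?_
        rw [sq]
        exact mul_le_mul_of_nonneg_right (hstar x) (norm_nonneg _)
      · refine le_of_forall_pos_le_add fun ε hε => ?_
        obtain ⟨j, hj, h1⟩ := hlt (star x * x) (half_pos hε)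
        obtain ⟨i, hi, h2⟩ := exists_norm_sub_mem_sq_le hI (x := x) hj (half_pos hε)
        have := pow_le_pow_left₀ (norm_nonneg _) (hle x i hi) 2
        linarith }

theorem quotSeminorm_eq_zero_iff {I : TwoSidedIdeal B} (hI : IsClosed (I : Set B)) {x : B} :
    (quotSeminorm I hI).toSeminorm x = 0 ↔ x ∈ I := by
  let S : Submodule ℂ B :=
    { carrier := I
      add_mem' := I.add_mem
      zero_mem' := I.zero_mem
      smul_mem' := fun c _ hx =>
        letI : PartialOrder B := CStarAlgebra.spectralOrder B
        haveI : StarOrderedRing B := CStarAlgebra.spectralOrderedRing B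
        TwoSidedIdeal.smul_mem_of_isClosed hI c hx }
  change ‖(Submodule.Quotient.mk x : B ⧸ S)‖ = 0 ↔ x ∈ I
  let _ : PartialOrder B := CStarAlgebra.spectralOrder B
  have _ : StarOrderedRing B := CStarAlgebra.spectralOrderedRing B
  constructor
  · intro h
    refine TwoSidedIdeal.mem_of_forall_norm_sub_lt hI fun ε hε => ?_
    obtain ⟨m, hm, hlt⟩ := Submodule.Quotient.norm_mk_lt (Submodule.Quotient.mk x : B ⧸ S) hε
    rw [h, zero_add] at hlt
    exact ⟨x - m, (Submodule.Quotient.eq S).1 hm.symm, by simpa using hlt⟩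
  · intro h
    rw [(Submodule.Quotient.mk_eq_zero S).2 h, norm_zero]

/-- If `B` has no non-zero characters, then a closed two-sided ideal that contains all commutators
is everything. -/
theorem mem_of_forall_commutator_mem {I : TwoSidedIdeal B} (hI : IsClosed (I : Set B))
    (hχ : ∀ χ : B →⋆ₙₐ[ℂ] ℂ, χ = 0) (hcomm : ∀ x y : B, x * y - y * x ∈ I) (x : B) : x ∈ I := by
  set p := quotSeminorm I hI with hp
  have hpx : ∀ x : p.Space, p.toCompl x = 0 ↔ (x : B) ∈ I := fun x => by
    rw [← norm_eq_zero, p.norm_toCompl, p.norm_def]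
    exact quotSeminorm_eq_zero_iff hI
  have hc : ∀ a b : p.Completion, a * b = b * a := fun a b => by
    induction a using p.induction_on with
    | hc => exact isClosed_eq (by fun_prop) (by fun_prop)
    | h a =>
    induction b using p.induction_on with
    | hc => exact isClosed_eq (by fun_prop) (by fun_prop)
    | h b =>
      rw [← sub_eq_zero, ← p.toCompl_mul, ← p.toCompl_mul, ← map_sub]
      exact (hpx _).2 (hcomm a b)
  let _ : NonUnitalCommCStarAlgebra p.Completion :=
    { (inferInstance : NonUnitalCStarAlgebra p.Completion) with mul_comm := hc }
  refine (hpx x).1 ?_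
  -- The quotient by `I` is commutative, and every character of its unitization restricts to a
  -- character of `B`, which vanishes. So Gelfand transforms of elements coming from `B` are zero,
  -- and the Gelfand transform is isometric.
  have h0 : WeakDual.gelfandTransform ℂ (Unitization ℂ p.Completion)
      (Unitization.inr (p.toCompl x)) = 0 := by
    ext ψ
    let χ : Unitization ℂ p.Completion →⋆ₙₐ[ℂ] ℂ :=
      { toFun := ψ
        map_smul' := fun c b => map_smul ψ c b
        map_zero' := map_zero ψ
        map_add' := map_add ψ
        map_mul' := map_mul ψ
        map_star' := map_star ψ }
    exact DFunLike.congr_fun (hχ ((χ.comp (Unitization.inrNonUnitalStarAlgHom ℂ _)).comp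
      p.toComplHom)) x
  have h1 := (gelfandTransform_isometry (Unitization ℂ p.Completion)).norm_map_of_map_zero
    (map_zero _) (Unitization.inr (p.toCompl x))
  rw [h0, norm_zero, Unitization.norm_inr] at h1
  exact norm_eq_zero.1 h1.symm

end CStarAlgebra

end QuotientSeminorm

/-! ### Purely infinite C⋆-algebras: positive elements are properly infinite -/

section ProperlyInfinite

open scoped CStarAlgebra

variable {B : Type u} [NonUnitalCStarAlgebra B]

namespace CStarAlgebra

/-- The triples `(x* a x, y* a y, x* a y)`. -/
def comparisonSet (a : B) : Set (B × B × B) :=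
  Set.range fun q : B × B => (star q.1 * a * q.1, star q.2 * a * q.2, star q.1 * a * q.2)

/-- The elements `q` for which `a ⊕ q` is Cuntz subequivalent to `a`. -/
def absorbedSet (a : B) : Set B := {q | (a, q, 0) ∈ closure (comparisonSet a)}

theorem isClosed_absorbedSet (a : B) : IsClosed (absorbedSet a) :=
  isClosed_closure.preimage (by fun_prop : Continuous fun q : B => (a, q, (0 : B)))

/-- Subequivalence is iterated: if `a ⊕ q'` is below `a`, then `a ⊕ q' ⊕ q` is below `a ⊕ q`, hence
below `a`. The pair `(x', y')` is held fixed while `(x, y)` goes to its limit, and only then varies.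
-/
theorem add_mem_absorbedSet {a q q' : B} (ha : IsSelfAdjoint a) (hq : q ∈ absorbedSet a)
    (hq' : q' ∈ absorbedSet a) : q' + q ∈ absorbedSet a := by
  have h1 : ∀ x' y' : B, (star x' * a * x', star y' * a * y' + q, star x' * a * y') ∈
      closure (comparisonSet a) := fun x' y' => by
    have hc : Continuous fun t : B × B × B => (star x' * t.1 * x',
        star y' * t.1 * y' + t.2.1 + star y' * t.2.2 + star t.2.2 * y',
        star x' * t.1 * y' + star x' * t.2.2) := by fun_prop
    have := map_mem_closure hc hq (t := comparisonSet a) ?_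
    · simpa using this
    · rintro _ ⟨⟨x, y⟩, rfl⟩
      -- Composition of the two comparisons. Since `x* a x ≈ a`, `y* a y ≈ q` and `x* a y ≈ 0`, the
      -- second column has square about `y'* a y' + q`.
      refine ⟨(x * x', x * y' + y), ?_⟩
      simp only [star_add, star_mul, star_star, ha.star_eq]
      refine Prod.ext ?_ (Prod.ext ?_ ?_) <;> simp only [] <;> noncomm_ring
  have hc : Continuous fun t : B × B × B => (t.1, t.2.1 + q, t.2.2) := by fun_prop
  have := map_mem_closure hc hq' (t := closure (comparisonSet a)) ?_
  · rwa [closure_closure] at this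
  · rintro _ ⟨⟨x', y'⟩, rfl⟩
    exact h1 x' y'

theorem conj_mem_absorbedSet {a q : B} (hq : q ∈ absorbedSet a) (u : B) :
    star u * q * u ∈ absorbedSet a := by
  have hc : Continuous fun t : B × B × B => (t.1, star u * t.2.1 * u, t.2.2 * u) := by fun_prop
  have := map_mem_closure hc hq (t := comparisonSet a) ?_
  · simpa [absorbedSet] using this
  · rintro _ ⟨⟨x, y⟩, rfl⟩
    refine ⟨(x, y * u), ?_⟩
    simp only [star_mul, mul_assoc]

theorem smul_mem_absorbedSet {a q : B} (hq : q ∈ absorbedSet a) {r : ℝ} (hr : 0 ≤ r) :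
    r • q ∈ absorbedSet a := by
  have hc : Continuous fun t : B × B × B => (t.1, r • t.2.1, √r • t.2.2) := by fun_prop
  have := map_mem_closure hc hq (t := comparisonSet a) ?_
  · simpa [absorbedSet] using this
  · rintro _ ⟨⟨x, y⟩, rfl⟩
    refine ⟨(x, √r • y), ?_⟩
    simp only [star_smul, star_trivial, smul_mul_assoc, mul_smul_comm, smul_smul,
      Real.mul_self_sqrt hr]

variable [PartialOrder B] [StarOrderedRing B]

/-- A smaller positive element is a limit of conjugates of the larger one, and the absorbed set is
closed and stable under conjugation. -/
theorem mem_absorbedSet_of_le {a q q' : B} (hq : q ∈ absorbedSet a) (h0 : 0 ≤ q') (h : q' ≤ q) :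
    q' ∈ absorbedSet a := by
  rw [← (isClosed_absorbedSet a).closure_eq]
  refine Metric.mem_closure_iff.2 fun ε hε => ?_
  obtain ⟨u, hu⟩ := exists_norm_sub_conj_lt h0 h hε
  exact ⟨_, conj_mem_absorbedSet hq u, by rwa [dist_eq_norm]⟩

/-- The closed ideal of all `z` for which `a ⊕ z* z` is Cuntz subequivalent to `a`, provided that
`0` is such an element. -/
def absorbedIdeal (a : B) (ha : IsSelfAdjoint a) (h0 : 0 ∈ absorbedSet a) : TwoSidedIdeal B :=
  .mk' {z | star z * z ∈ absorbedSet a}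
    (by simpa using h0)
    (by
      intro x y hx hy
      -- The bound used is `(x + y)* (x + y) ≤ 2 (x* x + y* y)`.
      have h := smul_mem_absorbedSet (add_mem_absorbedSet ha hx hy) (zero_le_two (α := ℝ))
      refine mem_absorbedSet_of_le h (star_mul_self_nonneg _) ?_
      rw [← sub_nonneg]
      refine (star_mul_self_nonneg (x - y)).trans_eq ?_
      simp only [star_sub, star_add, two_smul]
      noncomm_ring)
    (by
      intro x hx
      simpa using hx)
    (by
      intro x y hy
      refine mem_absorbedSet_of_le (smul_mem_absorbedSet hy (norm_nonneg (star x * x)))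
        (star_mul_self_nonneg _) ?_
      have e : star (x * y) * (x * y) = star y * (star x * x) * y := by
        rw [star_mul]; noncomm_ring
      rw [e]
      exact star_left_conjugate_le_norm_smul)
    (by
      intro x y hx
      have e : star (x * y) * (x * y) = star y * (star x * x) * y := by
        rw [star_mul]; noncomm_ring
      rw [Set.mem_ofPred_eq, e]
      exact conj_mem_absorbedSet hx y)

theorem mem_absorbedIdeal {a : B} {ha : IsSelfAdjoint a} {h0 : 0 ∈ absorbedSet a} {z : B} :
    z ∈ absorbedIdeal a ha h0 ↔ star z * z ∈ absorbedSet a :=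
  TwoSidedIdeal.mem_mk' {z | star z * z ∈ absorbedSet a} _ _ _ _ _ z

theorem isClosed_absorbedIdeal {a : B} (ha : IsSelfAdjoint a) (h0 : 0 ∈ absorbedSet a) :
    IsClosed (absorbedIdeal a ha h0 : Set B) := by
  have : (absorbedIdeal a ha h0 : Set B) = (fun z => star z * z) ⁻¹' absorbedSet a :=
    Set.ext fun _ => mem_absorbedIdeal
  rw [this]
  exact (isClosed_absorbedSet a).preimage (by fun_prop)

/-- The closed right ideal generated by `s`. -/
def rightSpan (s : B) : Set B := closure (Set.range (s * ·))

theorem isClosed_rightSpan (s : B) : IsClosed (rightSpan s) := isClosed_closure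

theorem mul_mem_rightSpan (s b : B) : s * b ∈ rightSpan s := subset_closure ⟨b, rfl⟩

theorem rightSpan_mul {s x : B} (hx : x ∈ rightSpan s) (y : B) : x * y ∈ rightSpan s :=
  map_mem_closure (f := (· * y)) (continuous_mul_const y) hx
    (by rintro _ ⟨b, rfl⟩; exact ⟨b * y, (mul_assoc _ _ _).symm⟩)

theorem rightSpan_add {s x y : B} (hx : x ∈ rightSpan s) (hy : y ∈ rightSpan s) :
    x + y ∈ rightSpan s :=
  map_mem_closure₂ continuous_add hx hy
    (by rintro _ ⟨b, rfl⟩ _ ⟨c, rfl⟩; exact ⟨b + c, mul_add _ _ _⟩)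

theorem rightSpan_smul {s x : B} (c : ℂ) (hx : x ∈ rightSpan s) : c • x ∈ rightSpan s :=
  map_mem_closure (continuous_const_smul c) hx
    (by rintro _ ⟨b, rfl⟩; exact ⟨c • b, mul_smul_comm _ _ _⟩)

theorem rightSpan_sub {s x y : B} (hx : x ∈ rightSpan s) (hy : y ∈ rightSpan s) :
    x - y ∈ rightSpan s := by
  rw [sub_eq_add_neg, ← neg_one_smul ℂ]
  exact rightSpan_add hx (rightSpan_smul _ hy)

theorem zero_mem_rightSpan (s : B) : (0 : B) ∈ rightSpan s := by
  simpa using mul_mem_rightSpan s 0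

/-- The hereditary subalgebra generated by `s`. -/
def hereditary (s : B) : NonUnitalStarSubalgebra ℂ B where
  carrier := {x | x ∈ rightSpan s ∧ star x ∈ rightSpan s}
  add_mem' hx hy := ⟨rightSpan_add hx.1 hy.1, by rw [star_add]; exact rightSpan_add hx.2 hy.2⟩
  zero_mem' := ⟨zero_mem_rightSpan s, by rw [star_zero]; exact zero_mem_rightSpan s⟩
  mul_mem' hx hy := ⟨rightSpan_mul hx.1 _, by rw [star_mul]; exact rightSpan_mul hy.2 _⟩
  smul_mem' c _ hx := ⟨rightSpan_smul c hx.1, by rw [star_smul]; exact rightSpan_smul _ hx.2⟩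
  star_mem' hx := ⟨hx.2, by rw [star_star]; exact hx.1⟩

instance isClosed_hereditary (s : B) : IsClosed (hereditary s : Set B) :=
  (isClosed_rightSpan s).inter ((isClosed_rightSpan s).preimage continuous_star)

/-- Vectors of the closed right ideal are limits of `s x`, and `(s x)* (s y) = x* s² y`. Thus
orthogonal vectors in the right ideal of `s` give orthogonal parts below `s²`. -/
theorem mem_closure_comparisonSet {s ξ η : B} (hs : IsSelfAdjoint s) (hξ : ξ ∈ rightSpan s)
    (hη : η ∈ rightSpan s) :
    (star ξ * ξ, star η * η, star ξ * η) ∈ closure (comparisonSet (s * s)) := by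
  have hc : Continuous fun t : B × B => (star t.1 * t.1, star t.2 * t.2, star t.1 * t.2) := by
    fun_prop
  have h1 : (ξ, η) ∈ closure (Set.range (s * ·) ×ˢ Set.range (s * ·)) := by
    rw [closure_prod_eq]
    exact ⟨hξ, hη⟩
  refine map_mem_closure (f := fun t : B × B => (star t.1 * t.1, star t.2 * t.2, star t.1 * t.2))
    hc h1 ?_
  rintro ⟨_, _⟩ ⟨⟨x, rfl⟩, ⟨y, rfl⟩⟩
  refine ⟨(x, y), ?_⟩
  simp only [star_mul, hs.star_eq, mul_assoc]

end CStarAlgebra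

theorem IsPurelyInfinite.exists_norm_conj_sub_lt [PartialOrder B] [StarOrderedRing B]
    (h : IsPurelyInfinite B) {a b : B} (ha : 0 ≤ a) (hb : 0 ≤ b)
    (hab : a ∈ TwoSidedIdeal.closedSpan {b}) {ε : ℝ} (hε : 0 < ε) :
    ∃ x : B, ‖star x * b * x - a‖ < ε := by
  obtain ⟨x, hx⟩ := h.2 a b (CStarAlgebra.nonneg_iff_eq_star_mul_self.1 ha)
    (CStarAlgebra.nonneg_iff_eq_star_mul_self.1 hb) (TwoSidedIdeal.mem_closedSpan.1 hab)
  obtain ⟨n, hn⟩ := ((Metric.tendsto_nhds.1 hx) ε hε).exists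
  exact ⟨x n, by rwa [← dist_eq_norm]⟩

/-! ### Proper infiniteness: square-zero elements, commutators and the exchange relation. -/

namespace CStarAlgebra

variable [PartialOrder B] [StarOrderedRing B]

theorem zero_mem_absorbedSet (h : IsPurelyInfinite B) {s : B} (hs : IsSelfAdjoint s) :
    0 ∈ absorbedSet (s * s) := by
  have h0 : 0 ≤ s * s := by simpa [hs.star_eq] using star_mul_self_nonneg s
  refine Metric.mem_closure_iff.2 fun ε hε => ?_
  obtain ⟨x, hx⟩ := h.exists_norm_conj_sub_lt h0 h0
    (TwoSidedIdeal.subset_closedSpan _ rfl) hε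
  refine ⟨_, ⟨(x, 0), rfl⟩, ?_⟩
  rw [Prod.dist_eq, Prod.dist_eq]
  rw [norm_sub_rev] at hx
  simpa [dist_eq_norm, hε] using hx

/-- In a purely infinite C⋆-algebra, the hereditary subalgebra of `s` absorbs its square-zero
elements. -/
theorem mem_absorbedIdeal_of_mul_self_eq_zero (h : IsPurelyInfinite B) {s x : B}
    (hs : IsSelfAdjoint s) (hx : x ∈ hereditary s) (hxx : x * x = 0)
    (hs2 : IsSelfAdjoint (s * s)) (h0 : 0 ∈ absorbedSet (s * s)) :
    x ∈ absorbedIdeal (s * s) hs2 h0 := by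
  have hIc := isClosed_absorbedIdeal hs2 h0
  set I := absorbedIdeal (s * s) hs2 h0
  set c := star x * x with hc
  have hc0 : 0 ≤ c := star_mul_self_nonneg x
  have hcs : IsSelfAdjoint c := .of_nonneg hc0
  have hq := quasispectrum_nonneg_of_nonneg (𝕜 := ℝ) c hc0
  have hcR : c ∈ rightSpan s := rightSpan_mul hx.2 x
  refine TwoSidedIdeal.mem_of_star_mul_self_mem hIc
    (TwoSidedIdeal.mem_of_forall_norm_sub_lt hIc fun ε' hε' => ?_)
  obtain ⟨ε, hε, hεε⟩ := exists_between hε'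
  have hmax : ∀ t : ℝ, max t ε ≠ 0 := fun t => (lt_max_of_lt_right hε).ne'
  have hhc : Continuous fun t : ℝ => t / max t ε ^ 2 :=
    continuous_id.div (by fun_prop) fun t => pow_ne_zero 2 (hmax t)
  have hnc : Continuous fun t : ℝ => max (t - ε) 0 / max t ε :=
    Continuous.div (by fun_prop) (by fun_prop) hmax
  have hn0 : max ((0 : ℝ) - ε) 0 / max 0 ε = 0 := by
    rw [max_eq_right (by linarith), zero_div]
  -- `g = c H` is a function of `c` equal to `1` where `c ≥ ε`, and `η = c N` is `(c - ε)_+`. Both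
  -- are written with an explicit factor `c`, so that they lie in the right ideal of `s`; also `g =
  -- H c` annihilates `x` from the left because `c x = x* x x = 0`.
  set H := cfcₙ (fun t : ℝ => t / max t ε ^ 2) c with hH
  set N := cfcₙ (fun t : ℝ => max (t - ε) 0 / max t ε) c with hN
  have hcN : c * N = cfcₙ (fun t : ℝ => t * (max (t - ε) 0 / max t ε)) c := by
    rw [hN, cfcₙ_mul (fun t : ℝ => t) _ c continuousOn_id rfl hnc.continuousOn hn0, cfcₙ_id' ℝ c]
  have hcH : c * H = cfcₙ (fun t : ℝ => t * (t / max t ε ^ 2)) c := by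
    rw [hH, cfcₙ_mul (fun t : ℝ => t) _ c continuousOn_id rfl hhc.continuousOn (by simp),
      cfcₙ_id' ℝ c]
  have hHc : H * c = cfcₙ (fun t : ℝ => t * (t / max t ε ^ 2)) c := by
    rw [hH]
    nth_rw 2 [← cfcₙ_id' ℝ c]
    rw [← cfcₙ_mul (fun t : ℝ => t / max t ε ^ 2) (fun t : ℝ => t) c hhc.continuousOn (by simp)
      continuousOn_id rfl]
    exact cfcₙ_congr fun t _ => mul_comm _ _
  set η := c * N with hη
  set g := c * H with hg
  have hf1 : Continuous fun t : ℝ => t * (t / max t ε ^ 2) := continuous_id.mul hhc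
  have hf2 : Continuous fun t : ℝ => t * (max (t - ε) 0 / max t ε) := continuous_id.mul hnc
  have hgη : g * η = η := by
    rw [hcH, hcN, ← cfcₙ_mul (fun t : ℝ => t * (t / max t ε ^ 2)) _ c hf1.continuousOn (by simp)
      hf2.continuousOn (by simp)]
    refine cfcₙ_congr fun t ht => ?_
    rcases le_total t ε with h | h
    · rw [max_eq_right (by linarith : t - ε ≤ 0), zero_div, mul_zero, mul_zero]
    · rw [max_eq_left h]
      have : t ≠ 0 := by linarith
      field_simp
  have hgx : g * x = 0 := by
    rw [hcH, ← hHc, mul_assoc, hc, mul_assoc, hxx, mul_zero, mul_zero]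
  have hgs : star g = g := by
    rw [hcH]
    exact (cfcₙ_predicate (R := ℝ) (fun t : ℝ => t * (t / max t ε ^ 2)) c : IsSelfAdjoint _).star_eq
  have hηR : η ∈ rightSpan s := rightSpan_mul hcR N
  have hcη : ‖c - η‖ < ε' := by
    have e : c - η = cfcₙ (fun t : ℝ => t - t * (max (t - ε) 0 / max t ε)) c := by
      rw [cfcₙ_sub (fun t : ℝ => t) _ c continuousOn_id rfl hf2.continuousOn (by simp),
        cfcₙ_id' ℝ c, hcN]
    rw [e]
    refine (norm_cfcₙ_le fun t ht => ?_).trans_lt hεε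
    have ht0 := hq t ht
    rcases le_total t ε with h | h
    · rw [max_eq_right (by linarith : t - ε ≤ 0), zero_div, mul_zero, sub_zero,
        Real.norm_of_nonneg ht0]
      exact h
    · rw [max_eq_left h, max_eq_left (by linarith : (0 : ℝ) ≤ t - ε)]
      have : t ≠ 0 := by linarith
      have e2 : t - t * ((t - ε) / t) = ε := by field_simp; ring
      rw [e2, Real.norm_of_nonneg hε.le]
  refine ⟨η, ?_, hcη⟩
  -- `w = (1 - g) s` is orthogonal to `η` because `g η = η`.
  set w := s - g * s with hw
  have hwη : star w * η = 0 := by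
    rw [hw, star_sub, star_mul, hgs, hs.star_eq, sub_mul, mul_assoc, hgη, sub_self]
  set e := w * star w with he
  have hes : star e = e := by rw [he, star_mul, star_star]
  have heR : e ∈ rightSpan s := by
    have : e = s * star w - g * (s * star w) := by rw [he, hw]; noncomm_ring
    rw [this]
    refine rightSpan_sub (mul_mem_rightSpan _ _) (rightSpan_mul (rightSpan_mul hcR _) _)
  -- The part of `s²` away from `η` still generates everything. The ideal contains `w`, hence `x =
  -- (1 - g) x`, hence `g = H x* x`, and finally `s = w + g s`.
  set K := TwoSidedIdeal.closedSpan {e * e} with hK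
  have hKc : IsClosed (K : Set B) := TwoSidedIdeal.isClosed_closedSpan _
  have heeK : e * e ∈ K := TwoSidedIdeal.subset_closedSpan _ rfl
  have heK : e ∈ K := TwoSidedIdeal.mem_of_star_mul_self_mem hKc (by rwa [hes])
  have hwK : w ∈ K := TwoSidedIdeal.mem_of_mul_star_self_mem hKc heK
  have hxK : x ∈ K := by
    have h1 : x - g * x ∈ closure (K : Set B) := by
      refine map_mem_closure (f := fun y => y - g * y) (by fun_prop) hx.1 ?_
      rintro _ ⟨b, rfl⟩
      have : s * b - g * (s * b) = w * b := by rw [hw]; noncomm_ring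
      simp only [this]
      exact K.mul_mem_right _ _ hwK
    rwa [hKc.closure_eq, hgx, sub_zero] at h1
  have hsK : s ∈ K := by
    have : s = w + g * s := by rw [hw]; abel
    rw [this]
    exact K.add_mem hwK (K.mul_mem_right _ _ (K.mul_mem_right _ _ (K.mul_mem_left _ _ hxK)))
  have hss : 0 ≤ s * s := by simpa [hs.star_eq] using star_mul_self_nonneg s
  have hee : 0 ≤ e * e := by simpa [hes] using star_mul_self_nonneg e
  rw [mem_absorbedIdeal]
  refine Metric.mem_closure_iff.2 fun ρ hρ => ?_
  -- Pure infiniteness recovers `s²` as `(e u)* (e u)`, with `e u` orthogonal to `η`. So `s² ⊕ η* η`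
  -- is below `s²`.
  obtain ⟨u, hu⟩ := h.exists_norm_conj_sub_lt hss hee (K.mul_mem_right _ _ hsK) (half_pos hρ)
  have h1 : e * η = 0 := by rw [he, mul_assoc, hwη, mul_zero]
  have h2 := mem_closure_comparisonSet hs (rightSpan_mul heR u) hηR
  obtain ⟨t, ht, hlt⟩ := Metric.mem_closure_iff.1 h2 _ (half_pos hρ)
  refine ⟨t, ht, ?_⟩
  refine (dist_triangle _ _ _).trans_lt ((add_lt_add_of_lt_of_le ?_ hlt.le).trans_eq
    (add_halves ρ))
  have e1 : star (e * u) * (e * u) = star u * (e * e) * u := by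
    rw [star_mul, hes]; noncomm_ring
  have e2 : star (e * u) * η = 0 := by rw [star_mul, hes, mul_assoc, h1, mul_zero]
  rw [e1, e2, Prod.dist_eq, Prod.dist_eq]
  rw [norm_sub_rev] at hu
  simpa [dist_eq_norm, hρ] using hu

/-- The functions need not vanish at `0`, so `f(h)` and `σ(h)` live only in the unitization; after
splitting off the scalars `f 0` and `σ 0`, the sandwich around `y` expands into elements of the
hereditary subalgebra. -/
theorem exists_mem_hereditary_inr_eq {s h y : B} (hh : IsSelfAdjoint h) (hhs : h ∈ hereditary s)
    (hy : y ∈ hereditary s) {f σ : ℝ → ℝ} (hf : Continuous f) (hσ : Continuous σ) :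
    ∃ z ∈ hereditary s, (z : B⁺¹) = cfc f (h : B⁺¹) * y * cfc σ (h : B⁺¹) := by
  have key : ∀ f : ℝ → ℝ, Continuous f → ∃ F ∈ hereditary s,
      cfc f (h : B⁺¹) = algebraMap ℝ B⁺¹ (f 0) + (F : B⁺¹) := fun f hf => by
    refine ⟨cfcₙ (fun t => f t - f 0) h, cfcₙ_mem (𝕜' := ℂ) _ hhs, ?_⟩
    rw [Unitization.real_cfcₙ_eq_cfc_inr _ _ (by simp), ← cfc_const_add (f 0) (fun t => f t - f 0)
      (h : B⁺¹) (by fun_prop) (hh.inr ℂ)]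
    simp
  obtain ⟨F, hF, eF⟩ := key f hf
  obtain ⟨S, hS, eS⟩ := key σ hσ
  refine ⟨((f 0 * σ 0 : ℝ) : ℂ) • y + ((f 0 : ℝ) : ℂ) • (y * S) + ((σ 0 : ℝ) : ℂ) • (F * y) +
    F * y * S, ?_, ?_⟩
  · exact add_mem (add_mem (add_mem (SMulMemClass.smul_mem _ hy)
      (SMulMemClass.smul_mem _ (mul_mem hy hS))) (SMulMemClass.smul_mem _ (mul_mem hF hy)))
      (mul_mem (mul_mem hF hy) hS)
  · rw [eF, eS]
    simp only [Unitization.inr_add, Unitization.inr_smul, Unitization.inr_mul,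
      Algebra.algebraMap_eq_smul_one, add_mul, mul_add, smul_mul_assoc, mul_smul_comm, one_mul,
      mul_one, Complex.coe_smul]
    module

/-- Near the spectral value `τ` the element `h` is almost the scalar `τ`. In `f(h) [h, y] = f(h)(h -
τ) y - f(h) y (h - τ)` the first term is small; the second is split by a function `σ` that vanishes
on the support of `f` and equals `1` far from `τ`. The part with `σ` belongs to the ideal and the
part with `1 - σ` is small. -/
theorem exists_localized_commutator {s h y : B} (hh : IsSelfAdjoint h) (hhs : h ∈ hereditary s)
    (hy : y ∈ hereditary s) {I : TwoSidedIdeal B} (hI : IsClosed (I : Set B))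
    (hsq : ∀ x ∈ hereditary s, x * x = 0 → x ∈ I) (τ : ℝ) {δ : ℝ} (hδ : 0 < δ) :
    ∃ F : B, ∃ j ∈ I, (F : B⁺¹) = cfc (fun t => max 0 (1 - |t - τ| / (2 * δ))) (h : B⁺¹) *
      ((h * y - y * h : B) : B⁺¹) ∧ ‖F - j‖ ≤ 6 * δ * ‖y‖ := by
  set f : ℝ → ℝ := fun t => max 0 (1 - |t - τ| / (2 * δ)) with hf
  set σ : ℝ → ℝ := fun t => min 1 (max 0 (|t - τ| / (2 * δ) - 1)) with hσ
  have hfc : Continuous f := by fun_prop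
  have hσc : Continuous σ := by fun_prop
  have hid : Continuous fun t : ℝ => t - τ := by fun_prop
  have hσc' : Continuous fun t : ℝ => 1 - σ t := continuous_const.sub hσc
  have hfσ : ∀ t, σ t * f t = 0 := fun t => by
    rcases le_total (|t - τ| / (2 * δ)) 1 with h | h
    · simp [hσ, max_eq_left (by linarith : |t - τ| / (2 * δ) - 1 ≤ 0)]
    · simp [hf, max_eq_left (by linarith : 1 - |t - τ| / (2 * δ) ≤ 0)]
  have hW : h * y - y * h ∈ hereditary s := sub_mem (mul_mem hhs hy) (mul_mem hy hhs)
  obtain ⟨F, -, eF⟩ := exists_mem_hereditary_inr_eq hh hhs hW hfc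
    (continuous_const : Continuous fun _ : ℝ => (1 : ℝ))
  obtain ⟨x, hx, ex⟩ := exists_mem_hereditary_inr_eq hh hhs hy hfc hσc
  have hhi : IsSelfAdjoint (h : B⁺¹) := hh.inr ℂ
  rw [cfc_const_one ℝ (h : B⁺¹), mul_one] at eF
  -- `x = f(h) y σ(h)` and `σ f = 0`.
  have hxx : x * x = 0 := by
    apply Unitization.inr_injective (R := ℂ)
    have e0 : cfc σ (h : B⁺¹) * cfc f (h : B⁺¹) = 0 := by
      rw [← cfc_mul σ f (h : B⁺¹) hσc.continuousOn hfc.continuousOn]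
      simp only [hfσ]
      exact cfc_const_zero ℝ _
    rw [Unitization.inr_mul, ex, Unitization.inr_zero]
    calc _ = cfc f (h : B⁺¹) * y * (cfc σ (h : B⁺¹) * cfc f (h : B⁺¹)) * y * cfc σ (h : B⁺¹) := by
          noncomm_ring
      _ = 0 := by rw [e0]; noncomm_ring
  have hxI := hsq x hx hxx
  refine ⟨F, -(x * h - τ • x), neg_mem (sub_mem (I.mul_mem_right _ _ hxI)
    (TwoSidedIdeal.real_smul_mem_of_isClosed hI _ hxI)), eF, ?_⟩
  have e1 : cfc f (h : B⁺¹) * ((h : B⁺¹) - algebraMap ℝ B⁺¹ τ) =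
      cfc (fun t => f t * (t - τ)) (h : B⁺¹) := by
    rw [cfc_mul f (fun t => t - τ) (h : B⁺¹) hfc.continuousOn hid.continuousOn,
      cfc_sub (fun t => t) (fun _ => τ) (h : B⁺¹) continuousOn_id continuousOn_const,
      cfc_id' ℝ (h : B⁺¹), cfc_const τ (h : B⁺¹)]
  have e2 : (1 - cfc σ (h : B⁺¹)) * ((h : B⁺¹) - algebraMap ℝ B⁺¹ τ) =
      cfc (fun t => (1 - σ t) * (t - τ)) (h : B⁺¹) := by
    rw [cfc_mul (fun t => 1 - σ t) (fun t => t - τ) (h : B⁺¹) hσc'.continuousOn hid.continuousOn,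
      cfc_sub (fun t => t) (fun _ => τ) (h : B⁺¹) continuousOn_id continuousOn_const,
      cfc_id' ℝ (h : B⁺¹), cfc_const τ (h : B⁺¹),
      cfc_sub (fun _ => 1) σ (h : B⁺¹) continuousOn_const hσc.continuousOn,
      cfc_const_one ℝ (h : B⁺¹)]
  have n1 : ‖cfc (fun t => f t * (t - τ)) (h : B⁺¹)‖ ≤ 2 * δ := by
    refine norm_cfc_le (by positivity) fun t _ => ?_
    rw [norm_mul, Real.norm_of_nonneg (le_max_left _ _), Real.norm_eq_abs]
    rcases le_total (|t - τ|) (2 * δ) with h | h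
    · have h1 : |t - τ| / (2 * δ) ≤ 1 := (div_le_one (by positivity)).2 h
      have h2 : 0 ≤ |t - τ| / (2 * δ) := by positivity
      have h3 : f t ≤ 1 := max_le zero_le_one (by linarith)
      have h4 : 0 ≤ f t := le_max_left _ _
      calc f t * |t - τ| ≤ 1 * (2 * δ) := mul_le_mul h3 h (abs_nonneg _) zero_le_one
        _ = _ := one_mul _
    · have h1 : 1 ≤ |t - τ| / (2 * δ) := (one_le_div (by positivity)).2 h
      have h3 : f t = 0 := max_eq_left (by linarith)
      change f t * |t - τ| ≤ 2 * δ
      rw [h3, zero_mul]; positivity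
  have n2 : ‖cfc (fun t => (1 - σ t) * (t - τ)) (h : B⁺¹)‖ ≤ 4 * δ := by
    refine norm_cfc_le (by positivity) fun t _ => ?_
    have h4 : 0 ≤ σ t := le_min zero_le_one (le_max_left _ _)
    have h5 : σ t ≤ 1 := min_le_left _ _
    rw [norm_mul, Real.norm_of_nonneg (by linarith), Real.norm_eq_abs]
    rcases le_total (|t - τ|) (4 * δ) with h | h
    · calc (1 - σ t) * |t - τ| ≤ 1 * (4 * δ) :=
          mul_le_mul (by linarith) h (abs_nonneg _) zero_le_one
        _ = _ := one_mul _
    · have h1 : 2 ≤ |t - τ| / (2 * δ) := (le_div_iff₀ (by positivity)).2 (by linarith)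
      have h3 : σ t = 1 := min_eq_left ((by linarith : 1 ≤ |t - τ| / (2 * δ) - 1).trans
        (le_max_right _ _))
      rw [h3, sub_self, zero_mul]; positivity
  have n3 : ‖cfc f (h : B⁺¹)‖ ≤ 1 := by
    refine norm_cfc_le zero_le_one fun t _ => ?_
    rw [Real.norm_of_nonneg (le_max_left _ _)]
    have : 0 ≤ |t - τ| / (2 * δ) := by positivity
    exact max_le zero_le_one (by linarith)
  have e3 : ((F - -(x * h - τ • x) : B) : B⁺¹) = cfc (fun t => f t * (t - τ)) (h : B⁺¹) * y -
      cfc f (h : B⁺¹) * y * cfc (fun t => (1 - σ t) * (t - τ)) (h : B⁺¹) := by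
    rw [← e1, ← e2]
    simp only [Unitization.inr_sub, Unitization.inr_neg, Unitization.inr_mul, Unitization.inr_smul,
      eF, ex, Algebra.algebraMap_eq_smul_one, mul_sub, sub_mul, mul_smul_comm, smul_mul_assoc,
      mul_one, one_mul, mul_assoc, smul_sub]
    abel
  rw [← Unitization.norm_inr (𝕜 := ℂ), e3]
  refine (norm_sub_le _ _).trans ?_
  have m1 := norm_mul_le (cfc (fun t => f t * (t - τ)) (h : B⁺¹)) (y : B⁺¹)
  have m2 := norm_mul_le (cfc f (h : B⁺¹) * y) (cfc (fun t => (1 - σ t) * (t - τ)) (h : B⁺¹))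
  have m3 := norm_mul_le (cfc f (h : B⁺¹)) (y : B⁺¹)
  rw [Unitization.norm_inr] at m1 m3
  have p1 : ‖cfc (fun t => f t * (t - τ)) (h : B⁺¹)‖ * ‖y‖ ≤ 2 * δ * ‖y‖ :=
    mul_le_mul_of_nonneg_right n1 (norm_nonneg _)
  have p3 : ‖cfc f (h : B⁺¹)‖ * ‖y‖ ≤ ‖y‖ := mul_le_of_le_one_left (norm_nonneg _) n3
  have p2 : ‖cfc f (h : B⁺¹) * y‖ * ‖cfc (fun t => (1 - σ t) * (t - τ)) (h : B⁺¹)‖ ≤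
      ‖y‖ * (4 * δ) := mul_le_mul (m3.trans p3) n2 (norm_nonneg _) (norm_nonneg _)
  linarith

/-- If a closed ideal contains all square-zero elements of a hereditary subalgebra, then it contains
the commutators of its elements. -/
theorem commutator_mem_of_isSelfAdjoint {s h y : B} (hh : IsSelfAdjoint h) (hhs : h ∈ hereditary s)
    (hy : y ∈ hereditary s) {I : TwoSidedIdeal B} (hI : IsClosed (I : Set B))
    (hsq : ∀ x ∈ hereditary s, x * x = 0 → x ∈ I) : h * y - y * h ∈ I := by
  refine TwoSidedIdeal.mem_of_forall_norm_sub_lt hI fun ε hε => ?_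
  set W := h * y - y * h with hW
  set M := ‖h‖ + 1 with hM
  have hMpos : 0 < M := by positivity
  -- The spectrum of `h` is covered by `N + 1` bumps of scale `δ = 2 M / N`. Each contributes a
  -- squared error of order `δ²`, so the total error is of order `1 / N`; `N` is taken large enough
  -- for `m < ε² / 2`.
  obtain ⟨N, hN⟩ := exists_nat_gt (max 1 (16 * (12 * M * ‖y‖) ^ 2 / (ε ^ 2 / 4)))
  have hN1 : (1 : ℝ) < N := (le_max_left _ _).trans_lt hN
  have hN2 : 16 * (12 * M * ‖y‖) ^ 2 < N * (ε ^ 2 / 4) := by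
    rw [← div_lt_iff₀ (by positivity)]
    exact (le_max_right _ _).trans_lt hN
  have hN0 : (0 : ℝ) < N := by linarith
  set δ := 2 * M / N with hδ
  have hδpos : 0 < δ := by positivity
  have hex := fun i : ℕ => exists_localized_commutator hh hhs hy hI hsq (-M + i * δ) hδpos
  choose F j hj eF hFj using hex
  set f : ℕ → ℝ → ℝ := fun i t => max 0 (1 - |t - (-M + i * δ)| / (2 * δ)) with hf
  have hfc : ∀ i, Continuous (f i) := fun i => by fun_prop
  have hhi : IsSelfAdjoint (h : B⁺¹) := hh.inr ℂ
  have hfs : ∀ i, star (cfc (f i) (h : B⁺¹)) = cfc (f i) (h : B⁺¹) := fun i =>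
    (cfc_predicate (R := ℝ) _ _ : IsSelfAdjoint (cfc (f i) (h : B⁺¹)))
  set S : B := (8 : ℝ) • ∑ i ∈ Finset.range (N + 1), star (j i) * j i with hS
  have hS0 : 0 ≤ S := smul_nonneg (by norm_num)
    (Finset.sum_nonneg fun i _ => star_mul_self_nonneg _)
  have hSI : S ∈ I := TwoSidedIdeal.real_smul_mem_of_isClosed hI _
    (sum_mem fun i _ => I.mul_mem_left _ _ (hj i))
  set m : ℝ := 8 * ((N + 1) * (6 * δ * ‖y‖) ^ 2) with hm
  have hm0 : 0 ≤ m := by positivity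
  -- Each point of the spectrum is within `δ` of some grid point, where the corresponding bump is at
  -- least `1/2`; this explains the factor `4`.
  have h1 : (1 : B⁺¹) ≤ ∑ i ∈ Finset.range (N + 1),
      (4 : ℝ) • (cfc (f i) (h : B⁺¹) * cfc (f i) (h : B⁺¹)) := by
    have e : ∀ i ∈ Finset.range (N + 1), (4 : ℝ) • (cfc (f i) (h : B⁺¹) * cfc (f i) (h : B⁺¹)) =
        cfc (fun t => (4 : ℝ) • (f i t * f i t)) (h : B⁺¹) := fun i _ => by
      rw [cfc_smul (4 : ℝ) (fun t => f i t * f i t) (h : B⁺¹)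
        ((hfc i).mul (hfc i)).continuousOn,
        cfc_mul (f i) (f i) (h : B⁺¹) (hfc i).continuousOn (hfc i).continuousOn]
    have hcc : ∀ i, Continuous fun t => (4 : ℝ) • (f i t * f i t) :=
      fun i => by
        have := (hfc i).mul (hfc i)
        exact continuous_const.mul this
    have hcs : Continuous (∑ i ∈ Finset.range (N + 1), fun t => (4 : ℝ) • (f i t * f i t)) :=
      by
        rw [Finset.sum_fn]
        exact continuous_finsetSum _ fun i _ => hcc i
    rw [Finset.sum_congr rfl e, ← cfc_sum _ (h : B⁺¹) _ (fun i _ => (hcc i).continuousOn),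
      ← cfc_one ℝ (h : B⁺¹)]
    refine cfc_mono (fun t ht => ?_) continuousOn_const hcs.continuousOn
    have ht1 := spectrum.norm_le_norm_of_mem ht
    rw [Unitization.norm_inr, Real.norm_eq_abs, abs_le] at ht1
    have p0 : 0 ≤ (t + M) / δ := div_nonneg (by linarith) hδpos.le
    obtain ⟨i, hi1, hi2⟩ : ∃ i : ℕ, i ≤ N ∧ |t - (-M + i * δ)| ≤ δ := by
      refine ⟨⌊(t + M) / δ⌋₊, Nat.floor_le_of_le ?_, ?_⟩
      · rw [div_le_iff₀ hδpos, hδ, mul_div_cancel₀ _ hN0.ne']; linarith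
      · have q1 := (le_div_iff₀ hδpos).1 (Nat.floor_le p0)
        have q2 := (div_lt_iff₀ hδpos).1 (Nat.lt_floor_add_one ((t + M) / δ))
        rw [abs_le]
        constructor <;> nlinarith
    have hi3 : 1 / 2 ≤ f i t := by
      refine le_trans ?_ (le_max_right _ _)
      have : |t - (-M + i * δ)| / (2 * δ) ≤ 1 / 2 := by
        rw [div_le_iff₀ (by positivity)]; linarith
      linarith
    rw [Finset.sum_apply]
    refine le_trans ?_ (Finset.single_le_sum (f := fun i => (4 : ℝ) • (f i t * f i t))
      (fun k _ => smul_nonneg (by norm_num) (mul_self_nonneg _))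
      (Finset.mem_range_succ_iff.2 hi1))
    simp only [smul_eq_mul, Pi.one_apply]
    nlinarith
  have h2 : star (W : B⁺¹) * W ≤
      ∑ i ∈ Finset.range (N + 1), (4 : ℝ) • (star (F i : B⁺¹) * F i) := by
    have := star_left_conjugate_le_conjugate h1 (W : B⁺¹)
    rw [mul_one] at this
    refine this.trans_eq ?_
    rw [Finset.mul_sum, Finset.sum_mul]
    refine Finset.sum_congr rfl fun i _ => ?_
    have eF' : (F i : B⁺¹) = cfc (f i) (h : B⁺¹) * (W : B⁺¹) := eF i
    rw [eF', star_mul, hfs]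
    simp only [mul_smul_comm, smul_mul_assoc, mul_assoc]
  -- Here `F_i = j_i + ρ` with `ρ` small, and `(j + ρ)* (j + ρ) ≤ 2 (j* j + ρ* ρ)`. Summing bounds
  -- `W* W` by an element of the ideal plus the scalar `m`, which is the hypothesis of the cutoff
  -- estimate.
  have h3 : ∀ i, (4 : ℝ) • (star (F i : B⁺¹) * F i) ≤
      (8 : ℝ) • (star (j i : B⁺¹) * j i) + algebraMap ℝ B⁺¹ (8 * (6 * δ * ‖y‖) ^ 2) := fun i => by
    set ρ : B⁺¹ := ((F i - j i : B) : B⁺¹) with hρ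
    have e1 : (F i : B⁺¹) = j i + ρ := by rw [hρ, Unitization.inr_sub]; abel
    have e2 : (4 : ℝ) • (star (F i : B⁺¹) * F i) ≤
        (8 : ℝ) • (star (j i : B⁺¹) * j i) + (8 : ℝ) • (star ρ * ρ) := by
      rw [← sub_nonneg]
      have := smul_nonneg (by norm_num : (0 : ℝ) ≤ 4) (star_mul_self_nonneg ((j i : B⁺¹) - ρ))
      refine this.trans_eq ?_
      rw [e1]
      simp only [star_sub, star_add, sub_mul, mul_sub, add_mul, mul_add]
      module
    refine e2.trans (add_le_add le_rfl ?_)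
    have e3 : star ρ * ρ ≤ algebraMap ℝ B⁺¹ (‖ρ‖ ^ 2) := star_mul_le_algebraMap_norm_sq
    have e4 : ‖ρ‖ ^ 2 ≤ (6 * δ * ‖y‖) ^ 2 := by
      rw [hρ, Unitization.norm_inr]
      exact pow_le_pow_left₀ (norm_nonneg _) (hFj i) 2
    have e5 := smul_le_smul_of_nonneg_left (e3.trans (algebraMap_mono _ e4))
      (by norm_num : (0 : ℝ) ≤ 8)
    refine e5.trans_eq ?_
    rw [Algebra.smul_def, ← map_mul]
  have h4 : star (W : B⁺¹) * W ≤ S + algebraMap ℝ B⁺¹ m := by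
    refine (h2.trans (Finset.sum_le_sum fun i _ => h3 i)).trans_eq ?_
    rw [Finset.sum_add_distrib, Finset.sum_const, Finset.card_range, ← map_nsmul, hS,
      Unitization.inr_smul, ← Finset.smul_sum]
    congr 2
    · change _ = Unitization.inrNonUnitalStarAlgHom ℂ B _
      rw [map_sum]
      exact Finset.sum_congr rfl fun i _ => by
        simp [Unitization.inrNonUnitalStarAlgHom_apply]
    · rw [hm, nsmul_eq_mul]; push_cast; ring
  have h5 := norm_sub_mul_cutoff_sq_le' hS0 hm0 (by positivity : 0 < ε ^ 2 / 4) h4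
  refine ⟨W * cutoff (ε ^ 2 / 4) S, I.mul_mem_left _ _
    (TwoSidedIdeal.cutoff_mem hI (by positivity) hS0 hSI), ?_⟩
  have h6 : m < ε ^ 2 / 2 := by
    have e : m = 8 * (N + 1) * (12 * M * ‖y‖) ^ 2 / N ^ 2 := by
      rw [hm, hδ]; field_simp; ring
    rw [e, div_lt_iff₀ (by positivity)]
    have a1 : (8 * (N + 1) * (12 * M * ‖y‖) ^ 2 : ℝ) ≤ N * (16 * (12 * M * ‖y‖) ^ 2) := by
      nlinarith [sq_nonneg (12 * M * ‖y‖)]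
    have a2 : (N : ℝ) * (16 * (12 * M * ‖y‖) ^ 2) < N * (N * (ε ^ 2 / 4)) :=
      mul_lt_mul_of_pos_left hN2 hN0
    nlinarith [sq_nonneg (N * ε : ℝ)]
  refine lt_of_pow_lt_pow_left₀ 2 hε.le ?_
  linarith [sq_pos_of_pos hε]

open scoped ComplexStarModule in
/-- If a closed ideal contains all square-zero elements of a hereditary subalgebra, then it contains
the commutators of its elements. -/
theorem commutator_mem {s x y : B} (hx : x ∈ hereditary s)
    (hy : y ∈ hereditary s) {I : TwoSidedIdeal B} (hI : IsClosed (I : Set B))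
    (hsq : ∀ x ∈ hereditary s, x * x = 0 → x ∈ I) : x * y - y * x ∈ I := by
  have h1 : (ℜ x : B) ∈ hereditary s := by
    rw [realPart_apply_coe, ← Complex.coe_smul]
    exact SMulMemClass.smul_mem _ (add_mem hx (star_mem hx))
  have h2 : (ℑ x : B) ∈ hereditary s := by
    rw [imaginaryPart_apply_coe, ← Complex.coe_smul]
    exact SMulMemClass.smul_mem _ (SMulMemClass.smul_mem _ (sub_mem hx (star_mem hx)))
  have h3 := commutator_mem_of_isSelfAdjoint (ℜ x).2 h1 hy hI hsq
  have h4 := TwoSidedIdeal.smul_mem_of_isClosed hI Complex.I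
    (commutator_mem_of_isSelfAdjoint (ℑ x).2 h2 hy hI hsq)
  have e : x * y - y * x = ((ℜ x : B) * y - y * (ℜ x : B)) +
      Complex.I • ((ℑ x : B) * y - y * (ℑ x : B)) := by
    conv_lhs => rw [← realPart_add_I_smul_imaginaryPart x]
    simp only [add_mul, mul_add, smul_mul_assoc, mul_smul_comm, smul_sub]
    abel
  rw [e]
  exact I.add_mem h3 h4

/-- Pure infiniteness gives `c ≈ z* s² z`, so `(v_i s)* c (v_j s)` becomes `r_i* r_j` with `r_i = s
z v_i s` in the hereditary subalgebra. Modulo `I` this subalgebra is commutative, which allows `r₂`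
and `r₄` to be exchanged. -/
theorem exchange_mem_of_mem_closedSpan (h : IsPurelyInfinite B) {s : B} (hs : IsSelfAdjoint s)
    {I : TwoSidedIdeal B} (hI : IsClosed (I : Set B))
    (hsq : ∀ x ∈ hereditary s, x * x = 0 → x ∈ I) {c : B} (hc : 0 ≤ c)
    (hcs : c ∈ TwoSidedIdeal.closedSpan {s * s}) (v₁ v₂ v₃ v₄ : B) :
    star (v₁ * s) * (c * (v₂ * s)) * (star (v₃ * s) * (c * (v₄ * s))) -
      star (v₁ * s) * (c * (v₄ * s)) * (star (v₃ * s) * (c * (v₂ * s))) ∈ I := by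
  have h0 : 0 ≤ s * s := by simpa [hs.star_eq] using star_mul_self_nonneg s
  have hmem : c ∈ closure (Set.range fun z : B => star z * (s * s) * z) := by
    refine Metric.mem_closure_iff.2 fun ε hε => ?_
    obtain ⟨z, hz⟩ := h.exists_norm_conj_sub_lt hc h0 hcs hε
    exact ⟨_, ⟨z, rfl⟩, by rwa [dist_comm, dist_eq_norm]⟩
  have hmap := map_mem_closure (t := (I : Set B)) (f := fun c : B =>
    star (v₁ * s) * (c * (v₂ * s)) * (star (v₃ * s) * (c * (v₄ * s))) -
      star (v₁ * s) * (c * (v₄ * s)) * (star (v₃ * s) * (c * (v₂ * s)))) (by fun_prop) hmem ?_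
  · rwa [hI.closure_eq] at hmap
  rintro _ ⟨z, rfl⟩
  have hr : ∀ v : B, s * z * (v * s) ∈ hereditary s := fun v => by
    constructor
    · rw [mul_assoc]; exact mul_mem_rightSpan _ _
    · have : star (s * z * (v * s)) = s * (star v * (star z * s)) := by
        simp only [star_mul, hs.star_eq, mul_assoc]
      rw [this]; exact mul_mem_rightSpan _ _
  have e : ∀ v w : B, star (v * s) * (star z * (s * s) * z * (w * s)) =
      star (s * z * (v * s)) * (s * z * (w * s)) := fun v w => by
    simp only [star_mul, hs.star_eq, mul_assoc]
  simp only [e]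
  generalize hr₁ : s * z * (v₁ * s) = r₁
  have m2 := hr v₂
  have m3 := hr v₃
  have m4 := hr v₄
  generalize s * z * (v₂ * s) = r₂ at *
  generalize s * z * (v₃ * s) = r₃ at *
  generalize s * z * (v₄ * s) = r₄ at *
  have e2 : star r₁ * r₂ * (star r₃ * r₄) - star r₁ * r₄ * (star r₃ * r₂) =
      star r₁ * ((r₂ * (star r₃ * r₄) - star r₃ * r₄ * r₂) +
        (star r₃ * r₄ - r₄ * star r₃) * r₂) := by noncomm_ring
  rw [e2]
  exact I.mul_mem_left _ _ (I.add_mem (commutator_mem m2 (mul_mem (star_mem m3) m4) hI hsq)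
    (I.mul_mem_right _ _ (commutator_mem (star_mem m3) m4 hI hsq)))

/-- The factor `c` of the previous relation is removed by letting it run through an approximate left
unit for `v₂ s` and `v₄ s` in the closed ideal generated by `s²`. -/
theorem exchange_mem (h : IsPurelyInfinite B) {s : B} (hs : IsSelfAdjoint s)
    {I : TwoSidedIdeal B} (hI : IsClosed (I : Set B))
    (hsq : ∀ x ∈ hereditary s, x * x = 0 → x ∈ I) (v₁ v₂ v₃ v₄ : B) :
    star (v₁ * s) * (v₂ * s) * (star (v₃ * s) * (v₄ * s)) -
      star (v₁ * s) * (v₄ * s) * (star (v₃ * s) * (v₂ * s)) ∈ I := by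
  set J := TwoSidedIdeal.closedSpan {s * s} with hJ
  have hJc : IsClosed (J : Set B) := TwoSidedIdeal.isClosed_closedSpan _
  have hsJ : s ∈ J := TwoSidedIdeal.mem_of_star_mul_self_mem hJc
    (by rw [hs.star_eq]; exact TwoSidedIdeal.subset_closedSpan _ rfl)
  set u := v₂ * s with hu
  set w := v₄ * s with hw
  set S := u * star u + w * star w with hS
  have hS0 : 0 ≤ S := add_nonneg (mul_star_self_nonneg _) (mul_star_self_nonneg _)
  have hSJ : S ∈ J := J.add_mem (J.mul_mem_right _ _ (J.mul_mem_left _ _ hsJ))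
    (J.mul_mem_right _ _ (J.mul_mem_left _ _ hsJ))
  have hmem : (u, w) ∈ closure {p : B × B | ∃ c : B, 0 ≤ c ∧ c ∈ J ∧ p = (c * u, c * w)} := by
    refine Metric.mem_closure_iff.2 fun ε hε => ?_
    have hδ : 0 < ε ^ 2 / 4 := by positivity
    have key : ∀ x : B, x * star x ≤ S → ‖x - cutoff (ε ^ 2 / 4) S * x‖ < ε := fun x hx => by
      have := norm_sub_mul_cutoff_sq_le (x := star x) (S := S) hδ (by rwa [star_star])
      rw [← norm_star, star_sub, star_mul, star_star, star_cutoff] at this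
      refine lt_of_pow_lt_pow_left₀ 2 hε.le (this.trans_lt ?_)
      have : 0 < ε ^ 2 := by positivity
      linarith
    refine ⟨_, ⟨cutoff (ε ^ 2 / 4) S, ?_, TwoSidedIdeal.cutoff_mem hJc hδ hS0 hSJ, rfl⟩, ?_⟩
    · exact cfcₙ_nonneg fun t ht => by
        have := quasispectrum_nonneg_of_nonneg (𝕜 := ℝ) S hS0 t ht
        positivity
    · rw [Prod.dist_eq, dist_eq_norm, dist_eq_norm]
      exact max_lt (key u (le_add_of_nonneg_right (mul_star_self_nonneg _)))
        (key w (le_add_of_nonneg_left (mul_star_self_nonneg _)))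
  have hmap := map_mem_closure (t := (I : Set B)) (f := fun p : B × B =>
    star (v₁ * s) * p.1 * (star (v₃ * s) * p.2) - star (v₁ * s) * p.2 * (star (v₃ * s) * p.1))
    (by fun_prop) hmem ?_
  · rwa [hI.closure_eq] at hmap
  rintro _ ⟨c, hc, hcJ, rfl⟩
  exact exchange_mem_of_mem_closedSpan h hs hI hsq hc hcJ v₁ v₂ v₃ v₄

/-- If a closed ideal of a purely infinite C⋆-algebra contains all square-zero elements of the
hereditary subalgebra of `s`, then it contains `s`. -/
theorem mem_of_forall_mul_self_eq_zero (h : IsPurelyInfinite B) {s : B} (hs : IsSelfAdjoint s)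
    {I : TwoSidedIdeal B} (hI : IsClosed (I : Set B))
    (hsq : ∀ x ∈ hereditary s, x * x = 0 → x ∈ I) : s ∈ I := by
  set t := s * s with ht
  have hts : star t = t := by rw [ht, star_mul, hs.star_eq]
  have ex := exchange_mem h hs hI hsq
  -- The exchange relation is used in two forms: compressions `t x t` and `t y t` commute modulo
  -- `I`, and their product is `t²` times the compression of `y x`. Comparing both orders kills the
  -- compressions of commutators.
  have swap : ∀ x y : B, t * x * t * (t * y * t) - t * y * t * (t * x * t) ∈ I := fun x y => by
    have := ex s (x * s) s (y * s)
    simp only [star_mul, hs.star_eq] at this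
    simpa only [ht, mul_assoc] using this
  have merge : ∀ x y : B, t * x * t * (t * y * t) - t * t * (t * (y * x) * t) ∈ I := fun x y => by
    have := ex s (x * s) (star y * s) s
    simp only [star_mul, hs.star_eq, star_star] at this
    simpa only [ht, mul_assoc] using this
  have hcomm : ∀ x y : B, t * t * (t * (x * y - y * x) * t) ∈ I := fun x y => by
    have := I.add_mem (I.sub_mem (merge x y) (merge y x)) (swap y x)
    convert this using 1
    noncomm_ring
  -- Killing the compression of `c` propagates to `u c v` at the price of extra powers of `t` on the
  -- left. This turns commutators into elements of a two-sided ideal.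
  have hucv : ∀ c u v : B, t * t * (t * c * t) ∈ I →
      t * t * (t * t * (t * t * (t * (u * c * v) * t))) ∈ I := fun c u v hc => by
    have m1 := I.mul_mem_left (t * t * (t * t)) _ (merge (c * v) u)
    have m2 := I.mul_mem_left (t * t) _ (I.mul_mem_right _ (t * u * t) (merge v c))
    have m3 := I.mul_mem_left (t * t) _ (I.mul_mem_right _ (t * u * t) (swap v c))
    have m4 := I.mul_mem_right _ (t * v * t * (t * u * t)) hc
    have := I.sub_mem (I.add_mem m4 (I.sub_mem m3 m2)) m1
    convert this using 1
    noncomm_ring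
  let K : TwoSidedIdeal B := .mk'
    {w | ∀ u v : B, t * t * (t * t * (t * t * (t * (u * w * v) * t))) ∈ I}
    (fun u v => by simp)
    (fun {x y} hx hy u v => by
      have := I.add_mem (hx u v) (hy u v)
      simpa only [mul_add, add_mul] using this)
    (fun {x} hx u v => by
      have := I.neg_mem (hx u v)
      simpa only [mul_neg, neg_mul] using this)
    (fun {x y} hy u v => by
      have := hy (u * x) v
      simpa only [mul_assoc] using this)
    (fun {x y} hx u v => by
      have := hx u (y * v)
      simpa only [mul_assoc] using this)
  have hK : ∀ w, w ∈ K ↔ ∀ u v : B, t * t * (t * t * (t * t * (t * (u * w * v) * t))) ∈ I :=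
    fun w => TwoSidedIdeal.mem_mk' _ _ _ _ _ _ w
  have hKc : IsClosed (K : Set B) := by
    have : (K : Set B) = ⋂ (u : B) (v : B),
        (fun w => t * t * (t * t * (t * t * (t * (u * w * v) * t)))) ⁻¹' (I : Set B) := by
      ext w
      simp only [SetLike.mem_coe, hK, Set.mem_iInter, Set.mem_preimage]
    rw [this]
    exact isClosed_iInter fun u => isClosed_iInter fun v => hI.preimage (by fun_prop)
  have hall : ∀ w, w ∈ K := mem_of_forall_commutator_mem hKc h.1 fun x y =>
    (hK _).2 fun u v => hucv _ u v (hcomm x y)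
  -- The arguments are powers of `t` with total exponent `16`, so that `t¹⁶` lies in `I`. Four
  -- square roots then give `t`, and one more gives `s`.
  have hp := (hK _).1 (hall (t * t)) (t * t * (t * t)) (t * t)
  have down : ∀ x : B, star x = x → x * x ∈ I → x ∈ I := fun x hx hxx =>
    TwoSidedIdeal.mem_of_star_mul_self_mem hI (by rwa [hx])
  refine down s hs (down t hts ?_)
  have hs2 : star (t * t) = t * t := by rw [star_mul, hts]
  have hs4 : star (t * t * (t * t)) = t * t * (t * t) := by rw [star_mul, hs2]
  refine down _ hs2 (down _ hs4 (down _ (by rw [star_mul, hs4]) ?_))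
  simpa only [mul_assoc] using hp

/-- Positive elements of purely infinite C⋆-algebras are properly infinite. -/
theorem mem_absorbedSet_self (h : IsPurelyInfinite B) {s : B} (hs : IsSelfAdjoint s) :
    s * s ∈ absorbedSet (s * s) := by
  have hs2 : IsSelfAdjoint (s * s) := by
    rw [isSelfAdjoint_iff, star_mul, hs.star_eq]
  have h0 := zero_mem_absorbedSet h hs
  have := mem_of_forall_mul_self_eq_zero h hs (isClosed_absorbedIdeal hs2 h0) fun x hx hxx =>
    mem_absorbedIdeal_of_mul_self_eq_zero h hs hx hxx hs2 h0
  rwa [mem_absorbedIdeal, hs.star_eq] at this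

/-- If `a ⊕ a` is Cuntz subequivalent to `a`, then so is `a ⊕ ⋯ ⊕ a`. -/
theorem exists_approx_isometries {a : B} (has : IsSelfAdjoint a) (ha : a ∈ absorbedSet a) (n : ℕ) {ε : ℝ} (hε : 0 < ε) :
    ∃ S : Fin n → B, ∀ i j, ‖star (S i) * a * S j - if i = j then a else 0‖ < ε := by
  induction n generalizing ε with
  | zero => exact ⟨Fin.elim0, fun i => i.elim0⟩
  | succ n ih =>
    obtain ⟨S, hS⟩ := ih hε
    -- The relations for `n` elements are open conditions on the limit point `(a, a, 0)`, so they
    -- persist for a pair `(x, y)` close to it; the new family is `y` together with the `x S_i`.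
    have hU : IsOpen {t : B × B × B | ‖t.2.1 - a‖ < ε ∧ (∀ i, ‖star t.2.2 * S i‖ < ε) ∧
        (∀ i, ‖star (S i) * t.2.2‖ < ε) ∧
        ∀ i j, ‖star (S i) * t.1 * S j - if i = j then a else 0‖ < ε} := by
      simp only [Set.ofPred_and, Set.ofPred_forall]
      refine .inter (isOpen_lt (by fun_prop) (by fun_prop)) (.inter ?_ (.inter ?_ ?_))
      · exact isOpen_iInter_of_finite fun i => isOpen_lt (by fun_prop) (by fun_prop)
      · exact isOpen_iInter_of_finite fun i => isOpen_lt (by fun_prop) (by fun_prop)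
      · exact isOpen_iInter_of_finite fun i => isOpen_iInter_of_finite fun j =>
          isOpen_lt (by fun_prop) (by fun_prop)
    obtain ⟨_, ⟨h1, h2, h3, h4⟩, ⟨⟨x, y⟩, rfl⟩⟩ := mem_closure_iff.1 ha _ hU
      ⟨by simpa using hε, fun i => by simpa using hε, fun i => by simpa using hε, hS⟩
    simp only [star_mul, star_star, has.star_eq] at h1 h2 h3 h4
    refine ⟨Fin.cons y fun i => x * S i, fun i j => ?_⟩
    induction i using Fin.cases with
    | zero =>
      induction j using Fin.cases with
      | zero => simpa using h1
      | succ j =>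
        simpa [mul_assoc, (Fin.succ_ne_zero j).symm] using h2 j
    | succ i =>
      induction j using Fin.cases with
      | zero => simpa [mul_assoc] using h3 i
      | succ j => simpa [mul_assoc] using h4 i j

end CStarAlgebra

end ProperlyInfinite

/-! ### Cauchy–Schwarz inequalities -/

namespace CStarAlgebra

variable {A : Type u} [NonUnitalCStarAlgebra A] [PartialOrder A] [StarOrderedRing A]

/-- Taking `r² = ‖c‖ + s` makes the last term at most `x* x`, which leaves `x* x ≤ (‖c‖ + s) d`;
then `s` tends to `0`. -/
theorem norm_sq_le_of_forall_le {c d x : A} (hc : IsSelfAdjoint c)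
    (h : ∀ r : ℝ, 0 < r → star x * x + star x * x ≤
      (r * r) • d + (r⁻¹ * r⁻¹) • (star x * c * x)) : ‖x‖ ^ 2 ≤ ‖c‖ * ‖d‖ := by
  have key : ∀ s : ℝ, 0 < s → ‖x‖ ^ 2 ≤ (‖c‖ + s) * ‖d‖ := fun s hs => by
    have hp : 0 < ‖c‖ + s := by positivity
    have h1 := h √(‖c‖ + s) (Real.sqrt_pos.2 hp)
    rw [← mul_inv, Real.mul_self_sqrt hp.le] at h1
    have h2 : (‖c‖ + s)⁻¹ • (star x * c * x) ≤ star x * x := by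
      have h3 := smul_le_smul_of_nonneg_left (star_left_conjugate_le_norm_smul (a := x) hc)
        (inv_nonneg.2 hp.le)
      rw [smul_smul] at h3
      refine h3.trans ?_
      have h4 : (‖c‖ + s)⁻¹ * ‖c‖ ≤ 1 := by
        rw [inv_mul_le_iff₀ hp]; linarith
      simpa using smul_le_smul_of_nonneg_right h4 (star_mul_self_nonneg x)
    have h5 : star x * x ≤ (‖c‖ + s) • d :=
      le_of_add_le_add_right (h1.trans (add_le_add le_rfl h2))
    have h6 := norm_le_norm_of_nonneg_of_le (star_mul_self_nonneg x) h5
    rwa [CStarRing.norm_star_mul_self, norm_smul, Real.norm_of_nonneg hp.le, ← sq] at h6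
  refine ge_of_tendsto (x := 𝓝[>] (0 : ℝ)) (f := fun s => (‖c‖ + s) * ‖d‖) ?_
    (eventually_nhdsWithin_of_forall key)
  have : Continuous fun s : ℝ => (‖c‖ + s) * ‖d‖ := by fun_prop
  simpa using (this.tendsto 0).mono_left nhdsWithin_le_nhds

/-- With `x = ∑ z_i b_i`, the positive sum of the squares of `r b_i - r⁻¹ z_i* x` is expanded. -/
theorem norm_sum_mul_sq_le {ι : Type*} (s : Finset ι) (z b : ι → A) :
    ‖∑ i ∈ s, z i * b i‖ ^ 2 ≤ ‖∑ i ∈ s, z i * star (z i)‖ * ‖∑ i ∈ s, star (b i) * b i‖ := by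
  set x := ∑ i ∈ s, z i * b i with hx
  refine norm_sq_le_of_forall_le (isSelfAdjoint_sum _ fun i _ => .mul_star_self _) fun r hr => ?_
  have h : 0 ≤ ∑ i ∈ s, star (r • b i - r⁻¹ • (star (z i) * x)) *
      (r • b i - r⁻¹ • (star (z i) * x)) := Finset.sum_nonneg fun i _ => star_mul_self_nonneg _
  rw [← sub_nonneg]
  refine h.trans_eq ?_
  have e : ∀ i, star (r • b i - r⁻¹ • (star (z i) * x)) * (r • b i - r⁻¹ • (star (z i) * x)) =
      (r * r) • (star (b i) * b i) - star (z i * b i) * x - star x * (z i * b i) +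
        (r⁻¹ * r⁻¹) • (star x * (z i * star (z i)) * x) := fun i => by
    simp only [star_sub, star_smul, star_trivial, star_mul, star_star, sub_mul, mul_sub,
      smul_mul_assoc, mul_smul_comm, smul_sub, smul_smul, mul_assoc, mul_inv_cancel₀ hr.ne',
      inv_mul_cancel₀ hr.ne', one_smul]
    abel
  simp only [e, Finset.sum_add_distrib, Finset.sum_sub_distrib, ← Finset.smul_sum,
    ← Finset.sum_mul, ← Finset.mul_sum, ← star_sum, ← hx]
  abel

/-- Cauchy–Schwarz for the rows `z_i` and the columns `d_i z_i*`. This holds for arbitrary `d_i`,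
not only for positive ones, and is the source of all contractivity statements for lifted Rokhlin
sums. -/
theorem norm_sum_conj_le {ι : Type*} (s : Finset ι) (z d : ι → A) {m : ℝ}
    (hd : ∀ i ∈ s, ‖d i‖ ≤ m) (hm : 0 ≤ m) :
    ‖∑ i ∈ s, z i * d i * star (z i)‖ ≤ m * ‖∑ i ∈ s, z i * star (z i)‖ := by
  have h1 := norm_sum_mul_sq_le s z fun i => d i * star (z i)
  have h2 : ‖∑ i ∈ s, star (d i * star (z i)) * (d i * star (z i))‖ ≤
      m ^ 2 * ‖∑ i ∈ s, z i * star (z i)‖ := by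
    rw [← Real.norm_of_nonneg (sq_nonneg m), ← norm_smul]
    refine norm_le_norm_of_nonneg_of_le (Finset.sum_nonneg fun i _ => star_mul_self_nonneg _) ?_
    rw [Finset.smul_sum]
    refine Finset.sum_le_sum fun i hi => ?_
    have h3 := star_right_conjugate_le_norm_smul (a := z i) (.star_mul_self (d i))
    have e : star (d i * star (z i)) * (d i * star (z i)) = z i * (star (d i) * d i) * star (z i) :=
      by simp only [star_mul, star_star, mul_assoc]
    rw [e]
    refine h3.trans (smul_le_smul_of_nonneg_right ?_ (mul_star_self_nonneg _))
    rw [CStarRing.norm_star_mul_self, sq]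
    exact mul_self_le_mul_self (norm_nonneg _) (hd i hi)
  simp only [← mul_assoc] at h1
  set S := ‖∑ i ∈ s, z i * star (z i)‖
  have hS : 0 ≤ S := norm_nonneg _
  refine le_of_sq_le_sq ?_ (by positivity)
  simp only [star_mul, star_star, mul_assoc] at h1 h2 ⊢
  calc _ ≤ _ := h1
    _ ≤ S * (m ^ 2 * S) := mul_le_mul_of_nonneg_left h2 hS
    _ = _ := by ring

end CStarAlgebra

/-! ### Partitions of unity and Riemann sums on compact spaces -/

section Partition

variable {G : Type v} [TopologicalSpace G] [CompactSpace G]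

/-- A continuous map on a compact space is almost constant on the members of some partition of
unity. -/
theorem exists_partition_dist_lt {E : Type*} [PseudoMetricSpace E] {Γ : G → E} (hΓ : Continuous Γ)
    {η : ℝ} (hη : 0 < η) : ∃ (t : Finset G) (p : G → C(G, ℝ)), (∀ g h, 0 ≤ p g h) ∧
      (∀ h, ∑ g ∈ t, p g h = 1) ∧ ∀ g h, p g h ≠ 0 → dist (Γ h) (Γ g) < η := by
  let b : G → C(G, ℝ) := fun g => ⟨fun h => max 0 (η - dist (Γ h) (Γ g)), by fun_prop⟩
  have hb0 : ∀ g h, 0 ≤ b g h := fun g h => le_max_left _ _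
  have hbg : ∀ g h, 0 < b g h ↔ dist (Γ h) (Γ g) < η := fun g h => by
    simp [b]
  obtain ⟨t, ht⟩ := isCompact_univ.elim_finite_subcover (fun g => {h | 0 < b g h})
    (fun g => isOpen_lt continuous_const (b g).continuous)
    (fun g _ => Set.mem_iUnion.2 ⟨g, (hbg g g).2 (by simpa using hη)⟩)
  let S : C(G, ℝ) := ∑ g ∈ t, b g
  have hSa : ∀ h, S h = ∑ g ∈ t, b g h := fun h => by simp [S]
  have hS : ∀ h, 0 < S h := fun h => by
    obtain ⟨g, hg, hh⟩ := Set.mem_iUnion₂.1 (ht (Set.mem_univ h))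
    rw [hSa]
    exact Finset.sum_pos' (fun g _ => hb0 g h) ⟨g, hg, hh⟩
  refine ⟨t, fun g => ⟨fun h => b g h / S h,
    (b g).continuous.div S.continuous fun h => (hS h).ne'⟩, fun g h => ?_, fun h => ?_,
    fun g h hgh => ?_⟩
  · exact div_nonneg (hb0 g h) (hS h).le
  · simp only [ContinuousMap.coe_mk, ← Finset.sum_div, ← hSa, div_self (hS h).ne']
  · refine (hbg g h).1 (lt_of_le_of_ne (hb0 g h) fun h0 => hgh ?_)
    simp [← h0]

/-- Integrals of continuous functions with a parameter are uniform limits of Riemann sums. -/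
theorem exists_riemann_sum [MeasurableSpace G] [BorelSpace G] (μ : Measure G)
    [IsFiniteMeasure μ] {X : Type*} [TopologicalSpace X] [CompactSpace X]
    (K : C(X × G, ℝ)) {δ : ℝ} (hδ : 0 < δ) : ∃ (t : Finset G) (c : G → ℝ), (∀ g, 0 ≤ c g) ∧
      ∀ x, |∑ g ∈ t, c g * K (x, g) - ∫ g, K (x, g) ∂μ| ≤ δ := by
  have hη : 0 < δ / (μ.real Set.univ + 1) := by positivity
  -- Viewed as a map into functions of `x`, the kernel is uniformly almost constant on the members
  -- of a partition of unity `p_g`. The weights of the Riemann sum are the integrals of the `p_g`.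
  let Γ : C(G, C(X, ℝ)) := (K.comp ContinuousMap.prodSwap).curry
  have hint : ∀ f : C(G, ℝ), Integrable f μ := fun f =>
    f.continuous.integrable_of_hasCompactSupport (HasCompactSupport.of_compactSpace f)
  obtain ⟨t, p, hp0, hp1, hp⟩ := exists_partition_dist_lt Γ.continuous hη
  refine ⟨t, fun g => ∫ h, p g h ∂μ, fun g => integral_nonneg (hp0 g), fun x => ?_⟩
  have hK : ∀ x, Integrable (fun h => K (x, h)) μ := fun x =>
    hint (K.comp ⟨fun h => (x, h), by fun_prop⟩)
  have e1 : ∑ g ∈ t, (∫ h, p g h ∂μ) * K (x, g) - ∫ g, K (x, g) ∂μ =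
      ∫ h, (∑ g ∈ t, p g h * (K (x, g) - K (x, h))) ∂μ := by
    rw [show (fun h => ∑ g ∈ t, p g h * (K (x, g) - K (x, h))) =
      fun h => ∑ g ∈ t, p g h * K (x, g) - K (x, h) by
        funext h
        simp only [mul_sub, Finset.sum_sub_distrib, ← Finset.sum_mul, hp1, one_mul],
      integral_sub (integrable_finsetSum _ fun g _ => (hint (p g)).mul_const _) (hK x),
      integral_finsetSum _ fun g _ => (hint (p g)).mul_const _]
    simp only [integral_mul_const]
  rw [e1, ← Real.norm_eq_abs]
  have h2 : ∀ h, ‖∑ g ∈ t, p g h * (K (x, g) - K (x, h))‖ ≤ δ / (μ.real Set.univ + 1) := fun h => by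
    calc _ ≤ ∑ g ∈ t, p g h * (δ / (μ.real Set.univ + 1)) := by
          refine norm_sum_le_of_le _ fun g _ => ?_
          rw [norm_mul, Real.norm_of_nonneg (hp0 g h)]
          by_cases h0 : p g h = 0
          · simp [h0]
          · refine mul_le_mul_of_nonneg_left ?_ (hp0 g h)
            have := (ContinuousMap.dist_lt_iff hη).1 (hp g h h0) x
            rw [dist_comm, dist_eq_norm] at this
            exact this.le
      _ = _ := by rw [← Finset.sum_mul, hp1, one_mul]
  refine (norm_integral_le_of_norm_le_const (ae_of_all _ h2)).trans ?_
  rw [div_mul_eq_mul_div, div_le_iff₀ (by positivity)]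
  nlinarith [measureReal_nonneg (μ := μ) (s := Set.univ)]

end Partition

/-! ### The conditional expectation onto the fixed point algebra -/

namespace CStarAction

variable {G : Type v} {A : Type u} [Group G] [TopologicalSpace G] [IsTopologicalGroup G]
  [CompactSpace G] [SecondCountableTopology G] [MeasurableSpace G] [BorelSpace G]
  [NonUnitalCStarAlgebra A] (α : CStarAction G A)

open ConvAlg

theorem integrable_orbit (a : A) : Integrable (fun g => α.toAut g a) (haarProb G) :=
  integrable_of_continuous (α.continuous_orbit a)

/-- The conditional expectation onto the fixed point algebra, as a linear map. -/
noncomputable def expect : A →ₗ[ℂ] A where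
  toFun a := ∫ g, α.toAut g a ∂(haarProb G)
  map_add' a b := by
    simp only [map_add]
    exact integral_add (α.integrable_orbit a) (α.integrable_orbit b)
  map_smul' c a := by
    simp only [α.toAut_smul, RingHom.id_apply]
    exact integral_smul c _

theorem expect_apply (a : A) : α.expect a = ∫ g, α.toAut g a ∂(haarProb G) := rfl

theorem norm_integral_le_of_forall {f : G → A} {r : ℝ} (h : ∀ g, ‖f g‖ ≤ r) :
    ‖∫ g, f g ∂(haarProb G)‖ ≤ r := by
  simpa using norm_integral_le_of_norm_le_const (μ := haarProb G) (ae_of_all _ h)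

theorem norm_expect_le (a : A) : ‖α.expect a‖ ≤ ‖a‖ :=
  norm_integral_le_of_forall fun g => (α.norm_toAut g a).le

theorem norm_expect_sub_le {a b : A} {r : ℝ} (h : ∀ g, ‖α.toAut g a - b‖ ≤ r) :
    ‖α.expect a - b‖ ≤ r := by
  have e : α.expect a - b = ∫ g, (α.toAut g a - b) ∂(haarProb G) := by
    rw [integral_sub (α.integrable_orbit a) (integrable_const b)]
    simp [expect_apply]
  rw [e]
  exact norm_integral_le_of_forall h

theorem expect_mem (a : A) : α.expect a ∈ α.fixedPoints := fun g => by
  rw [expect_apply, toAut_integral g (α.continuous_orbit a)]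
  simp only [← α.toAut_mul]
  exact integral_mul_left_eq_self (μ := haarProb G) (fun h => α.toAut h a) g

theorem expect_of_mem {x : A} (hx : x ∈ α.fixedPoints) : α.expect x = x := by
  simp [expect_apply, hx _]

theorem expect_star (a : A) : α.expect (star a) = star (α.expect a) := by
  simp only [expect_apply, star_integral, map_star]

theorem expect_mul_left {x : A} (hx : x ∈ α.fixedPoints) (a : A) :
    α.expect (x * a) = x * α.expect a := by
  simp only [expect_apply, map_mul, hx _, mul_integral x (α.continuous_orbit a)]

theorem expect_mul_right {x : A} (hx : x ∈ α.fixedPoints) (a : A) :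
    α.expect (a * x) = α.expect a * x := by
  simp only [expect_apply, map_mul, hx _, integral_mul x (α.continuous_orbit a)]

theorem expect_real_smul (r : ℝ) (a : A) : α.expect (r • a) = r • α.expect a := by
  simpa only [Complex.coe_smul] using map_smul α.expect (r : ℂ) a

section Order

variable [PartialOrder A] [StarOrderedRing A]

theorem expect_nonneg {a : A} (ha : 0 ≤ a) : 0 ≤ α.expect a :=
  integral_nonneg fun g => map_nonneg (α.toAut g) ha

/-- Cauchy–Schwarz for the `A^α`-valued inner product `E(a* b)`. The expansion uses that `E` is a
bimodule map over the fixed points, so that `x = E(a* b)` can be pulled out. -/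
theorem norm_expect_star_mul_sq_le (a b : A) :
    ‖α.expect (star a * b)‖ ^ 2 ≤ ‖α.expect (star a * a)‖ * ‖α.expect (star b * b)‖ := by
  set x := α.expect (star a * b) with hx
  have hxm : x ∈ α.fixedPoints := α.expect_mem _
  refine CStarAlgebra.norm_sq_le_of_forall_le
    (.of_nonneg (α.expect_nonneg (star_mul_self_nonneg a))) fun r hr => ?_
  have h := α.expect_nonneg (star_mul_self_nonneg (r • b - r⁻¹ • (a * x)))
  rw [← sub_nonneg]
  refine h.trans_eq ?_
  have e : star (r • b - r⁻¹ • (a * x)) * (r • b - r⁻¹ • (a * x)) =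
      (r * r) • (star b * b) - star (star a * b) * x - star x * (star a * b) +
        (r⁻¹ * r⁻¹) • (star x * (star a * a) * x) := by
    simp only [star_sub, star_smul, star_trivial, star_mul, star_star, sub_mul, mul_sub,
      smul_mul_assoc, mul_smul_comm, smul_sub, smul_smul, mul_assoc, mul_inv_cancel₀ hr.ne',
      inv_mul_cancel₀ hr.ne', one_smul]
    abel
  rw [e]
  simp only [map_add, map_sub, α.expect_real_smul, α.expect_mul_right hxm,
    α.expect_mul_left (star_mem hxm), α.expect_star (star a * b), ← hx]
  abel

end Order

end CStarAction

/-! ### Asymptotic norm bounds in sequence algebras -/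

section AsymptoticBounds

variable {A : Type u} [NonUnitalCStarAlgebra A]

theorem quotMap_eq_iff {x y : BddSeq A} :
    (nullSeq A).quotMap x = (nullSeq A).quotMap y ↔
      Tendsto (fun n => ‖x n - y n‖) atTop (𝓝 0) :=
  (nullSeq A).mkₗ_eq_iff

/-- `r` is an upper bound of the quotient norm of `X`. -/
def SeqAlg.NormLE (X : SeqAlg A) (r : ℝ) : Prop :=
  ∃ x : BddSeq A, (nullSeq A).quotMap x = X ∧ ∀ ε > 0, ∀ᶠ n in atTop, ‖x n‖ ≤ r + ε

namespace SeqAlg.NormLE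

theorem eventually {x : BddSeq A} {r : ℝ} (h : SeqAlg.NormLE ((nullSeq A).quotMap x) r) {ε : ℝ}
    (hε : 0 < ε) : ∀ᶠ n in atTop, ‖x n‖ ≤ r + ε := by
  obtain ⟨y, hy, hy'⟩ := h
  filter_upwards [hy' _ (half_pos hε),
    (quotMap_eq_iff.1 hy).eventually (gt_mem_nhds (half_pos hε))] with n h1 h2
  rw [norm_sub_rev] at h2
  have := norm_add_le (x n - y n) (y n)
  rw [sub_add_cancel] at this
  linarith

theorem mono {X : SeqAlg A} {r s : ℝ} (hX : NormLE X r) (h : r ≤ s) : NormLE X s := by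
  obtain ⟨x, rfl, hx⟩ := hX
  exact ⟨x, rfl, fun ε hε => (hx ε hε).mono fun n hn => by linarith⟩

theorem const (a : A) : NormLE (constSeqAlg a) ‖a‖ :=
  ⟨constSeq a, rfl, fun ε hε => .of_forall fun n => by
    change ‖a‖ ≤ ‖a‖ + ε
    linarith⟩

end SeqAlg.NormLE

/-- On a compact space, asymptotic bounds of a continuous family of sequences are uniform. -/
theorem eventually_forall_norm_le {X : Type*} [TopologicalSpace X] [CompactSpace X]
    {f : X → BddSeq A} (hf : Continuous f) {r : ℝ}
    (h : ∀ t, SeqAlg.NormLE ((nullSeq A).quotMap (f t)) r) {ε : ℝ} (hε : 0 < ε) :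
    ∀ᶠ n in atTop, ∀ t, ‖f t n‖ ≤ r + ε := by
  obtain ⟨s, hs⟩ := isCompact_univ.elim_finite_subcover (fun t => {t' | ‖f t' - f t‖ < ε / 2})
    (fun t => isOpen_lt (by fun_prop) continuous_const)
    (fun t _ => Set.mem_iUnion.2 ⟨t, by simpa using hε⟩)
  filter_upwards [(s.eventually_all).2 fun t _ => (h t).eventually (half_pos hε)] with n hn t
  obtain ⟨t', ht', htt'⟩ := Set.mem_iUnion₂.1 (hs (Set.mem_univ t))
  have h1 : ‖(f t - f t') n‖ < ε / 2 := (lp.norm_apply_le_norm (by simp) _ n).trans_lt htt'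
  have h2 : f t n = (f t - f t') n + f t' n := by
    rw [lp.coeFn_sub, Pi.sub_apply, sub_add_cancel]
  rw [h2]
  exact (norm_add_le _ _).trans (by linarith [hn t' ht'])

end AsymptoticBounds

/-! ### Separable invariant subalgebras and invariant approximate units -/

namespace CStarAction

variable {G : Type v} {A : Type u} [Group G] [TopologicalSpace G] [NonUnitalCStarAlgebra A]

/-- The sets obtained from the orbits of the elements of `s` by finitely many algebraic
operations. -/
def orbitStage (α : CStarAction G A) (s : Set A) : ℕ → Set A
  | 0 => insert 0 ((fun q : G × A => α.toAut q.1 q.2) '' (Set.univ ×ˢ s))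
  | n + 1 => α.orbitStage s n ∪ ((fun q : A × A => q.1 + q.2) '' (α.orbitStage s n ×ˢ α.orbitStage s n)
      ∪ (fun q : A × A => q.1 * q.2) '' (α.orbitStage s n ×ˢ α.orbitStage s n)
      ∪ (fun q : ℂ × A => q.1 • q.2) '' (Set.univ ×ˢ α.orbitStage s n)
      ∪ star '' α.orbitStage s n)

variable (α : CStarAction G A) {s : Set A}

theorem orbitStage_mono : Monotone (α.orbitStage s) :=
  monotone_nat_of_le_succ fun _ => Set.subset_union_left

theorem isSeparable_orbitStage [SecondCountableTopology G] (hs : s.Countable) (n : ℕ) :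
    TopologicalSpace.IsSeparable (α.orbitStage s n) := by
  induction n with
  | zero =>
    exact (Set.countable_singleton 0).isSeparable.union
      (((TopologicalSpace.IsSeparable.of_separableSpace _).prod hs.isSeparable).image
        α.continuous_toAut)
  | succ n ih =>
    refine ih.union (((((ih.prod ih).image continuous_add).union
      ((ih.prod ih).image continuous_mul)).union ?_).union (ih.image continuous_star))
    exact ((TopologicalSpace.IsSeparable.of_separableSpace _).prod ih).image continuous_smul

theorem toAut_mem_orbitStage (g : G) (n : ℕ) {x : A} (hx : x ∈ α.orbitStage s n) :
    α.toAut g x ∈ α.orbitStage s n := by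
  induction n generalizing x with
  | zero =>
    rcases hx with rfl | ⟨⟨h, a⟩, ⟨-, ha⟩, rfl⟩
    · exact .inl (map_zero _)
    · exact .inr ⟨(g * h, a), ⟨trivial, ha⟩, α.toAut_mul g h a⟩
  | succ n ih =>
    rcases hx with hx | ((⟨⟨a, b⟩, ⟨ha, hb⟩, rfl⟩ | ⟨⟨a, b⟩, ⟨ha, hb⟩, rfl⟩) |
      ⟨⟨c, a⟩, ⟨-, ha⟩, rfl⟩) | ⟨a, ha, rfl⟩
    · exact .inl (ih hx)
    · exact .inr (.inl (.inl (.inl ⟨(_, _), ⟨ih ha, ih hb⟩, (map_add _ _ _).symm⟩)))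
    · exact .inr (.inl (.inl (.inr ⟨(_, _), ⟨ih ha, ih hb⟩, (map_mul _ _ _).symm⟩)))
    · exact .inr (.inl (.inr ⟨(_, _), ⟨trivial, ih ha⟩, (α.toAut_smul _ _ _).symm⟩))
    · exact .inr (.inr ⟨_, ih ha, (map_star _ _).symm⟩)

/-- The invariant closed subalgebra generated by `s`. -/
def orbitAlgebra (s : Set A) : NonUnitalStarSubalgebra ℂ A :=
  NonUnitalStarSubalgebra.topologicalClosure
  { carrier := ⋃ n, α.orbitStage s n
    add_mem' := by
      intro x y hx hy
      obtain ⟨m, hm⟩ := Set.mem_iUnion.1 hx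
      obtain ⟨n, hn⟩ := Set.mem_iUnion.1 hy
      exact Set.mem_iUnion.2 ⟨max m n + 1, .inr (.inl (.inl (.inl ⟨(x, y),
        ⟨α.orbitStage_mono (le_max_left m n) hm, α.orbitStage_mono (le_max_right m n) hn⟩,
        rfl⟩)))⟩
    zero_mem' := Set.mem_iUnion.2 ⟨0, .inl rfl⟩
    mul_mem' := by
      intro x y hx hy
      obtain ⟨m, hm⟩ := Set.mem_iUnion.1 hx
      obtain ⟨n, hn⟩ := Set.mem_iUnion.1 hy
      exact Set.mem_iUnion.2 ⟨max m n + 1, .inr (.inl (.inl (.inr ⟨(x, y),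
        ⟨α.orbitStage_mono (le_max_left m n) hm, α.orbitStage_mono (le_max_right m n) hn⟩,
        rfl⟩)))⟩
    smul_mem' := by
      intro c x hx
      obtain ⟨n, hn⟩ := Set.mem_iUnion.1 hx
      exact Set.mem_iUnion.2 ⟨n + 1, .inr (.inl (.inr ⟨(c, x), ⟨trivial, hn⟩, rfl⟩))⟩
    star_mem' := by
      intro x hx
      obtain ⟨n, hn⟩ := Set.mem_iUnion.1 hx
      exact Set.mem_iUnion.2 ⟨n + 1, .inr (.inr ⟨x, hn, rfl⟩)⟩ }

theorem isClosed_orbitAlgebra (s : Set A) : IsClosed (α.orbitAlgebra s : Set A) :=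
  isClosed_closure

theorem subset_orbitAlgebra {a : A} (ha : a ∈ s) : a ∈ α.orbitAlgebra s :=
  subset_closure (Set.mem_iUnion.2 ⟨0, .inr ⟨(1, a), ⟨trivial, ha⟩, α.toAut_one a⟩⟩)

theorem isInvariant_orbitAlgebra (s : Set A) : α.IsInvariant (α.orbitAlgebra s) :=
  fun g x hx => map_mem_closure (α.isometry_toAut g).continuous hx fun y hy => by
    obtain ⟨n, hn⟩ := Set.mem_iUnion.1 hy
    exact Set.mem_iUnion.2 ⟨n, α.toAut_mem_orbitStage g n hn⟩

theorem isSeparable_orbitAlgebra [SecondCountableTopology G] (hs : s.Countable) :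
    TopologicalSpace.IsSeparable (α.orbitAlgebra s : Set A) :=
  (TopologicalSpace.IsSeparable.iUnion fun n => α.isSeparable_orbitStage hs n).closure

end CStarAction

/-! ### Invariant approximate units. -/

namespace CStarAction

variable {G : Type v} {A : Type u} [Group G] [TopologicalSpace G] [IsTopologicalGroup G]
  [CompactSpace G] [SecondCountableTopology G] [MeasurableSpace G] [BorelSpace G]
  [NonUnitalCStarAlgebra A] (α : CStarAction G A)

/-- Pointwise convergence of equi-Lipschitz maps is uniform on compact sets. -/
theorem eventually_forall_norm_lt {X E : Type*} [TopologicalSpace X] [CompactSpace X]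
    [NormedAddCommGroup E] {a : X → E} (ha : Continuous a) {T : ℕ → E → E}
    (hT : ∀ n x y, ‖T n x - T n y‖ ≤ 2 * ‖x - y‖)
    (h : ∀ x, Tendsto (fun n => ‖T n (a x)‖) atTop (𝓝 0)) {ε : ℝ} (hε : 0 < ε) :
    ∀ᶠ n in atTop, ∀ x, ‖T n (a x)‖ < ε := by
  obtain ⟨s, hs⟩ := isCompact_univ.elim_finite_subcover (fun x => {y | ‖a y - a x‖ < ε / 4})
    (fun t => isOpen_lt (by fun_prop) continuous_const)
    (fun t _ => Set.mem_iUnion.2 ⟨t, by simpa using hε⟩)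
  filter_upwards [(s.eventually_all).2 fun x _ =>
    (h x).eventually (gt_mem_nhds (half_pos hε))] with n hn x
  obtain ⟨y, hy, hxy⟩ := Set.mem_iUnion₂.1 (hs (Set.mem_univ x))
  have h1 := hn y hy
  have h2 := hT n (a x) (a y)
  have h3 : ‖a x - a y‖ < ε / 4 := hxy
  have h4 := norm_add_le (T n (a x) - T n (a y)) (T n (a y))
  rw [sub_add_cancel] at h4
  linarith

/-- Averaging a sequential approximate unit over the group yields an invariant one. -/
theorem exists_invariant_approximate_unit (hA : IsSigmaUnital A) : ∃ u : ℕ → A,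
    (∀ n, u n ∈ α.fixedPoints ∧ ‖u n‖ ≤ 1 ∧ IsSelfAdjoint (u n)) ∧
    ∀ a, Tendsto (fun n => u n * a) atTop (𝓝 a) ∧ Tendsto (fun n => a * u n) atTop (𝓝 a) := by
  obtain ⟨e, he, hlim⟩ := hA
  have hes : ∀ n, star (e n) = e n := fun n => by
    obtain ⟨c, hc⟩ := (he n).2
    rw [hc, star_mul, star_star]
  have hus : ∀ n, IsSelfAdjoint (α.expect (e n)) := fun n => by
    rw [isSelfAdjoint_iff, ← expect_star, hes]
  have hleft : ∀ a, Tendsto (fun n => α.expect (e n) * a) atTop (𝓝 a) := fun a => by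
    have hT : ∀ n x y, ‖(e n * x - x) - (e n * y - y)‖ ≤ 2 * ‖x - y‖ := fun n x y => by
      have e1 : (e n * x - x) - (e n * y - y) = e n * (x - y) - (x - y) := by
        rw [mul_sub]; abel
      have h1 := norm_sub_le (e n * (x - y)) (x - y)
      have h2 := (norm_mul_le (e n) (x - y)).trans
        (mul_le_of_le_one_left (norm_nonneg _) (he n).1)
      rw [e1]
      linarith
    refine Metric.tendsto_nhds.2 fun ε hε => ?_
    filter_upwards [eventually_forall_norm_lt ((α.continuous_orbit a).comp continuous_inv) hT
      (fun x => tendsto_iff_norm_sub_tendsto_zero.1 (hlim _).1) (half_pos hε)] with n hn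
    -- The integrand is `α_g` applied to `e_n b - b` with `b = α_{g⁻¹}(a)`, which is small uniformly
    -- over the compact orbit of `a`.
    have e1 : α.expect (e n) * a - a = ∫ g, (α.toAut g (e n) * a - a) ∂(haarProb G) := by
      have hc : Continuous fun g => α.toAut g (e n) * a :=
        (α.continuous_orbit (e n)).mul continuous_const
      rw [integral_sub (ConvAlg.integrable_of_continuous hc) (integrable_const a),
        expect_apply, ConvAlg.integral_mul a (α.continuous_orbit (e n))]
      simp
    rw [dist_eq_norm, e1]
    refine (norm_integral_le_of_forall fun g => ?_).trans_lt (half_lt_self hε)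
    have h1 := (hn g).le
    rw [← α.norm_toAut g, map_sub, map_mul] at h1
    simpa only [Function.comp_apply, ← α.toAut_mul, mul_inv_cancel, α.toAut_one] using h1
  refine ⟨fun n => α.expect (e n), fun n => ⟨α.expect_mem _, (α.norm_expect_le _).trans (he n).1,
    hus n⟩, fun a => ⟨hleft a, ?_⟩⟩
  have := (hleft (star a)).star
  simpa only [star_mul, star_star, (hus _).star_eq] using this

/-- `A` has an approximate unit consisting of invariant strict contractions. -/
theorem exists_invariant_unit (hA : IsSigmaUnital A) (F : Finset A) {ε : ℝ} (hε : 0 < ε) :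
    ∃ e ∈ α.fixedPoints, IsSelfAdjoint e ∧ ‖e‖ < 1 ∧ ∀ a ∈ F, ‖e * a - a‖ < ε ∧ ‖a * e - a‖ < ε := by
  obtain ⟨u, hu, hlim⟩ := α.exists_invariant_approximate_unit hA
  -- Scaling by factors below `1` that tend to `1` makes the contractions strict. The room below `1`
  -- later makes approximate contractions into genuine ones.
  let c : ℕ → ℝ := fun n => 1 - 1 / ((n : ℝ) + 1 + 1)
  have hc0 : ∀ n, 0 ≤ c n := fun n => by
    have : 1 / ((n : ℝ) + 1 + 1) ≤ 1 := (div_le_one (by positivity)).2 (by linarith)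
    simp only [c]
    linarith
  have hc1 : ∀ n, c n < 1 := fun n => sub_lt_self _ (by positivity)
  have hcl : Tendsto c atTop (𝓝 1) := by
    have h := (tendsto_add_atTop_iff_nat 1).2 (tendsto_one_div_add_atTop_nhds_zero_nat (𝕜 := ℝ))
    simpa [c] using h.const_sub 1
  have h1 : ∀ a, Tendsto (fun n => c n • u n * a) atTop (𝓝 a) := fun a => by
    simpa only [smul_mul_assoc, one_smul] using hcl.smul (hlim a).1
  have h2 : ∀ a, Tendsto (fun n => a * c n • u n) atTop (𝓝 a) := fun a => by
    simpa only [mul_smul_comm, one_smul] using hcl.smul (hlim a).2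
  have h3 : ∀ᶠ n in atTop, ∀ a ∈ F, ‖c n • u n * a - a‖ < ε ∧ ‖a * c n • u n - a‖ < ε :=
    (F.eventually_all).2 fun a _ => by
      have h4 := Metric.tendsto_nhds.1 (h1 a) ε hε
      have h5 := Metric.tendsto_nhds.1 (h2 a) ε hε
      simp only [dist_eq_norm] at h4 h5
      exact h4.and h5
  obtain ⟨n, hn⟩ := h3.exists
  refine ⟨c n • u n, ?_, (IsSelfAdjoint.all (c n)).smul (hu n).2.2, ?_, hn⟩
  · rw [← Complex.coe_smul]
    exact SMulMemClass.smul_mem _ (hu n).1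
  · rw [norm_smul, Real.norm_of_nonneg (hc0 n)]
    exact (mul_le_of_le_one_right (hc0 n) (hu n).2.1).trans_lt (hc1 n)

end CStarAction

/-! ### Lifts of Rokhlin homomorphisms -/

namespace CStarAction

variable {G : Type v} {A : Type u} [Group G] [TopologicalSpace G] [IsTopologicalGroup G]
  [CompactSpace G] [NonUnitalCStarAlgebra A]

/-- A lift to `A_∞` of a unital equivariant `*`-homomorphism from `C(G)` to `F_α(D, A)`. -/
structure RokhlinLift (α : CStarAction G A) (D : NonUnitalStarSubalgebra ℂ A) where
  toFun : C(G, ℂ) → SeqAlg A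
  mem_cont : ∀ f, toFun f ∈ α.contSeqAlg
  comm : ∀ f, ∀ d ∈ D, constSeqAlg d * toFun f = toFun f * constSeqAlg d
  one_mul : ∀ d ∈ D, toFun 1 * constSeqAlg d = constSeqAlg d
  mul_mul : ∀ f k, ∀ d ∈ D, toFun (f * k) * constSeqAlg d = toFun f * toFun k * constSeqAlg d
  add_mul : ∀ f k, ∀ d ∈ D,
    toFun (f + k) * constSeqAlg d = toFun f * constSeqAlg d + toFun k * constSeqAlg d
  smul_mul : ∀ (c : ℂ) f, ∀ d ∈ D, toFun (c • f) * constSeqAlg d = c • (toFun f * constSeqAlg d)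
  star_mul : ∀ f, ∀ d ∈ D, toFun (star f) * constSeqAlg d = star (toFun f) * constSeqAlg d
  equivariant : ∀ g f, ∀ d ∈ D,
    toFun (leftTranslate g f) * constSeqAlg d = α.onSeqAlg g (toFun f) * constSeqAlg d

theorem annihil_quotMap_eq {D : NonUnitalStarSubalgebra ℂ A} {x y : relComm D}
    (h : (annihil D).quotMap x = (annihil D).quotMap y) {d : A} (hd : d ∈ D) :
    (x : SeqAlg A) * constSeqAlg d = (y : SeqAlg A) * constSeqAlg d := by
  have h1 := (((annihil D).mkₗ_eq_iff).1 h d hd).1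
  rwa [AddSubgroupClass.coe_sub, sub_mul, sub_eq_zero] at h1

theorem mem_contBddSeq_of_fixed {α : CStarAction G A} {x : BddSeq A}
    (h : ∀ n, x n ∈ α.fixedPoints) : x ∈ α.contBddSeq := by
  have : ∀ g, α.onBddSeq g x = x := fun g => by
    ext n
    exact h n g
  change Continuous fun g => α.onBddSeq g x
  simpa only [this] using continuous_const

/-- Choosing representatives makes the algebraic relations hold only up to the annihilator of `D`,
hence exactly after multiplication by elements of `D`. Unitality of `φ` is stated only relative to
`F_α(D, A)`; to get `φ(1) d = d` one needs an element of that algebra acting as a unit on `D`, and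
an invariant approximate unit provides one. -/
theorem HasRokhlinProperty.exists_lift {α : CStarAction G A} (hα : α.HasRokhlinProperty)
    {D : NonUnitalStarSubalgebra ℂ A} (hD : α.IsInvariant D) (hDc : IsClosed (D : Set A))
    (hDs : TopologicalSpace.IsSeparable (D : Set A)) {u : ℕ → A}
    (hu : ∀ n, u n ∈ α.fixedPoints ∧ ‖u n‖ ≤ 1)
    (hlim : ∀ a, Tendsto (fun n => u n * a) atTop (𝓝 a) ∧
      Tendsto (fun n => a * u n) atTop (𝓝 a)) : Nonempty (RokhlinLift α D) := by
  obtain ⟨φ, hφ1, hφ⟩ := hα D hD hDc hDs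
  have hex : ∀ f, ∃ w : relComm D, (w : SeqAlg A) ∈ α.contSeqAlg ∧
      (annihil D).quotMap w = (φ f : CentralSeqAlg D) := fun f => by
    obtain ⟨w, hw, hwf⟩ := (φ f).2
    exact ⟨w, hw, hwf⟩
  choose w hwc hw using hex
  let U : BddSeq A := ⟨u, memℓp_infty ⟨1, by rintro _ ⟨n, rfl⟩; exact (hu n).2⟩⟩
  have hUd : ∀ d, (nullSeq A).quotMap U * constSeqAlg d = constSeqAlg d := fun d =>
    quotMap_eq_iff.2 (tendsto_iff_norm_sub_tendsto_zero.1 (hlim d).1)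
  have hdU : ∀ d, constSeqAlg d * (nullSeq A).quotMap U = constSeqAlg d := fun d =>
    quotMap_eq_iff.2 (tendsto_iff_norm_sub_tendsto_zero.1 (hlim d).2)
  let V : relComm D := ⟨(nullSeq A).quotMap U, mem_relComm.2 fun d hd => by rw [hUd, hdU]⟩
  let Y : α.contCentralSeqAlg D := ⟨(annihil D).quotMap V, ⟨V,
    ⟨U, mem_contBddSeq_of_fixed fun n => (hu n).1, rfl⟩, rfl⟩⟩
  have hY := congrArg Subtype.val (hφ1 Y).1
  refine ⟨⟨fun f => w f, hwc, fun f => mem_relComm.1 (w f).2, fun d hd => ?_, fun f k d hd => ?_,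
    fun f k d hd => ?_, fun c f d hd => ?_, fun f d hd => ?_, fun g f d hd => ?_⟩⟩
  -- From `φ(1) [U] = [U]` and `U d = d` one obtains `w(1) d = w(1) U d = U d = d`.
  · have h1 : (annihil D).quotMap (w 1 * V) = (annihil D).quotMap V := by
      rw [map_mul, hw]; exact hY
    have h2 := annihil_quotMap_eq h1 hd
    have h3 : (((w 1 * V : relComm D)) : SeqAlg A) = w 1 * (nullSeq A).quotMap U := rfl
    have h4 : (V : SeqAlg A) = (nullSeq A).quotMap U := rfl
    rwa [h3, h4, mul_assoc, hUd] at h2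
  · exact annihil_quotMap_eq (y := w f * w k) (by
      rw [map_mul, hw, hw, hw, map_mul]; rfl) hd
  · have := annihil_quotMap_eq (x := w (f + k)) (y := w f + w k) (by
      rw [map_add, hw, hw, hw, map_add]; rfl) hd
    rw [this, ← add_mul]; rfl
  · have := annihil_quotMap_eq (x := w (c • f)) (y := c • w f) (by
      rw [map_smul, hw, hw, map_smul]; rfl) hd
    rw [this, ← smul_mul_assoc]; rfl
  · exact annihil_quotMap_eq (x := w (star f)) (y := star (w f)) (by
      rw [map_star, hw, hw, map_star]; rfl) hd
  · exact annihil_quotMap_eq (x := w (leftTranslate g f)) (y := α.onRelComm D hD g (w f)) (by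
      rw [hw, hφ, ← hw]; rfl) hd

end CStarAction

/-! ### Norm estimates for lifts of Rokhlin homomorphisms -/

namespace CStarAction

variable {G : Type v} {A : Type u} [Group G] [TopologicalSpace G] [IsTopologicalGroup G]
  [CompactSpace G] [NonUnitalCStarAlgebra A]

/-- A real valued continuous function, as a complex valued one. -/
def ofRealMap (p : C(G, ℝ)) : C(G, ℂ) := ⟨fun s => (p s : ℂ), by fun_prop⟩

@[simp] theorem ofRealMap_apply (p : C(G, ℝ)) (s : G) : ofRealMap p s = (p s : ℂ) := rfl

theorem star_ofRealMap (p : C(G, ℝ)) : star (ofRealMap p) = ofRealMap p := by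
  ext s; simp

theorem ofRealMap_mul (p q : C(G, ℝ)) : ofRealMap (p * q) = ofRealMap p * ofRealMap q := by
  ext s; simp

namespace RokhlinLift

variable {α : CStarAction G A} {D : NonUnitalStarSubalgebra ℂ A} (N : RokhlinLift α D)

/-- The map `f ↦ N f * d`, as a linear map. -/
noncomputable def mulRight {d : A} (hd : d ∈ D) : C(G, ℂ) →ₗ[ℂ] SeqAlg A where
  toFun f := N.toFun f * constSeqAlg d
  map_add' f k := N.add_mul f k d hd
  map_smul' c f := N.smul_mul c f d hd

theorem sum_mul {ι : Type*} (t : Finset ι) (f : ι → C(G, ℂ)) {d : A} (hd : d ∈ D) :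
    N.toFun (∑ i ∈ t, f i) * constSeqAlg d = ∑ i ∈ t, N.toFun (f i) * constSeqAlg d :=
  map_sum (N.mulRight hd) f t

theorem sub_mul (f k : C(G, ℂ)) {d : A} (hd : d ∈ D) :
    N.toFun (f - k) * constSeqAlg d = N.toFun f * constSeqAlg d - N.toFun k * constSeqAlg d :=
  map_sub (N.mulRight hd) f k

theorem zero_mul {d : A} (hd : d ∈ D) : N.toFun 0 * constSeqAlg d = 0 :=
  map_zero (N.mulRight hd)

theorem star_comm (f : C(G, ℂ)) {d : A} (hd : d ∈ D) :
    constSeqAlg d * star (N.toFun f) = star (N.toFun f) * constSeqAlg d := by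
  have := congrArg star (N.comm f (star d) (star_mem hd))
  rw [StarMul.star_mul, StarMul.star_mul, ← map_star, star_star] at this
  exact this.symm

/-- The products `N(f) d` multiply like elementary tensors in `C(G) ⊗ D`. The following bounds then
play the role of the contractive map `C(G) ⊗ D → A_∞`, without constructing the tensor product. -/
theorem mul_const_mul (f k : C(G, ℂ)) {d d' : A} (hd : d ∈ D) (hd' : d' ∈ D) :
    N.toFun f * constSeqAlg d * (N.toFun k * constSeqAlg d') =
      N.toFun (f * k) * constSeqAlg (d * d') := by
  rw [N.mul_mul f k _ (mul_mem hd hd'), map_mul, ← mul_assoc, mul_assoc (N.toFun f),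
    N.comm k d hd, ← mul_assoc, ← mul_assoc]

theorem star_mul_const (f : C(G, ℂ)) {d : A} (hd : d ∈ D) :
    star (N.toFun f * constSeqAlg d) = N.toFun (star f) * constSeqAlg (star d) := by
  rw [StarMul.star_mul, ← map_star, N.star_comm f (star_mem hd), N.star_mul f _ (star_mem hd)]

theorem mul_const_star_mul (f k : C(G, ℂ)) {d d' : A} (hd : d ∈ D) (hd' : d' ∈ D) :
    N.toFun f * constSeqAlg d * star (N.toFun k * constSeqAlg d') =
      N.toFun (f * star k) * constSeqAlg (d * star d') := by
  rw [N.star_mul_const k hd', N.mul_const_mul _ _ hd (star_mem hd')]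

theorem onSeqAlg_mul_const (hD : α.IsInvariant D) (g : G) (f : C(G, ℂ)) {d : A} (hd : d ∈ D) :
    α.onSeqAlg g (N.toFun f * constSeqAlg d) =
      N.toFun (leftTranslate g f) * constSeqAlg (α.toAut g d) := by
  rw [map_mul, onSeqAlg_const, N.equivariant g f _ (hD g d hd)]

theorem exists_rep (f : C(G, ℂ)) : ∃ z ∈ α.contBddSeq, (nullSeq A).quotMap z = N.toFun f := by
  obtain ⟨z, hz, h⟩ := N.mem_cont f
  exact ⟨z, hz, h⟩

variable [PartialOrder A] [StarOrderedRing A]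

theorem quotMap_conj {z : BddSeq A} {h : C(G, ℂ)} (hz : (nullSeq A).quotMap z = N.toFun h)
    (hh : star h = h) {e d : A} (he : e ∈ D) (hd : d ∈ D) :
    (nullSeq A).quotMap (z * constSeq e * constSeq d * star (z * constSeq e)) =
      N.toFun (h * h) * constSeqAlg (e * d * star e) := by
  have h1 : (nullSeq A).quotMap (z * constSeq e * constSeq d * star (z * constSeq e)) =
      N.toFun h * constSeqAlg (e * d) * star (N.toFun h * constSeqAlg e) := by
    simp only [map_mul, map_star, hz, mul_assoc]
    rfl
  rw [h1, N.mul_const_star_mul _ _ (mul_mem he hd) he, hh]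

theorem quotMap_mul_star {z : BddSeq A} {h : C(G, ℂ)} (hz : (nullSeq A).quotMap z = N.toFun h)
    (hh : star h = h) {e : A} (he : e ∈ D) :
    (nullSeq A).quotMap (z * constSeq e * star (z * constSeq e)) =
      N.toFun (h * h) * constSeqAlg (e * star e) := by
  have h1 : (nullSeq A).quotMap (z * constSeq e * star (z * constSeq e)) =
      N.toFun h * constSeqAlg e * star (N.toFun h * constSeqAlg e) := by
    simp only [map_mul, map_star, hz]
    rfl
  rw [h1, N.mul_const_star_mul _ _ he he, hh]

theorem _root_.BddSeq.sum_apply {ι : Type*} (t : Finset ι) (x : ι → BddSeq A) (n : ℕ) :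
    (∑ i ∈ t, x i) n = ∑ i ∈ t, x i n := by
  rw [lp.coeFn_sum, Finset.sum_apply]

/-- The sum is represented by `∑ (z_i e) d_i (z_i e)*`, where the `z_i` lift `N(h_i)`, and `∑ (z_i
e)(z_i e)*` represents the constant `e e*`. Cauchy–Schwarz at each index gives the bound. -/
theorem normLE_sum_conj {ι : Type*} {t : Finset ι} {h : ι → C(G, ℂ)} (hh : ∀ i, star (h i) = h i)
    (hsum : ∑ i ∈ t, h i * h i = 1) {d : ι → A} (hd : ∀ i ∈ t, d i ∈ D) {m : ℝ} (hm : 0 ≤ m)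
    (hdm : ∀ i ∈ t, ‖d i‖ ≤ m) {e : A} (he : e ∈ D) :
    SeqAlg.NormLE (∑ i ∈ t, N.toFun (h i * h i) * constSeqAlg (e * d i * star e))
      (m * ‖e * star e‖) := by
  choose z hzc hz using fun i => N.exists_rep (h i)
  refine ⟨∑ i ∈ t, z i * constSeq e * constSeq (d i) * star (z i * constSeq e), ?_, ?_⟩
  · rw [map_sum]
    exact Finset.sum_congr rfl fun i hi => N.quotMap_conj (hz i) (hh i) he (hd i hi)
  intro ε hε
  have h1 : (nullSeq A).quotMap (∑ i ∈ t, z i * constSeq e * star (z i * constSeq e)) =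
      constSeqAlg (e * star e) := by
    rw [map_sum, Finset.sum_congr rfl fun i _ => N.quotMap_mul_star (hz i) (hh i) he,
      ← N.sum_mul t _ (mul_mem he (star_mem he)), hsum, N.one_mul _ (mul_mem he (star_mem he))]
  have h2 : SeqAlg.NormLE ((nullSeq A).quotMap
      (∑ i ∈ t, z i * constSeq e * star (z i * constSeq e))) ‖e * star e‖ := by
    rw [h1]; exact SeqAlg.NormLE.const _
  filter_upwards [h2.eventually (show 0 < ε / (m + 1) by positivity)] with n hn
  rw [BddSeq.sum_apply] at hn ⊢
  have h3 := CStarAlgebra.norm_sum_conj_le t (fun i => z i n * e) d hdm hm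
  refine h3.trans ((mul_le_mul_of_nonneg_left hn hm).trans ?_)
  rw [mul_add]
  refine add_le_add le_rfl ?_
  rw [mul_div_assoc', div_le_iff₀ (by positivity)]
  nlinarith

/-- A function of the form `∑ p_i ⊗ e d_i e` has norm at most `m ‖e²‖`; the preceding lemma is
applied to `h_i = √p_i`. The indices will be pairs, so that some products `p_i` vanish and no bound
on `d_i` is available. -/
theorem normLE_sum {ι : Type*} {t : Finset ι} {p : ι → C(G, ℝ)} (hp : ∀ i s, 0 ≤ p i s)
    (hsum : ∀ s, ∑ i ∈ t, p i s = 1) {d : ι → A} (hd : ∀ i ∈ t, d i ∈ D) {m : ℝ} (hm : 0 ≤ m)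
    (hdm : ∀ i ∈ t, ∀ s, p i s ≠ 0 → ‖d i‖ ≤ m) {e : A} (he : e ∈ D) (hes : star e = e) :
    SeqAlg.NormLE (∑ i ∈ t, N.toFun (ofRealMap (p i)) * constSeqAlg (e * d i * e))
      (m * ‖e * e‖) := by
  classical
  let h : ι → C(G, ℂ) := fun i => ofRealMap ⟨fun s => √(p i s), by fun_prop⟩
  have hh : ∀ i, h i * h i = ofRealMap (p i) := fun i => by
    ext s
    simp only [h, ContinuousMap.mul_apply, ofRealMap_apply, ContinuousMap.coe_mk]
    rw [← Complex.ofReal_mul, Real.mul_self_sqrt (hp i s)]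
  have key := N.normLE_sum_conj (t := t) (h := h) (fun i => star_ofRealMap _) (by
    simp only [hh]
    ext s
    rw [ContinuousMap.sum_apply]
    simp only [ofRealMap_apply, ContinuousMap.one_apply]
    rw [← Complex.ofReal_sum, hsum, Complex.ofReal_one])
    -- Terms with `p_i = 0` contribute nothing, and replacing their `d_i` by `0` supplies the
    -- missing bound.
    (d := fun i => if p i = 0 then 0 else d i) (fun i hi => by
      split_ifs
      · exact zero_mem D
      · exact hd i hi) hm (fun i hi => by
      split_ifs with h0
      · simpa using hm
      · obtain ⟨s, hs⟩ := DFunLike.ne_iff.1 h0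
        exact hdm i hi s hs) he
  rw [hes] at key
  convert key using 2 with i hi
  rw [hh]
  split_ifs with h0
  · have : ofRealMap (p i) = (0 : C(G, ℂ)) := by ext s; simp [h0]
    rw [this, mul_zero, MulZeroClass.zero_mul, map_zero, mul_zero,
      N.zero_mul (mul_mem (mul_mem he (hd i hi)) he)]
  · rfl

/-- For `k = √(δ² - |f|²)` one has `f* f + k* k = δ²`, so `(N(f) d)* (N(f) d)` is dominated, up to
null sequences, by `δ² d* d`. -/
theorem normLE_mul_const {f : C(G, ℂ)} {δ : ℝ} (hδ : 0 ≤ δ) (hf : ∀ s, ‖f s‖ ≤ δ) {d : A}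
    (hd : d ∈ D) : SeqAlg.NormLE (N.toFun f * constSeqAlg d) (δ * ‖d‖) := by
  let k : C(G, ℂ) := ofRealMap ⟨fun s => √(δ ^ 2 - ‖f s‖ ^ 2), by fun_prop⟩
  have hk : star f * f + star k * k = ((δ ^ 2 : ℝ) : ℂ) • (1 : C(G, ℂ)) := by
    ext s
    have h1 : 0 ≤ δ ^ 2 - ‖f s‖ ^ 2 := sub_nonneg.2 (pow_le_pow_left₀ (norm_nonneg _) (hf s) 2)
    simp only [k, star_ofRealMap, ContinuousMap.add_apply, ContinuousMap.mul_apply,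
      ContinuousMap.star_apply, ofRealMap_apply, ContinuousMap.coe_mk, ContinuousMap.smul_apply,
      ContinuousMap.one_apply, smul_eq_mul, mul_one]
    rw [← Complex.ofReal_mul, Real.mul_self_sqrt h1, Complex.star_def, Complex.conj_mul']
    push_cast
    ring
  obtain ⟨z, -, hz⟩ := N.exists_rep f
  obtain ⟨w, -, hw⟩ := N.exists_rep k
  have hz' : (nullSeq A).quotMap (z * constSeq d) = N.toFun f * constSeqAlg d := by
    rw [map_mul, hz]; rfl
  have hw' : (nullSeq A).quotMap (w * constSeq d) = N.toFun k * constSeqAlg d := by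
    rw [map_mul, hw]; rfl
  have hdd : star d * d ∈ D := mul_mem (star_mem hd) hd
  have h1 : (nullSeq A).quotMap (star (z * constSeq d) * (z * constSeq d) +
      star (w * constSeq d) * (w * constSeq d)) =
      constSeqAlg (((δ ^ 2 : ℝ) : ℂ) • (star d * d)) := by
    rw [map_add, map_mul _ (star (z * constSeq d)), map_mul _ (star (w * constSeq d)), map_star,
      map_star, hz', hw', N.star_mul_const _ hd, N.star_mul_const _ hd,
      N.mul_const_mul _ _ (star_mem hd) hd, N.mul_const_mul _ _ (star_mem hd) hd,
      ← N.add_mul _ _ _ hdd, hk, N.smul_mul _ _ _ hdd, N.one_mul _ hdd, map_smul]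
  have h2 : SeqAlg.NormLE ((nullSeq A).quotMap (star (z * constSeq d) * (z * constSeq d) +
      star (w * constSeq d) * (w * constSeq d))) ((δ * ‖d‖) ^ 2) := by
    rw [h1]
    refine (SeqAlg.NormLE.const _).mono ?_
    rw [norm_smul, CStarRing.norm_star_mul_self, Complex.norm_real,
      Real.norm_of_nonneg (sq_nonneg δ)]
    exact le_of_eq (by ring)
  refine ⟨_, hz', fun ε hε => ?_⟩
  filter_upwards [h2.eventually (show 0 < ε ^ 2 by positivity)] with n hn
  have h3 : ‖star ((z * constSeq d) n) * (z * constSeq d) n‖ ≤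
      ‖(star (z * constSeq d) * (z * constSeq d) + star (w * constSeq d) * (w * constSeq d)) n‖ :=
    CStarAlgebra.norm_le_norm_of_nonneg_of_le (star_mul_self_nonneg _)
      (le_add_of_nonneg_right (star_mul_self_nonneg ((w * constSeq d) n)))
  rw [CStarRing.norm_star_mul_self] at h3
  have h4 : 0 ≤ δ * ‖d‖ := by positivity
  refine le_of_sq_le_sq ?_ (by positivity)
  nlinarith

end RokhlinLift

end CStarAction

namespace CStarAction

variable {G : Type v} {A : Type u} [Group G] [TopologicalSpace G] [IsTopologicalGroup G]
  [CompactSpace G] [NonUnitalCStarAlgebra A]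

theorem constSeq_mem_contBddSeq (α : CStarAction G A) (a : A) : constSeq a ∈ α.contBddSeq := by
  have : (fun g => α.onBddSeq g (constSeq a)) = fun g => constSeq (α.toAut g a) := rfl
  change Continuous fun g => α.onBddSeq g (constSeq a)
  rw [this]
  have hc : Isometry (constSeq : A → BddSeq A) := by
    refine AddMonoidHomClass.isometry_of_norm constSeq fun a => ?_
    refine le_antisymm (lp.norm_le_of_forall_le (norm_nonneg _) fun _ => le_rfl) ?_
    exact lp.norm_apply_le_norm (by simp) (constSeq a) 0
  exact hc.continuous.comp (α.continuous_orbit a)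

/-! ### Approximately multiplicative maps onto the fixed point algebra -/

/-- `leftTranslate` on real valued functions. -/
def leftTranslateReal (g : G) (f : C(G, ℝ)) : C(G, ℝ) :=
  f.comp ⟨fun h => g⁻¹ * h, by fun_prop⟩

theorem leftTranslate_ofRealMap (g : G) (f : C(G, ℝ)) :
    leftTranslate g (ofRealMap f) = ofRealMap (leftTranslateReal g f) := rfl

namespace RokhlinLift

variable {α : CStarAction G A} {D : NonUnitalStarSubalgebra ℂ A} (N : RokhlinLift α D)
  (t : Finset G) (p : G → C(G, ℝ)) (e : A)

/-- The element of `A_∞` corresponding to `∑ p_g ⊗ e α_g(a) e`. -/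
noncomputable def average (a : A) : SeqAlg A :=
  ∑ g ∈ t, N.toFun (ofRealMap (p g)) * constSeqAlg (e * α.toAut g a * e)

variable [PartialOrder A] [StarOrderedRing A] {t p e}
  (hD : α.IsInvariant D) (hp : ∀ g s, 0 ≤ p g s) (hsum : ∀ s, ∑ g ∈ t, p g s = 1)
  (he : e ∈ D) (hes : star e = e) (he1 : ‖e‖ ≤ 1) {η : ℝ} (hη : 0 ≤ η)

include hD he hsum in
theorem average_of_fixed {b : A} (hb : b ∈ D) (hbα : b ∈ α.fixedPoints) :
    N.average t p e b = constSeqAlg (e * b * e) := by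
  have hm : e * b * e ∈ D := mul_mem (mul_mem he hb) he
  have h1 : ∑ g ∈ t, ofRealMap (p g) = 1 := by
    ext s
    rw [ContinuousMap.sum_apply]
    simp only [ofRealMap_apply, ContinuousMap.one_apply]
    rw [← Complex.ofReal_sum, hsum, Complex.ofReal_one]
  simp only [average, hbα _]
  rw [← N.sum_mul t _ hm, h1, N.one_mul _ hm]

theorem norm_mul_self_le_one (he1 : ‖e‖ ≤ 1) : ‖e * e‖ ≤ 1 :=
  (norm_mul_le e e).trans (mul_le_one₀ he1 (norm_nonneg _) he1)

include hsum in
theorem mul_const_eq_sum (f : C(G, ℂ)) {d : A} (hd : d ∈ D) :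
    N.toFun f * constSeqAlg d = ∑ g ∈ t, N.toFun (f * ofRealMap (p g)) * constSeqAlg d := by
  have h1 : ∑ g ∈ t, ofRealMap (p g) = 1 := by
    ext s
    rw [ContinuousMap.sum_apply]
    simp only [ofRealMap_apply, ContinuousMap.one_apply]
    rw [← Complex.ofReal_sum, hsum, Complex.ofReal_one]
  rw [← N.sum_mul t _ hd, ← Finset.mul_sum, h1, mul_one]

-- The difference becomes a double sum with weights `p_g p_h`. Where such a weight is nonzero at
-- `r`, both `α_g(b)` and `α_h(b)` are within `η` of `α_r(b)`; the rest of the error is the defect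
-- of `e²` as a unit between `a` and `b`.
include hp hsum hD he hes he1 hη in
theorem normLE_average_mul_sub {a b : A} (ha : a ∈ D) (hb : b ∈ D)
    (hpb : ∀ g s, p g s ≠ 0 → ‖α.toAut s b - α.toAut g b‖ ≤ η) (heα : e ∈ α.fixedPoints) :
    SeqAlg.NormLE (N.average t p e a * N.average t p e b - N.average t p e (a * b))
      (‖a‖ * (2 * η) + ‖a * e * e * b - a * b‖) := by
  have hm : ∀ c ∈ D, e * c * e ∈ D := fun c hc => mul_mem (mul_mem he hc) he
  have h1 : N.average t p e a * N.average t p e b - N.average t p e (a * b) =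
      ∑ i ∈ t ×ˢ t, N.toFun (ofRealMap (p i.1 * p i.2)) *
        constSeqAlg (e * (α.toAut i.1 a * e * e * α.toAut i.2 b - α.toAut i.1 (a * b)) * e) := by
    rw [Finset.sum_product, average, average, average, Finset.sum_mul_sum,
      ← Finset.sum_sub_distrib]
    refine Finset.sum_congr rfl fun i _ => ?_
    rw [N.mul_const_eq_sum hsum _ (hm _ (hD _ _ (mul_mem ha hb))), ← Finset.sum_sub_distrib]
    refine Finset.sum_congr rfl fun j _ => ?_
    rw [N.mul_const_mul _ _ (hm _ (hD _ _ ha)) (hm _ (hD _ _ hb)), ← ofRealMap_mul, ← mul_sub,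
      ← map_sub]
    congr 2
    noncomm_ring
  rw [h1]
  refine (N.normLE_sum (m := ‖a‖ * (2 * η) + ‖a * e * e * b - a * b‖)
    (fun i r => mul_nonneg (hp _ _) (hp _ _)) (fun r => ?_)
    (fun i _ => sub_mem (mul_mem (mul_mem (mul_mem (hD _ _ ha) he) he) (hD _ _ hb))
      (hD _ _ (mul_mem ha hb))) (by positivity) (fun i _ r hr => ?_) he hes).mono
    (mul_le_of_le_one_right (by positivity) (norm_mul_self_le_one he1))
  · rw [Finset.sum_product]
    simp only [ContinuousMap.mul_apply, ← Finset.mul_sum, hsum, mul_one]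
  · have h2 := hpb _ _ (left_ne_zero_of_mul hr)
    have h3 := hpb _ _ (right_ne_zero_of_mul hr)
    have h4 : ‖α.toAut i.2 b - α.toAut i.1 b‖ ≤ 2 * η := by
      have := norm_sub_le (α.toAut r b - α.toAut i.1 b) (α.toAut r b - α.toAut i.2 b)
      rw [sub_sub_sub_cancel_left] at this
      linarith
    have e1 : α.toAut i.1 a * e * e * α.toAut i.2 b - α.toAut i.1 (a * b) =
        α.toAut i.1 a * (e * e) * (α.toAut i.2 b - α.toAut i.1 b) +
          α.toAut i.1 (a * e * e * b - a * b) := by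
      simp only [map_sub, map_mul, heα _]
      noncomm_ring
    rw [e1]
    refine (norm_add_le _ _).trans (add_le_add ?_ (α.norm_toAut _ _).le)
    refine (norm_mul_le _ _).trans (mul_le_mul ?_ h4 (norm_nonneg _) (norm_nonneg _))
    refine (norm_mul_le _ _).trans ?_
    rw [α.norm_toAut]
    exact mul_le_of_le_one_right (norm_nonneg _) (norm_mul_self_le_one he1)

-- The function `r ↦ α_r(a)` is invariant under translation combined with `α`. After refining the
-- translated partition by the original one, the two discretizations differ by at most `2 η`
-- wherever their weights overlap.
include hp hsum hD he hes he1 hη in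
theorem normLE_onSeqAlg_average_sub {a : A} (ha : a ∈ D) (s : G)
    (hpa : ∀ g s, p g s ≠ 0 → ‖α.toAut s a - α.toAut g a‖ ≤ η) (heα : e ∈ α.fixedPoints) :
    SeqAlg.NormLE (α.onSeqAlg s (N.average t p e a) - N.average t p e a) (2 * η) := by
  have h1 : α.onSeqAlg s (N.average t p e a) - N.average t p e a =
      ∑ i ∈ t ×ˢ t, N.toFun (ofRealMap (leftTranslateReal s (p i.1) * p i.2)) *
        constSeqAlg (e * (α.toAut (s * i.1) a - α.toAut i.2 a) * e) := by
    have hm : ∀ g, e * α.toAut g a * e ∈ D := fun g => mul_mem (mul_mem he (hD _ _ ha)) he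
    have hsum' : ∀ r, ∑ g ∈ t, leftTranslateReal s (p g) r = 1 := fun r => hsum (s⁻¹ * r)
    have e1 : α.onSeqAlg s (N.average t p e a) = ∑ i ∈ t, ∑ j ∈ t,
        N.toFun (ofRealMap (leftTranslateReal s (p i) * p j)) *
          constSeqAlg (e * α.toAut (s * i) a * e) := by
      rw [average, map_sum]
      refine Finset.sum_congr rfl fun i _ => ?_
      rw [N.onSeqAlg_mul_const hD _ _ (hm i), leftTranslate_ofRealMap,
        N.mul_const_eq_sum hsum _ (hD _ _ (hm i))]
      simp only [ofRealMap_mul, α.toAut_map_mul, heα _, α.toAut_mul]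
    have e2 : N.average t p e a = ∑ i ∈ t, ∑ j ∈ t,
        N.toFun (ofRealMap (leftTranslateReal s (p i) * p j)) *
          constSeqAlg (e * α.toAut j a * e) := by
      rw [Finset.sum_comm, average]
      refine Finset.sum_congr rfl fun i _ => ?_
      rw [N.mul_const_eq_sum hsum' _ (hm i)]
      simp only [ofRealMap_mul, mul_comm]
    rw [e1]
    conv_lhs => rw [e2]
    rw [Finset.sum_product, ← Finset.sum_sub_distrib]
    refine Finset.sum_congr rfl fun i _ => ?_
    rw [← Finset.sum_sub_distrib]
    refine Finset.sum_congr rfl fun j _ => ?_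
    rw [← mul_sub, ← map_sub]
    congr 2
    noncomm_ring
  rw [h1]
  refine (N.normLE_sum (m := 2 * η) (fun i r => mul_nonneg (hp _ _) (hp _ _)) (fun r => ?_)
    (fun i _ => sub_mem (hD _ _ ha) (hD _ _ ha)) (by positivity) (fun i _ r hr => ?_) he hes).mono
    (mul_le_of_le_one_right (by positivity) (norm_mul_self_le_one he1))
  · rw [Finset.sum_product]
    simp only [ContinuousMap.mul_apply, ← Finset.mul_sum, hsum, mul_one]
    exact hsum _
  · have h2 := hpa _ _ (left_ne_zero_of_mul hr)
    have h3 := hpa _ _ (right_ne_zero_of_mul hr)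
    rw [← α.norm_toAut s, map_sub, ← α.toAut_mul, ← α.toAut_mul, ContinuousMap.coe_mk,
      mul_inv_cancel_left] at h2
    have := norm_sub_le (α.toAut r a - α.toAut i.2 a) (α.toAut r a - α.toAut (s * i.1) a)
    rw [sub_sub_sub_cancel_left] at this
    linarith

end RokhlinLift

/-- One term of a sequence representing `average` is almost multiplicative and almost invariant on
the finite set, and averaging over `G` makes it exactly invariant at small cost. The explicit
formula in the conclusion is kept because it shows complete positivity. -/
theorem exists_approx_mul_map [SecondCountableTopology G] [MeasurableSpace G] [BorelSpace G]
    [PartialOrder A] [StarOrderedRing A] {α : CStarAction G A} (hα : α.HasRokhlinProperty)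
    (hA : IsSigmaUnital A) (F : Finset A) {ε : ℝ} (hε : 0 < ε) : ∃ ψ : A →ₗ[ℂ] A,
      (∃ (t : Finset G) (y : G → A),
        ∀ a, ψ a = α.expect (∑ g ∈ t, y g * α.toAut g a * star (y g))) ∧
      (∀ a, ‖ψ a‖ ≤ ‖a‖) ∧
      (∀ a ∈ F, ∀ b ∈ F, a * b ∈ F → ‖ψ (a * b) - ψ a * ψ b‖ < ε) ∧
      ∀ a ∈ F, a ∈ α.fixedPoints → ‖ψ a - a‖ < ε := by
  set M := ∑ a ∈ F, ‖a‖ with hM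
  have hFM : ∀ a ∈ F, ‖a‖ ≤ M := fun a ha =>
    Finset.single_le_sum (f := fun a => ‖a‖) (fun a _ => norm_nonneg a) ha
  have hM0 : 0 ≤ M := Finset.sum_nonneg fun a _ => norm_nonneg a
  -- The multiplicativity error adds up to `4 δ + 10 M δ`, which is below `11 (M + 1) δ`.
  set δ := ε / (11 * (M + 1)) with hδ
  have hδ0 : 0 < δ := by positivity
  have hδε : 11 * (M + 1) * δ = ε := by rw [hδ]; field_simp
  obtain ⟨e, heα, hes, he1, heF⟩ := α.exists_invariant_unit hA F hδ0
  obtain ⟨u, hu, hlim⟩ := α.exists_invariant_approximate_unit hA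
  set D := α.orbitAlgebra (insert e (F : Set A)) with hDdef
  have hD : α.IsInvariant D := α.isInvariant_orbitAlgebra _
  have heD : e ∈ D := α.subset_orbitAlgebra (Set.mem_insert _ _)
  have hFD : ∀ a ∈ F, a ∈ D := fun a ha => α.subset_orbitAlgebra (Set.mem_insert_of_mem _ ha)
  obtain ⟨N⟩ := hα.exists_lift hD (α.isClosed_orbitAlgebra _)
    (α.isSeparable_orbitAlgebra (F.countable_toSet.insert e))
    (fun n => ⟨(hu n).1, (hu n).2.1⟩) hlim
  have hΓ : Continuous fun (s : G) (a : F) => α.toAut s (a : A) :=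
    continuous_pi fun a => α.continuous_orbit a
  obtain ⟨t, p, hp, hsum, hpd⟩ := exists_partition_dist_lt hΓ hδ0
  have hpF : ∀ a ∈ F, ∀ g s, p g s ≠ 0 → ‖α.toAut s a - α.toAut g a‖ ≤ δ :=
    fun a ha g s hgs => by
      rw [← dist_eq_norm]
      exact ((dist_pi_lt_iff hδ0).1 (hpd g s hgs) ⟨a, ha⟩).le
  let q : G → C(G, ℝ) := fun g => ⟨fun s => √(p g s), by fun_prop⟩
  have hq : ∀ g, ofRealMap (q g) * ofRealMap (q g) = ofRealMap (p g) := fun g => by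
    ext s
    simp only [q, ContinuousMap.mul_apply, ofRealMap_apply, ContinuousMap.coe_mk]
    rw [← Complex.ofReal_mul, Real.mul_self_sqrt (hp g s)]
  choose z hzc hz using fun g => N.exists_rep (ofRealMap (q g))
  have hzec : ∀ g, z g * constSeq e ∈ α.contBddSeq := fun g =>
    mul_mem (hzc g) (α.constSeq_mem_contBddSeq e)
  let P : A → BddSeq A := fun a =>
    ∑ g ∈ t, z g * constSeq e * constSeq (α.toAut g a) * star (z g * constSeq e)
  have hPc : ∀ a, P a ∈ α.contBddSeq := fun a => sum_mem fun g _ =>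
    mul_mem (mul_mem (hzec g) (α.constSeq_mem_contBddSeq _)) (star_mem (hzec g))
  have hPq : ∀ a ∈ D, (nullSeq A).quotMap (P a) = N.average t p e a := fun a ha => by
    rw [map_sum]
    refine Finset.sum_congr rfl fun g _ => ?_
    rw [N.quotMap_conj (hz g) (star_ofRealMap _) heD (hD g a ha), hq, hes.star_eq]
  have hPn : ∀ a n, P a n = ∑ g ∈ t, z g n * e * α.toAut g a * star (z g n * e) := fun a n =>
    BddSeq.sum_apply _ _ n
  -- The strict inequality `‖e²‖ < 1` turns the asymptotic bound into a genuine contraction,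
  -- uniformly in `a`, from some index on.
  have E0 : ∀ᶠ n in atTop, ∀ a, ‖P a n‖ ≤ ‖a‖ := by
    have h1 : (nullSeq A).quotMap (∑ g ∈ t, z g * constSeq e * star (z g * constSeq e)) =
        constSeqAlg (e * e) := by
      have hee : e * star e ∈ D := mul_mem heD (star_mem heD)
      have h2 : ∑ g ∈ t, ofRealMap (p g) = 1 := by
        ext s
        rw [ContinuousMap.sum_apply]
        simp only [ofRealMap_apply, ContinuousMap.one_apply]
        rw [← Complex.ofReal_sum, hsum, Complex.ofReal_one]
      rw [map_sum, Finset.sum_congr rfl fun g _ => N.quotMap_mul_star (hz g) (star_ofRealMap _) heD]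
      simp only [hq]
      rw [← N.sum_mul t _ hee, h2, N.one_mul _ hee, hes.star_eq]
    have h3 := SeqAlg.NormLE.const (e * e)
    rw [← h1] at h3
    have h4 : ‖e * e‖ < 1 :=
      (norm_mul_le e e).trans_lt (mul_lt_one_of_nonneg_of_lt_one_left (norm_nonneg _) he1 he1.le)
    filter_upwards [h3.eventually (sub_pos.2 h4)] with n hn a
    rw [add_sub_cancel, BddSeq.sum_apply] at hn
    rw [hPn]
    refine (CStarAlgebra.norm_sum_conj_le t (fun g => z g n * e) (fun g => α.toAut g a)
      (fun g _ => (α.norm_toAut g a).le) (norm_nonneg a)).trans ?_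
    exact mul_le_of_le_one_right (norm_nonneg _) hn
  -- A single index must serve all `s` in `G`. Continuity of `s ↦ α_s(P a)` in `ℓ^∞`, that is,
  -- membership in `ℓ^∞_α`, makes the estimate uniform.
  have E1 : ∀ᶠ n in atTop, ∀ a ∈ F, ∀ s, ‖α.toAut s (P a n) - P a n‖ ≤ 2 * δ + δ := by
    refine (F.eventually_all).2 fun a ha => ?_
    have hc : Continuous fun s => α.onBddSeq s (P a) - P a := (hPc a).sub continuous_const
    refine eventually_forall_norm_le hc (fun s => ?_) hδ0
    have h1 := N.normLE_onSeqAlg_average_sub hD hp hsum heD hes.star_eq he1.le hδ0.le (hFD a ha) s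
      (hpF a ha) heα
    rw [← hPq a (hFD a ha)] at h1
    rw [map_sub]
    exact h1
  have E2 : ∀ᶠ n in atTop, ∀ a ∈ F, ∀ b ∈ F,
      ‖P a n * P b n - P (a * b) n‖ ≤ 4 * M * δ + δ := by
    refine (F.eventually_all).2 fun a ha => (F.eventually_all).2 fun b hb => ?_
    have h1 := N.normLE_average_mul_sub hD hp hsum heD hes.star_eq he1.le hδ0.le (hFD a ha)
      (hFD b hb) (hpF b hb) heα
    rw [← hPq a (hFD a ha), ← hPq b (hFD b hb), ← hPq _ (mul_mem (hFD a ha) (hFD b hb)),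
      ← map_mul, ← map_sub] at h1
    refine (h1.mono ?_).eventually hδ0
    have h2 : ‖a * e * e * b - a * b‖ ≤ M * δ + M * δ := by
      have e1 : a * e * e * b - a * b = (a * e - a) * (e * b) + a * (e * b - b) := by
        noncomm_ring
      rw [e1]
      refine (norm_add_le _ _).trans (add_le_add ?_ ?_)
      · refine (norm_mul_le _ _).trans ?_
        rw [mul_comm]
        refine mul_le_mul ?_ (heF a ha).2.le (norm_nonneg _) hM0
        exact (norm_mul_le _ _).trans ((mul_le_of_le_one_left (norm_nonneg _) he1.le).trans
          (hFM b hb))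
      · exact (norm_mul_le _ _).trans
          (mul_le_mul (hFM a ha) (heF b hb).1.le (norm_nonneg _) hM0)
    nlinarith [mul_le_mul_of_nonneg_right (hFM a ha) hδ0.le]
  have E3 : ∀ᶠ n in atTop, ∀ a ∈ F, a ∈ α.fixedPoints → ‖P a n - a‖ ≤ 2 * δ + δ := by
    refine (F.eventually_all).2 fun a ha => ?_
    by_cases haα : a ∈ α.fixedPoints
    swap
    · exact .of_forall fun n h => absurd h haα
    have h1 := SeqAlg.NormLE.const (e * a * e - a)
    have h2 : constSeqAlg (e * a * e - a) = (nullSeq A).quotMap (P a - constSeq a) := by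
      rw [map_sub, map_sub, hPq a (hFD a ha), N.average_of_fixed hD hsum heD (hFD a ha) haα]
      rfl
    rw [h2] at h1
    refine ((h1.mono ?_).eventually hδ0).mono fun n hn _ => hn
    have e1 : e * a * e - a = (e * a - a) * e + (a * e - a) := by noncomm_ring
    rw [e1]
    refine (norm_add_le _ _).trans ?_
    have h3 := (norm_mul_le (e * a - a) e).trans (mul_le_of_le_one_right (norm_nonneg _) he1.le)
    linarith [(heF a ha).1, (heF a ha).2]
  obtain ⟨n, e0, e1, e2, e3⟩ := (E0.and (E1.and (E2.and E3))).exists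
  refine ⟨
    { toFun := fun a => α.expect (∑ g ∈ t, z g n * e * α.toAut g a * star (z g n * e))
      map_add' := fun a b => by
        simp only [map_add, mul_add, add_mul, Finset.sum_add_distrib]
      map_smul' := fun c a => by
        simp only [α.toAut_smul, mul_smul_comm, smul_mul_assoc, ← Finset.smul_sum, map_smul,
          RingHom.id_apply] }, ⟨t, fun g => z g n * e, fun a => rfl⟩, fun a => ?_, ?_, ?_⟩
  · simp only [LinearMap.coe_mk, AddHom.coe_mk, ← hPn]
    exact (α.norm_expect_le _).trans (e0 a)
  · intro a ha b hb hab
    simp only [LinearMap.coe_mk, AddHom.coe_mk, ← hPn]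
    have k1 := α.norm_expect_sub_le (e1 _ hab)
    have k2 := α.norm_expect_sub_le (e1 _ ha)
    have k3 := α.norm_expect_sub_le (e1 _ hb)
    have k4 := e2 a ha b hb
    have k5 := (e0 b).trans (hFM b hb)
    have k6 := ((α.norm_expect_le _).trans (e0 a)).trans (hFM a ha)
    have e4 : α.expect (P (a * b) n) - α.expect (P a n) * α.expect (P b n) =
        (α.expect (P (a * b) n) - P (a * b) n) - (P a n * P b n - P (a * b) n) -
        (α.expect (P a n) - P a n) * P b n - α.expect (P a n) * (α.expect (P b n) - P b n) := by
      noncomm_ring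
    rw [e4]
    have n1 := norm_mul_le (α.expect (P a n) - P a n) (P b n)
    have n2 := norm_mul_le (α.expect (P a n)) (α.expect (P b n) - P b n)
    have n3 : ‖α.expect (P a n) - P a n‖ * ‖P b n‖ ≤ (2 * δ + δ) * M :=
      mul_le_mul k2 k5 (norm_nonneg _) (by positivity)
    have n4 : ‖α.expect (P a n)‖ * ‖α.expect (P b n) - P b n‖ ≤ M * (2 * δ + δ) :=
      mul_le_mul k6 k3 (norm_nonneg _) hM0
    have n5 := norm_sub_le ((α.expect (P (a * b) n) - P (a * b) n) -
      (P a n * P b n - P (a * b) n) - (α.expect (P a n) - P a n) * P b n)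
      (α.expect (P a n) * (α.expect (P b n) - P b n))
    have n6 := norm_sub_le ((α.expect (P (a * b) n) - P (a * b) n) -
      (P a n * P b n - P (a * b) n)) ((α.expect (P a n) - P a n) * P b n)
    have n7 := norm_sub_le (α.expect (P (a * b) n) - P (a * b) n) (P a n * P b n - P (a * b) n)
    have n8 : 0 ≤ M * δ := by positivity
    nlinarith
  · intro a ha haα
    simp only [LinearMap.coe_mk, AddHom.coe_mk, ← hPn]
    have k1 := (α.norm_expect_le (P a n - a)).trans (e3 a ha haα)
    rw [map_sub, α.expect_of_mem haα] at k1
    have n8 : 0 ≤ M * δ := by positivity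
    nlinarith

/-! ### Approximate units of the crossed product coming from towers -/

/-- The sum on the left is the value at `s` of `∑ y_g p y_g*` in the convolution algebra. The `y_g`
come from scaled right translates `h_g(r) = √c_g v(r g)`, for which `∑ h_g(r) h_g(s⁻¹ r)` is a
Riemann sum of the autocorrelation of `v`. -/
theorem exists_tower [SecondCountableTopology G] [MeasurableSpace G] [BorelSpace G]
    [PartialOrder A] [StarOrderedRing A] {α : CStarAction G A} (hα : α.HasRokhlinProperty)
    (hA : IsSigmaUnital A) {e : A} (heα : e ∈ α.fixedPoints) (hes : IsSelfAdjoint e)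
    (he1 : ‖e‖ ≤ 1) (v : C(G, ℝ)) {ε : ℝ} (hε : 0 < ε) : ∃ (t : Finset G) (y : G → A), ∀ s,
      ‖∑ g ∈ t, y g * α.toAut s (star (y g)) -
        (∫ w, v w * v (s⁻¹ * w) ∂(haarProb G)) • (e * e)‖ ≤ ε := by
  obtain ⟨u, hu, hlim⟩ := α.exists_invariant_approximate_unit hA
  set D := α.orbitAlgebra {e} with hDdef
  have hD : α.IsInvariant D := α.isInvariant_orbitAlgebra _
  have heD : e ∈ D := α.subset_orbitAlgebra rfl
  have hee : e * e ∈ D := mul_mem heD heD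
  obtain ⟨N⟩ := hα.exists_lift hD (α.isClosed_orbitAlgebra _)
    (α.isSeparable_orbitAlgebra (Set.countable_singleton e))
    (fun n => ⟨(hu n).1, (hu n).2.1⟩) hlim
  let K : C((G × G) × G, ℝ) := ⟨fun q => v (q.1.2 * q.2) * v (q.1.1⁻¹ * (q.1.2 * q.2)), by fun_prop⟩
  obtain ⟨t, c, hc, hK⟩ := exists_riemann_sum (haarProb G) K (half_pos hε)
  let h : G → C(G, ℝ) := fun g => ⟨fun r => √(c g) * v (r * g), by fun_prop⟩
  choose z hzc hz using fun g => N.exists_rep (ofRealMap (h g))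
  have hzec : ∀ g, z g * constSeq e ∈ α.contBddSeq := fun g =>
    mul_mem (hzc g) (α.constSeq_mem_contBddSeq e)
  let κ : G → ℝ := fun s => ∫ w, v w * v (s⁻¹ * w) ∂(haarProb G)
  have hκ : Continuous κ := by
    have hcc : Continuous fun q : G × G => v q.2 * v (q.1⁻¹ * q.2) := by fun_prop
    have := continuous_parametric_integral_of_continuous (μ := haarProb G)
      (f := fun s w => v w * v (s⁻¹ * w)) hcc isCompact_univ
    simpa only [Measure.restrict_univ] using this
  have hcs : Isometry (constSeq : A → BddSeq A) := by
    refine AddMonoidHomClass.isometry_of_norm constSeq fun a => ?_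
    refine le_antisymm (lp.norm_le_of_forall_le (norm_nonneg _) fun _ => le_rfl) ?_
    exact lp.norm_apply_le_norm (by simp) (constSeq a) 0
  -- The error is treated as a continuous family of sequences indexed by `s`, so that one index
  -- works for all `s`.
  let T : G → BddSeq A := fun s =>
    ∑ g ∈ t, z g * constSeq e * α.onBddSeq s (star (z g * constSeq e)) -
      constSeq (((κ s : ℝ) : ℂ) • (e * e))
  have hT : Continuous T := by
    refine Continuous.sub (continuous_finsetSum _ fun g _ => continuous_const.mul ?_)
      (hcs.continuous.comp ?_)
    · exact (star_mem (hzec g) : star (z g * constSeq e) ∈ α.contBddSeq)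
    · exact (Complex.continuous_ofReal.comp hκ).smul continuous_const
  have hTn : ∀ s, SeqAlg.NormLE ((nullSeq A).quotMap (T s)) (ε / 2) := fun s => by
    have h1 : ∀ g, (nullSeq A).quotMap (z g * constSeq e * α.onBddSeq s (star (z g * constSeq e)))
        = N.toFun (ofRealMap (h g * leftTranslateReal s (h g))) * constSeqAlg (e * e) := fun g => by
      have h2 : (nullSeq A).quotMap (z g * constSeq e) =
          N.toFun (ofRealMap (h g)) * constSeqAlg e := by rw [map_mul, hz]; rfl
      have h3 : (nullSeq A).quotMap (α.onBddSeq s (star (z g * constSeq e))) =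
          star (α.onSeqAlg s ((nullSeq A).quotMap (z g * constSeq e))) := by
        rw [map_star (α.onBddSeq s), map_star]; rfl
      rw [map_mul, h3, h2, N.onSeqAlg_mul_const hD _ _ heD, heα s, leftTranslate_ofRealMap,
        N.mul_const_star_mul _ _ heD heD, star_ofRealMap, hes.star_eq, ofRealMap_mul]
    have h4 : (nullSeq A).quotMap (T s) = N.toFun (ofRealMap
        ((∑ g ∈ t, h g * leftTranslateReal s (h g)) - .const G (κ s))) * constSeqAlg (e * e) := by
      have e1 : ofRealMap ((∑ g ∈ t, h g * leftTranslateReal s (h g)) - .const G (κ s)) =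
          (∑ g ∈ t, ofRealMap (h g * leftTranslateReal s (h g))) -
            ((κ s : ℝ) : ℂ) • (1 : C(G, ℂ)) := by
        ext r
        simp [ContinuousMap.sum_apply]
      rw [e1, N.sub_mul _ _ hee, N.sum_mul t _ hee, N.smul_mul _ _ _ hee, N.one_mul _ hee,
        map_sub, map_sum, Finset.sum_congr rfl fun g _ => h1 g, ← map_smul]
      rfl
    rw [h4]
    refine (N.normLE_mul_const (half_pos hε).le (fun r => ?_) hee).mono
      (mul_le_of_le_one_right (half_pos hε).le (RokhlinLift.norm_mul_self_le_one he1))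
    have h5 := hK (s, r)
    -- Left invariance of the Haar measure removes the dependence on `r`, so a function on `G` is
    -- approximated by a scalar.
    have h6 : ∫ w, K ((s, r), w) ∂(haarProb G) = κ s :=
      integral_mul_left_eq_self (μ := haarProb G) (fun w => v w * v (s⁻¹ * w)) r
    rw [h6] at h5
    rw [ofRealMap_apply, Complex.norm_real, Real.norm_eq_abs]
    convert h5 using 2
    simp only [ContinuousMap.sub_apply, ContinuousMap.sum_apply, ContinuousMap.const_apply]
    congr 1
    refine Finset.sum_congr rfl fun g _ => ?_
    have e2 : (h g * leftTranslateReal s (h g)) r =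
        √(c g) * v (r * g) * (√(c g) * v (s⁻¹ * r * g)) := rfl
    have e3 : K ((s, r), g) = v (r * g) * v (s⁻¹ * (r * g)) := rfl
    rw [e2, e3, mul_mul_mul_comm, Real.mul_self_sqrt (hc g), mul_assoc s⁻¹]
  obtain ⟨n, hn⟩ := (eventually_forall_norm_le hT hTn (half_pos hε)).exists
  refine ⟨t, fun g => z g n * e, fun s => ?_⟩
  have h1 := hn s
  rw [add_halves] at h1
  have h2 : T s n = ∑ g ∈ t, z g n * e * α.toAut s (star (z g n * e)) - κ s • (e * e) := by
    rw [← Complex.coe_smul]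
    simp only [T]
    rw [lp.coeFn_sub, Pi.sub_apply, BddSeq.sum_apply]
    rfl
  rwa [h2] at h1

end CStarAction

/-! ### The representation of the crossed product on the algebra -/

namespace haarProb

variable {G : Type v} [Group G] [TopologicalSpace G] [IsTopologicalGroup G] [CompactSpace G]
  [MeasurableSpace G] [BorelSpace G]

/-- Compact groups are unimodular: a right translate of the Haar measure is again a Haar probability
measure, and this is unique. -/
instance : (haarProb G).IsMulRightInvariant where
  map_mul_right_eq_self g := by
    have : IsProbabilityMeasure (Measure.map (· * g) (haarProb G)) :=
      Measure.isProbabilityMeasure_map (measurable_mul_const g).aemeasurable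
    exact Measure.isHaarMeasure_eq_of_isProbabilityMeasure _ _

end haarProb

namespace CStarAction

variable {G : Type v} {A : Type u} [Group G] [TopologicalSpace G] [IsTopologicalGroup G]
  [CompactSpace G] [SecondCountableTopology G] [MeasurableSpace G] [BorelSpace G]
  [NonUnitalCStarAlgebra A] (α : CStarAction G A)

theorem expect_toAut (g : G) (a : A) : α.expect (α.toAut g a) = α.expect a := by
  simp only [expect_apply, ← α.toAut_mul]
  exact integral_mul_right_eq_self (μ := haarProb G) (fun h => α.toAut h a) g

/-- The norm of the Hilbert module with inner product `E (a* b)`. -/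
noncomputable def expectNorm (a : A) : ℝ := √‖α.expect (star a * a)‖

theorem expectNorm_nonneg (a : A) : 0 ≤ α.expectNorm a := Real.sqrt_nonneg _

theorem expectNorm_sq (a : A) : α.expectNorm a ^ 2 = ‖α.expect (star a * a)‖ :=
  Real.sq_sqrt (norm_nonneg _)

theorem norm_expect_star_mul_le (a b : A) :
    ‖α.expect (star a * b)‖ ≤ α.expectNorm a * α.expectNorm b := by
  let _ := CStarAlgebra.spectralOrder A
  have := CStarAlgebra.spectralOrderedRing A
  have h := α.norm_expect_star_mul_sq_le a b
  rw [← expectNorm_sq, ← expectNorm_sq, ← mul_pow] at h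
  exact le_of_sq_le_sq h (mul_nonneg (α.expectNorm_nonneg _) (α.expectNorm_nonneg _))

theorem expectNorm_add_le (a b : A) :
    α.expectNorm (a + b) ≤ α.expectNorm a + α.expectNorm b := by
  refine le_of_sq_le_sq ?_ (add_nonneg (α.expectNorm_nonneg _) (α.expectNorm_nonneg _))
  have e : star (a + b) * (a + b) = star a * a + star a * b + star b * a + star b * b := by
    rw [star_add]; noncomm_ring
  rw [expectNorm_sq, e, map_add, map_add, map_add]
  have h1 := α.norm_expect_star_mul_le a b
  have h2 := α.norm_expect_star_mul_le b a
  have h3 := α.expectNorm_sq a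
  have h4 := α.expectNorm_sq b
  have h5 := norm_add₄_le (a := α.expect (star a * a)) (b := α.expect (star a * b))
    (c := α.expect (star b * a)) (d := α.expect (star b * b))
  nlinarith

theorem expectNorm_smul (c : ℂ) (a : A) : α.expectNorm (c • a) = ‖c‖ * α.expectNorm a := by
  have h : star (c • a) * (c • a) = (star c * c) • (star a * a) := by
    rw [star_smul, smul_mul_smul_comm]
  rw [expectNorm, h, map_smul, norm_smul, norm_mul, norm_star, Real.sqrt_mul (by positivity),
    Real.sqrt_mul_self (norm_nonneg _), expectNorm]

theorem expectNorm_mul_le (x a : A) : α.expectNorm (x * a) ≤ ‖x‖ * α.expectNorm a := by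
  let _ := CStarAlgebra.spectralOrder A
  have := CStarAlgebra.spectralOrderedRing A
  refine le_of_sq_le_sq ?_ (mul_nonneg (norm_nonneg _) (α.expectNorm_nonneg _))
  rw [mul_pow, expectNorm_sq, expectNorm_sq]
  have h1 : star (x * a) * (x * a) ≤ ‖x‖ ^ 2 • (star a * a) := by
    have h2 := CStarAlgebra.star_left_conjugate_le_norm_smul (a := a) (.star_mul_self x)
    rw [CStarRing.norm_star_mul_self, ← sq] at h2
    simpa only [star_mul, mul_assoc] using h2
  have h3 := α.expect_nonneg (sub_nonneg.2 h1)
  rw [map_sub, α.expect_real_smul, sub_nonneg] at h3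
  refine (CStarAlgebra.norm_le_norm_of_nonneg_of_le (α.expect_nonneg (star_mul_self_nonneg _))
    h3).trans_eq ?_
  rw [norm_smul, Real.norm_of_nonneg (sq_nonneg _)]

theorem expectNorm_toAut (g : G) (a : A) : α.expectNorm (α.toAut g a) = α.expectNorm a := by
  rw [expectNorm, ← map_star, ← map_mul, α.expect_toAut, expectNorm]

theorem expectNorm_of_mem {x : A} (hx : x ∈ α.fixedPoints) : α.expectNorm x = ‖x‖ := by
  rw [expectNorm, α.expect_of_mem (mul_mem (star_mem hx) hx), CStarRing.norm_star_mul_self,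
    Real.sqrt_mul_self (norm_nonneg _)]

/-! ### Constant functions and the representation on the Hilbert module of the conditional
expectation. -/

namespace ConvAlg

variable {α}

/-- The constant function `a` on `G`, as an element of the convolution algebra. -/
def const (a : A) : α.ConvAlg := ContinuousMap.const G a

@[simp] theorem const_apply (a : A) (s : G) : (const a : α.ConvAlg) s = a := rfl

theorem const_injective : Function.Injective (const : A → α.ConvAlg) :=
  fun _ _ h => congrArg (fun f : α.ConvAlg => f 1) h

/-- The integrated form of the covariant pair given by `A` and `α` acting on `A`. -/
noncomputable def act (f : α.ConvAlg) (a : A) : A := ∫ t, f t * α.toAut t a ∂(haarProb G)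

theorem continuous_act_integrand (f : α.ConvAlg) (a : A) :
    Continuous fun t => f t * α.toAut t a := f.continuous.mul (α.continuous_orbit a)

/-- The constant functions form a left ideal on which left multiplication is the integrated
representation; multiplicativity and adjointability of `act` therefore follow from the algebra laws
of convolution. -/
theorem mul_const (f : α.ConvAlg) (a : A) : f * const a = const (act f a) := rfl

theorem act_mul (f h : α.ConvAlg) (a : A) : act (f * h) a = act f (act h a) :=
  const_injective (by rw [← mul_const, ← mul_const, ← mul_const, mul_assoc])

/-- In the notation `const a = a p` this is `p a* b p = E(a* b) p`. -/
theorem star_const_mul_const (a b : A) :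
    star (const a : α.ConvAlg) * const b = const (α.expect (star a * b)) := by
  ext s
  simp only [mul_apply, star_apply, const_apply, expect_apply, map_mul]

theorem const_mul_const {x : A} (hx : x ∈ α.fixedPoints) (a : A) :
    (const a : α.ConvAlg) * const x = const (a * x) := by
  ext s
  simp [mul_apply, hx _]

theorem const_mul_star_const_apply (a b : A) (s : G) :
    (const a * star (const b) : α.ConvAlg) s = a * α.toAut s (star b) := by
  rw [mul_apply]
  simp only [star_apply, const_apply, ← α.toAut_mul, mul_inv_cancel_left]
  simp

theorem star_const {x : A} (hx : x ∈ α.fixedPoints) :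
    star (const x : α.ConvAlg) = const (star x) := by
  ext s
  rw [star_apply, const_apply, const_apply]
  exact star_mem hx s

theorem expect_star_mul_act (f : α.ConvAlg) (a b : A) :
    α.expect (star a * act f b) = α.expect (star (act (star f) a) * b) :=
  const_injective (α := α) (by
    rw [← star_const_mul_const, ← star_const_mul_const, ← mul_const, ← mul_const, star_mul,
      star_star, mul_assoc])

theorem normL1_apply (f : α.ConvAlg) : normL1 α f = ∫ t, ‖f t‖ ∂(haarProb G) := rfl

/-- For `x = act f a`, the inner product of `x` with itself is an integral of inner products of `x`
with `f(t) α_t(a)`. Cauchy–Schwarz and invariance of the module norm bound each by `‖x‖ ‖f(t)‖ ‖a‖`,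
with module norms for `x` and `a`, and one factor `‖x‖` is cancelled. -/
theorem expectNorm_act_le (f : α.ConvAlg) (a : A) :
    α.expectNorm (act f a) ≤ normL1 α f * α.expectNorm a := by
  set x := act f a with hx
  have hc : Continuous fun t => star x * (f t * α.toAut t a) :=
    continuous_const.mul (continuous_act_integrand f a)
  have h1 : α.expect (star x * x) = ∫ t, α.expect (star x * (f t * α.toAut t a)) ∂(haarProb G) := by
    have h0 : star x * x = ∫ t, star x * (f t * α.toAut t a) ∂(haarProb G) :=
      mul_integral (star x) (continuous_act_integrand f a)
    rw [h0]
    exact ((α.expect.mkContinuous 1 fun a => by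
      simpa using α.norm_expect_le a).integral_comp_comm (integrable_of_continuous hc)).symm
  have h2 : α.expectNorm x ^ 2 ≤ α.expectNorm x * (normL1 α f * α.expectNorm a) := by
    rw [expectNorm_sq, h1, normL1_apply, ← integral_mul_const, ← integral_const_mul]
    refine norm_integral_le_of_norm_le (integrable_of_continuous
      (continuous_const.mul (f.continuous.norm.mul continuous_const))) (ae_of_all _ fun t => ?_)
    refine (α.norm_expect_star_mul_le _ _).trans (mul_le_mul_of_nonneg_left ?_
      (α.expectNorm_nonneg _))
    exact (α.expectNorm_mul_le _ _).trans_eq (by rw [α.expectNorm_toAut])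
  have h3 := α.expectNorm_nonneg x
  have h4 : 0 ≤ normL1 α f * α.expectNorm a :=
    mul_nonneg (apply_nonneg _ _) (α.expectNorm_nonneg a)
  by_contra! h
  nlinarith

variable (α) in
/-- The operator norm of `act f`, as a C⋆-seminorm. -/
noncomputable def actNorm (f : α.ConvAlg) : ℝ := ⨆ a : {a : A // α.expectNorm a ≤ 1}, α.expectNorm (act f a)

theorem bddAbove_actNorm (f : α.ConvAlg) :
    BddAbove (Set.range fun a : {a : A // α.expectNorm a ≤ 1} => α.expectNorm (act f a)) :=
  ⟨normL1 α f, by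
    rintro _ ⟨a, rfl⟩
    exact (expectNorm_act_le f a).trans (mul_le_of_le_one_right (apply_nonneg _ _) a.2)⟩

theorem actNorm_nonneg (f : α.ConvAlg) : 0 ≤ actNorm α f :=
  Real.iSup_nonneg fun _ => α.expectNorm_nonneg _

theorem actNorm_le {f : α.ConvAlg} {r : ℝ} (hr : 0 ≤ r)
    (h : ∀ a, α.expectNorm (act f a) ≤ r * α.expectNorm a) : actNorm α f ≤ r :=
  Real.iSup_le (fun a => (h a).trans (mul_le_of_le_one_right hr a.2)) hr

theorem act_smul (f : α.ConvAlg) (c : ℂ) (a : A) : act f (c • a) = c • act f a := by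
  simp only [act, α.toAut_smul, mul_smul_comm]
  exact integral_smul c _

theorem expectNorm_act_le_actNorm (f : α.ConvAlg) (a : A) :
    α.expectNorm (act f a) ≤ actNorm α f * α.expectNorm a := by
  rcases (α.expectNorm_nonneg a).eq_or_lt with h0 | h0
  · rw [← h0, mul_zero]
    simpa [← h0] using expectNorm_act_le f a
  · have h1 : α.expectNorm (((α.expectNorm a)⁻¹ : ℂ) • a) ≤ 1 := by
      rw [expectNorm_smul, norm_inv, Complex.norm_real, Real.norm_of_nonneg h0.le,
        inv_mul_cancel₀ h0.ne']
    have h2 := le_ciSup (bddAbove_actNorm f) ⟨_, h1⟩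
    dsimp only at h2
    rw [act_smul, expectNorm_smul, norm_inv, Complex.norm_real, Real.norm_of_nonneg h0.le,
      inv_mul_le_iff₀ h0] at h2
    rw [mul_comm]
    exact h2

theorem actNorm_star_le (f : α.ConvAlg) : actNorm α (star f) ≤ actNorm α f := by
  refine actNorm_le (actNorm_nonneg f) fun a => ?_
  set y := act (star f) a with hy
  have h1 : α.expectNorm y ^ 2 ≤ α.expectNorm a * (actNorm α f * α.expectNorm y) := by
    rw [expectNorm_sq]
    conv_lhs => rw [hy, ← expect_star_mul_act, ← hy]
    exact (α.norm_expect_star_mul_le _ _).trans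
      (mul_le_mul_of_nonneg_left (expectNorm_act_le_actNorm f y) (α.expectNorm_nonneg _))
  have h3 := α.expectNorm_nonneg y
  have h4 := mul_nonneg (actNorm_nonneg f) (α.expectNorm_nonneg a)
  by_contra! h
  nlinarith

theorem actNorm_mul_le (f h : α.ConvAlg) : actNorm α (f * h) ≤ actNorm α f * actNorm α h := by
  refine actNorm_le (mul_nonneg (actNorm_nonneg f) (actNorm_nonneg h)) fun a => ?_
  rw [act_mul, mul_assoc]
  exact (expectNorm_act_le_actNorm f _).trans
    (mul_le_mul_of_nonneg_left (expectNorm_act_le_actNorm h a) (actNorm_nonneg f))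

variable (α) in
/-- The C⋆-seminorm on the convolution algebra given by its representation on `A`. -/
noncomputable def actSeminorm : CStarSeminorm α.ConvAlg where
  toSeminorm := Seminorm.of (actNorm α)
    (fun f h => by
      refine actNorm_le (add_nonneg (actNorm_nonneg f) (actNorm_nonneg h)) fun a => ?_
      have : act (f + h) a = act f a + act h a := by
        simp only [act, add_apply, add_mul]
        exact integral_add (integrable_of_continuous (continuous_act_integrand f a))
          (integrable_of_continuous (continuous_act_integrand h a))
      rw [this, add_mul]
      exact (α.expectNorm_add_le _ _).trans
        (add_le_add (expectNorm_act_le_actNorm f a) (expectNorm_act_le_actNorm h a)))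
    (fun c f => by
      have : ∀ a, act (c • f) a = c • act f a := fun a => by
        simp only [act, smul_apply, smul_mul_assoc]
        exact integral_smul c _
      simp only [actNorm, this, expectNorm_smul]
      exact (Real.mul_iSup_of_nonneg (norm_nonneg c) _).symm)
  mul_le' := actNorm_mul_le
  star_mul_self' f := by
    change actNorm α (star f * f) = actNorm α f ^ 2
    refine le_antisymm ?_ ?_
    · refine (actNorm_mul_le _ _).trans ?_
      rw [sq]
      exact mul_le_mul_of_nonneg_right (actNorm_star_le f) (actNorm_nonneg f)
    -- The usual Hilbert space argument: `‖f a‖²` is the norm of the inner product of `a` with `f* f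
    -- a`, hence at most `‖f* f‖ ‖a‖²`.
    · refine (Real.le_sqrt (actNorm_nonneg _) (actNorm_nonneg _)).1 ?_
      refine actNorm_le (Real.sqrt_nonneg _) fun a => ?_
      refine le_of_sq_le_sq ?_ (mul_nonneg (Real.sqrt_nonneg _) (α.expectNorm_nonneg a))
      rw [mul_pow, Real.sq_sqrt (actNorm_nonneg _), expectNorm_sq]
      have e := expect_star_mul_act (star f) a (act f a)
      rw [star_star] at e
      rw [← e, ← act_mul]
      refine (α.norm_expect_star_mul_le _ _).trans ?_
      have := mul_le_mul_of_nonneg_left (expectNorm_act_le_actNorm (star f * f) a)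
        (α.expectNorm_nonneg a)
      linarith

theorem actNorm_le_normL1 (f : α.ConvAlg) : actNorm α f ≤ normL1 α f :=
  actNorm_le (apply_nonneg _ _) (expectNorm_act_le f)

/-- Testing on the vector `x*`, which is mapped to `x x*`; on fixed points the module norm is the
norm of `A`. -/
theorem norm_le_actNorm_const {x : A} (hx : x ∈ α.fixedPoints) :
    ‖x‖ ≤ actNorm α (const x) := by
  have h1 := expectNorm_act_le_actNorm (const x : α.ConvAlg) (star x)
  have h2 : act (const x : α.ConvAlg) (star x) = x * star x := by
    have := mul_const (const x : α.ConvAlg) (star x)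
    rw [const_mul_const (star_mem hx)] at this
    exact (const_injective this).symm
  rw [h2, α.expectNorm_of_mem (mul_mem hx (star_mem hx)), α.expectNorm_of_mem (star_mem hx),
    CStarRing.norm_self_mul_star, norm_star] at h1
  by_contra! h
  have h3 := actNorm_nonneg (const x : α.ConvAlg)
  nlinarith

end ConvAlg

/-! ### The fixed point algebra inside the crossed product -/

namespace CrossedProduct

open ConvAlg

/-- The canonical map of the convolution algebra into the crossed product. -/
noncomputable def ofConv : α.ConvAlg →⋆ₙₐ[ℂ] α.CrossedProduct :=
  (CStarSeminorm.enveloping (ConvAlg.normL1 α)).toComplHom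

theorem norm_ofConv (f : α.ConvAlg) :
    ‖ofConv α f‖ = sSup (CStarSeminorm.dominated (normL1 α)) f :=
  (CStarSeminorm.enveloping (ConvAlg.normL1 α)).norm_toCompl f

theorem norm_ofConv_le (f : α.ConvAlg) : ‖ofConv α f‖ ≤ normL1 α f := by
  rw [norm_ofConv]
  exact CStarSeminorm.sSup_dominated_le _ _ (apply_nonneg _ _) fun q hq => hq.1 f

theorem norm_ofConv_le_of_forall {f : α.ConvAlg} {r : ℝ} (h : ∀ s, ‖f s‖ ≤ r) :
    ‖ofConv α f‖ ≤ r := by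
  refine (norm_ofConv_le α f).trans ?_
  rw [normL1_apply]
  calc _ ≤ ∫ _, r ∂(haarProb G) := integral_mono
        (integrable_of_continuous f.continuous.norm) (integrable_const r) h
    _ = r := by simp

/-- The representation on the Hilbert module is one of the C⋆-seminorms entering the supremum. It
bounds the enveloping norm from below, which makes `ofFixed` isometric. -/
theorem actNorm_le_norm_ofConv (f : α.ConvAlg) : actNorm α f ≤ ‖ofConv α f‖ := by
  rw [norm_ofConv]
  exact CStarSeminorm.le_sSup_dominated (q := (actSeminorm α).toSeminorm)
    ⟨actNorm_le_normL1, _, rfl⟩ f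

theorem denseRange_ofConv : DenseRange (ofConv α) :=
  (CStarSeminorm.enveloping (ConvAlg.normL1 α)).isDenseInducing_toCompl.dense

/-- The embedding of the fixed point algebra into the crossed product, by constant functions. -/
noncomputable def ofFixed : α.fixedPoints →⋆ₙₐ[ℂ] α.CrossedProduct where
  toFun x := ofConv α (const (x : A))
  map_smul' c x := by rw [← map_smul]; rfl
  map_zero' := by
    have : (const ((0 : α.fixedPoints) : A) : α.ConvAlg) = 0 := rfl
    rw [this, map_zero]
  map_add' x y := by rw [← map_add]; rfl
  map_mul' x y := by rw [← map_mul, const_mul_const y.2]; rfl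
  map_star' x := by rw [← map_star, star_const x.2]; rfl

theorem ofFixed_apply (x : α.fixedPoints) : ofFixed α x = ofConv α (const (x : A)) := rfl

theorem norm_ofFixed (x : α.fixedPoints) : ‖ofFixed α x‖ = ‖x‖ :=
  le_antisymm (norm_ofConv_le_of_forall α fun _ => le_rfl)
    ((norm_le_actNorm_const x.2).trans (actNorm_le_norm_ofConv α _))

theorem isometry_ofFixed : Isometry (ofFixed α) :=
  AddMonoidHomClass.isometry_of_norm (ofFixed α) (norm_ofFixed α)

theorem isClosed_range_ofFixed : IsClosed (Set.range (ofFixed α)) :=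
  (isometry_ofFixed α).isClosedEmbedding.isClosed_range

/-- The corner `p (A ⋊ G) p` is the fixed point algebra: for `c` in the convolution algebra the
product is the constant `E(a* act c b)`, and the range of the isometric map `ofFixed` is closed. -/
theorem star_const_mul_mul_const_mem (a b : A) (c : α.CrossedProduct) :
    star (ofConv α (const a)) * c * ofConv α (const b) ∈ Set.range (ofFixed α) := by
  have hc : Continuous fun c => star (ofConv α (const a)) * c * ofConv α (const b) := by fun_prop
  have := map_mem_closure hc (denseRange_ofConv α c) (t := Set.range (ofFixed α)) ?_
  · rwa [(isClosed_range_ofFixed α).closure_eq] at this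
  · rintro _ ⟨f, rfl⟩
    refine ⟨⟨α.expect (star a * act f b), α.expect_mem _⟩, ?_⟩
    rw [ofFixed_apply, ← star_const_mul_const, ← mul_const, map_mul, map_mul, map_star]
    exact (mul_assoc _ _ _).symm

end CrossedProduct

end CStarAction

/-! ### Compressions of the crossed product to the fixed point algebra -/

namespace CStarAction

variable {G : Type v} {A : Type u} [Group G] [TopologicalSpace G] [IsTopologicalGroup G]
  [CompactSpace G] [SecondCountableTopology G] [MeasurableSpace G] [BorelSpace G]
  [NonUnitalCStarAlgebra A]

theorem exists_invariant_unit_of_isCompact (α : CStarAction G A) (hA : IsSigmaUnital A) {S : Set A}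
    (hS : IsCompact S) {ε : ℝ} (hε : 0 < ε) :
    ∃ e ∈ α.fixedPoints, IsSelfAdjoint e ∧ ‖e‖ < 1 ∧ ∀ a ∈ S, ‖e * a - a‖ < ε := by
  obtain ⟨t, -, htf, ht⟩ := hS.finite_cover_balls (show 0 < ε / 3 by positivity)
  obtain ⟨e, heα, hes, he1, he⟩ := α.exists_invariant_unit hA htf.toFinset
    (show 0 < ε / 3 by positivity)
  refine ⟨e, heα, hes, he1, fun a ha => ?_⟩
  obtain ⟨x, hx, hax⟩ := Set.mem_iUnion₂.1 (ht ha)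
  rw [Metric.mem_ball, dist_eq_norm] at hax
  have h1 := (he x (htf.mem_toFinset.2 hx)).1
  have h2 : ‖e * (a - x)‖ ≤ ‖a - x‖ :=
    (norm_mul_le _ _).trans (mul_le_of_le_one_left (norm_nonneg _) he1.le)
  have e1 : e * a - a = e * (a - x) + (e * x - x) - (a - x) := by noncomm_ring
  rw [e1]
  have h3 := norm_sub_le (e * (a - x) + (e * x - x)) (a - x)
  have h4 := norm_add_le (e * (a - x)) (e * x - x)
  linarith

/-- The autocorrelation `s ↦ ∫ v(w) v(s⁻¹ w) dw` of `v`. -/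
noncomputable def autocorrelation (v : C(G, ℝ)) (s : G) : ℝ :=
  ∫ w, v w * v (s⁻¹ * w) ∂(haarProb G)

theorem continuous_autocorrelation (v : C(G, ℝ)) : Continuous (autocorrelation v) := by
  have hcc : Continuous fun q : G × G => v q.2 * v (q.1⁻¹ * q.2) := by fun_prop
  have := continuous_parametric_integral_of_continuous (μ := haarProb G)
    (f := fun s w => v w * v (s⁻¹ * w)) hcc isCompact_univ
  rw [Measure.restrict_univ] at this
  exact this

/-- For `f` supported in `V` with `V V⁻¹ ⊆ W`, a nonzero value at `s` forces `w` and `s⁻¹ w` to lie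
in `V`, hence `s ∈ W`. Normalizing gives an approximate identity for convolution consisting of
autocorrelations, which is the shape towers produce. -/
theorem exists_autocorrelation [T2Space G] {W : Set G} (hW : W ∈ 𝓝 (1 : G)) : ∃ v : C(G, ℝ),
    (∀ s, 0 ≤ autocorrelation v s) ∧ ∫ s, autocorrelation v s ∂(haarProb G) = 1 ∧
      ∀ s, autocorrelation v s ≠ 0 → s ∈ W := by
  obtain ⟨V, hV, hVW⟩ := exists_nhds_split_inv hW
  obtain ⟨f, hf0, hf1, hf⟩ := exists_continuous_zero_one_of_isClosed (s := (interior V)ᶜ)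
    (t := {(1 : G)}) isOpen_interior.isClosed_compl isClosed_singleton
    (Set.disjoint_singleton_right.2 fun h => h (mem_interior_iff_mem_nhds.2 hV))
  have hfn : ∀ w, 0 ≤ f w := fun w => (hf w).1
  have hfV : ∀ w, f w ≠ 0 → w ∈ V := fun w hw => by
    by_contra h
    exact hw (hf0 fun h' => h (interior_subset h'))
  have hn : ∀ s, 0 ≤ autocorrelation f s := fun s =>
    integral_nonneg fun w => mul_nonneg (hfn _) (hfn _)
  have h1 : 0 < autocorrelation f 1 := by
    refine Continuous.integral_pos_of_hasCompactSupport_nonneg_nonzero (x := 1) (by fun_prop)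
      (HasCompactSupport.of_compactSpace _) (fun w => mul_nonneg (hfn _) (hfn _)) ?_
    rw [inv_one, one_mul, hf1 rfl]
    simp
  have hI : 0 < ∫ s, autocorrelation f s ∂(haarProb G) :=
    Continuous.integral_pos_of_hasCompactSupport_nonneg_nonzero (x := 1)
      (continuous_autocorrelation f) (HasCompactSupport.of_compactSpace _) hn h1.ne'
  set I := ∫ s, autocorrelation f s ∂(haarProb G) with hIdef
  have hv : ∀ s, autocorrelation ((√I)⁻¹ • f) s = I⁻¹ * autocorrelation f s := fun s => by
    rw [autocorrelation, autocorrelation, ← integral_const_mul]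
    refine integral_congr_ae (.of_forall fun w => ?_)
    simp only [ContinuousMap.smul_apply, smul_eq_mul]
    rw [mul_mul_mul_comm, ← mul_inv, Real.mul_self_sqrt hI.le]
  refine ⟨(√I)⁻¹ • f, fun s => ?_, ?_, fun s hs => ?_⟩
  · rw [hv]
    exact mul_nonneg (inv_nonneg.2 hI.le) (hn s)
  · simp only [hv]
    rw [integral_const_mul, ← hIdef, inv_mul_cancel₀ hI.ne']
  · rw [hv] at hs
    have hs' := right_ne_zero_of_mul hs
    obtain ⟨w, hw⟩ : ∃ w, f w * f (s⁻¹ * w) ≠ 0 := by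
      by_contra! h
      exact hs' (by simp [autocorrelation, h])
    have := hVW w (hfV w (left_ne_zero_of_mul hw)) _ (hfV _ (right_ne_zero_of_mul hw))
    rwa [div_eq_mul_inv, mul_inv_rev, inv_inv, mul_inv_cancel_left] at this

namespace CrossedProduct

open ConvAlg

variable {α : CStarAction G A}

theorem norm_ofConv_const_le (a : A) : ‖ofConv α (const a)‖ ≤ ‖a‖ :=
  norm_ofConv_le_of_forall α fun _ => le_rfl

theorem ofConv_const_mul_ofFixed (a : A) (x : α.fixedPoints) :
    ofConv α (const a) * ofFixed α x = ofConv α (const (a * x)) := by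
  rw [ofFixed_apply, ← map_mul, const_mul_const x.2]

/-- Fullness of the corner: `∑ y_i p y_i*` is uniformly close, as a function on `G`, to `κ e²`,
where `κ` is a normalized bump at the identity and `e` an invariant approximate unit. Convolution by
`κ e²` almost fixes the given functions. -/
theorem exists_sum_approx_unit [T2Space G] (hα : α.HasRokhlinProperty) (hA : IsSigmaUnital A)
    (F : Finset α.CrossedProduct) {ε : ℝ} (hε : 0 < ε) : ∃ (n : ℕ) (y : Fin n → A),
      ‖∑ i, ofConv α (const (y i)) * star (ofConv α (const (y i)))‖ < 1 ∧
      ∀ c ∈ F, ‖(∑ i, ofConv α (const (y i)) * star (ofConv α (const (y i)))) * c - c‖ < ε := by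
  let _ := CStarAlgebra.spectralOrder A
  have := CStarAlgebra.spectralOrderedRing A
  have hd : ∀ c : α.CrossedProduct, ∃ f : α.ConvAlg, ‖c - ofConv α f‖ < ε / 4 := fun c => by
    obtain ⟨f, hf⟩ := (denseRange_ofConv α).exists_dist_lt c (show 0 < ε / 4 by positivity)
    exact ⟨f, by rwa [← dist_eq_norm]⟩
  choose f hf using hd
  have hS : IsCompact (⋃ c ∈ F, Set.range (f c)) :=
    F.isCompact_biUnion fun c _ => isCompact_range (f c).continuous
  obtain ⟨e, heα, hes, he1, he⟩ := α.exists_invariant_unit_of_isCompact hA hS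
    (show 0 < ε / 16 by positivity)
  have heF : ∀ c ∈ F, ∀ s, ‖e * f c s - f c s‖ < ε / 16 := fun c hc s =>
    he _ (Set.mem_iUnion₂.2 ⟨c, hc, s, rfl⟩)
  -- Compactness of `G` makes the continuity of `t ↦ α_t(f(t⁻¹ s))` at `t = 1` uniform in `s`.
  have hW : {t : G | ∀ c ∈ F, ∀ s, ‖α.toAut t (f c (t⁻¹ * s)) - f c s‖ < ε / 8} ∈ 𝓝 (1 : G) := by
    simp only [← Filter.eventually_iff]
    refine (F.eventually_all).2 fun c _ => ?_
    have hcc : Continuous fun q : G × G => α.toAut q.1 (f c (q.1⁻¹ * q.2)) - f c q.2 :=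
      (α.continuous_toAut_comp continuous_fst ((f c).continuous.comp (by fun_prop))).sub
        ((f c).continuous.comp continuous_snd)
    let Γ : C(G, C(G, A)) := ContinuousMap.curry ⟨_, hcc⟩
    have h1 : Γ 1 = 0 := by
      ext s
      change α.toAut 1 (f c (1⁻¹ * s)) - f c s = 0
      rw [inv_one, one_mul, α.toAut_one, sub_self]
    have h2 := Γ.continuous.tendsto 1
    rw [h1] at h2
    have h3 := (Metric.tendsto_nhds.1 h2) (ε / 8) (by positivity)
    filter_upwards [h3] with t ht s
    rw [dist_zero_right] at ht
    exact ((Γ t).norm_coe_le_norm s).trans_lt ht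
  obtain ⟨v, hκ0, hκ1, hκW⟩ := exists_autocorrelation hW
  have hκc := continuous_autocorrelation v
  set κ := autocorrelation v with hκ
  set L := ∑ c ∈ F, ‖ofConv α (f c)‖ with hL
  have hL0 : 0 ≤ L := Finset.sum_nonneg fun _ _ => norm_nonneg _
  -- The first bound keeps the norm of the sum strictly below `1`, since the model `κ e²` has norm
  -- at most `‖e‖`; the second controls the error on the given elements.
  set δ := min ((1 - ‖e‖) / 2) (ε / (8 * (L + 1))) with hδ
  have hδ0 : 0 < δ := lt_min (by linarith) (by positivity)
  obtain ⟨t, y, hty⟩ := exists_tower hα hA heα hes he1.le v hδ0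
  set T : α.ConvAlg := ∑ g ∈ t, const (y g) * star (const (y g)) with hT
  have hTs : ∀ s, T s = ∑ g ∈ t, y g * α.toAut s (star (y g)) := fun s => by
    have : ∀ (u : Finset G), (∑ g ∈ u, const (y g) * star (const (y g)) : α.ConvAlg) s =
        ∑ g ∈ u, y g * α.toAut s (star (y g)) := fun u => by
      classical
      induction u using Finset.induction_on with
      | empty => rfl
      | insert a u ha ih => rw [Finset.sum_insert ha, Finset.sum_insert ha, ConvAlg.add_apply, ih,
          const_mul_star_const_apply]
    exact this t
  let T₀ : α.ConvAlg := (⟨fun s => ((κ s : ℝ) : ℂ) • (e * e),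
    (Complex.continuous_ofReal.comp hκc).smul continuous_const⟩ : C(G, A))
  have hT₀ : ∀ s, T₀ s = ((κ s : ℝ) : ℂ) • (e * e) := fun _ => rfl
  have hee : ‖e * e‖ ≤ ‖e‖ := (norm_mul_le e e).trans (mul_le_of_le_one_left (norm_nonneg _) he1.le)
  have hκi : Integrable κ (haarProb G) := integrable_of_continuous hκc
  have hTT : ‖ofConv α T - ofConv α T₀‖ ≤ δ := by
    rw [← map_sub]
    refine norm_ofConv_le_of_forall α fun s => ?_
    have : (T - T₀ : α.ConvAlg) s = T s - T₀ s := rfl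
    rw [this, hTs, hT₀, Complex.coe_smul]
    exact hty s
  have hT₀n : ‖ofConv α T₀‖ ≤ ‖e‖ := by
    refine (norm_ofConv_le α T₀).trans ?_
    rw [normL1_apply]
    simp only [hT₀, norm_smul, Complex.norm_real, Real.norm_of_nonneg (hκ0 _)]
    rw [integral_mul_const, hκ1, one_mul]
    exact hee
  have hTn : ‖ofConv α T‖ < 1 := by
    have h1 := norm_add_le (ofConv α T - ofConv α T₀) (ofConv α T₀)
    rw [sub_add_cancel] at h1
    have h2 : δ ≤ (1 - ‖e‖) / 2 := min_le_left _ _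
    linarith
  have hT₀f : ∀ c ∈ F, ‖ofConv α (T₀ * f c) - ofConv α (f c)‖ ≤ ε / 4 := fun c hc => by
    rw [← map_sub]
    refine norm_ofConv_le_of_forall α fun s => ?_
    have e1 : (T₀ * f c - f c : α.ConvAlg) s =
        ∫ t, ((κ t : ℝ) : ℂ) • (e * e * α.toAut t (f c (t⁻¹ * s)) - f c s) ∂(haarProb G) := by
      have h1 : (T₀ * f c - f c : α.ConvAlg) s = (T₀ * f c) s - f c s := rfl
      simp only [smul_sub]
      have h2 : Integrable (fun t => ((κ t : ℝ) : ℂ) • f c s) (haarProb G) :=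
        integrable_of_continuous ((Complex.continuous_ofReal.comp hκc).smul continuous_const)
      have h3 : ∀ t, T₀ t * α.toAut t (f c (t⁻¹ * s)) =
          ((κ t : ℝ) : ℂ) • (e * e * α.toAut t (f c (t⁻¹ * s))) := fun t => by
        rw [hT₀, smul_mul_assoc]
      have h4 := integrable_integrand T₀ (f c) s
      simp only [h3] at h4
      rw [h1, mul_apply, integral_sub h4 h2]
      simp only [h3, Complex.coe_smul]
      rw [integral_smul_const, hκ1, one_smul]
    rw [e1]
    refine (norm_integral_le_of_norm_le (hκi.mul_const (ε / 4)) (ae_of_all _ fun t => ?_)).trans ?_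
    · rw [norm_smul, Complex.norm_real, Real.norm_of_nonneg (hκ0 t)]
      by_cases h0 : κ t = 0
      · simp [h0]
      refine mul_le_mul_of_nonneg_left ?_ (hκ0 t)
      have h1 := (hκW t h0 c hc s).le
      have h2 := (heF c hc s).le
      have e2 : e * e * α.toAut t (f c (t⁻¹ * s)) - f c s =
          e * e * (α.toAut t (f c (t⁻¹ * s)) - f c s) + e * (e * f c s - f c s) +
            (e * f c s - f c s) := by noncomm_ring
      rw [e2]
      have h3 := (norm_mul_le (e * e) (α.toAut t (f c (t⁻¹ * s)) - f c s)).trans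
        (mul_le_of_le_one_left (norm_nonneg _) (hee.trans he1.le))
      have h4 := (norm_mul_le e (e * f c s - f c s)).trans
        (mul_le_of_le_one_left (norm_nonneg _) he1.le)
      refine (norm_add_le _ _).trans ((add_le_add (norm_add_le _ _) le_rfl).trans ?_)
      linarith
    · rw [integral_mul_const, hκ1, one_mul]
  have hfin : ∀ c ∈ F, ‖ofConv α T * c - c‖ < ε := fun c hc => by
    have h1 := (hf c).le
    have e1 : ofConv α T * c - c = ofConv α T * (c - ofConv α (f c)) +
        (ofConv α T - ofConv α T₀) * ofConv α (f c) + (ofConv α (T₀ * f c) - ofConv α (f c)) -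
        (c - ofConv α (f c)) := by rw [map_mul]; noncomm_ring
    have h2 := (norm_mul_le (ofConv α T) (c - ofConv α (f c))).trans
      (mul_le_of_le_one_left (norm_nonneg _) hTn.le)
    have h3 : ‖(ofConv α T - ofConv α T₀) * ofConv α (f c)‖ ≤ ε / 8 := by
      refine (norm_mul_le _ _).trans ?_
      have h4 : ‖ofConv α (f c)‖ ≤ L :=
        Finset.single_le_sum (f := fun c => ‖ofConv α (f c)‖) (fun _ _ => norm_nonneg _) hc
      have h5 : δ ≤ ε / (8 * (L + 1)) := min_le_right _ _
      calc _ ≤ ε / (8 * (L + 1)) * (L + 1) :=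
            mul_le_mul (hTT.trans h5) (by linarith) (norm_nonneg _) (by positivity)
        _ = ε / 8 := by field_simp
    have h6 := hT₀f c hc
    rw [e1]
    refine (norm_sub_le _ _).trans_lt ?_
    have h7 := norm_add_le (ofConv α T * (c - ofConv α (f c)) +
        (ofConv α T - ofConv α T₀) * ofConv α (f c)) (ofConv α (T₀ * f c) - ofConv α (f c))
    have h8 := norm_add_le (ofConv α T * (c - ofConv α (f c)))
        ((ofConv α T - ofConv α T₀) * ofConv α (f c))
    have h9 := hf c
    linarith
  have hsum : ∑ i : Fin t.card, ofConv α (const (y (t.equivFin.symm i))) *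
      star (ofConv α (const (y (t.equivFin.symm i)))) = ofConv α T := by
    rw [Equiv.sum_comp t.equivFin.symm fun g : t => ofConv α (const (y g)) *
      star (ofConv α (const (y g))), Finset.sum_coe_sort t fun g => ofConv α (const (y g)) *
      star (ofConv α (const (y g))), hT, map_sum]
    simp only [map_mul, map_star]
  refine ⟨t.card, fun i => y (t.equivFin.symm i), ?_, ?_⟩
  · rw [hsum]; exact hTn
  · rw [hsum]; exact hfin

/-- If the fixed point algebra is purely infinite, then there are contractions `x` in the crossed
product with `x x*` almost a unit that compress the crossed product into the fixed point algebra. -/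
theorem exists_compression [T2Space G] (hα : α.HasRokhlinProperty) (hA : IsSigmaUnital A)
    (hB : IsPurelyInfinite α.fixedPoints) (F : Finset α.CrossedProduct) {ε : ℝ} (hε : 0 < ε) :
    ∃ x : α.CrossedProduct, ‖x‖ ≤ 1 ∧ (∀ c, star x * c * x ∈ Set.range (ofFixed α)) ∧
      ∀ c ∈ F, ‖x * star x * c - c‖ < ε := by
  classical
  let _ := CStarAlgebra.spectralOrder α.fixedPoints
  have := CStarAlgebra.spectralOrderedRing α.fixedPoints
  obtain ⟨n, y, hT1, hTF⟩ := exists_sum_approx_unit hα hA F (half_pos hε)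
  set k : Fin n → α.CrossedProduct := fun i => ofConv α (const (y i)) with hk
  set T := ∑ i, k i * star (k i) with hT
  set Y := ∑ i, ‖y i‖ with hY
  have hY0 : 0 ≤ Y := Finset.sum_nonneg fun _ _ => norm_nonneg _
  have hyY : ∀ i, ‖y i‖ ≤ Y := fun i =>
    Finset.single_le_sum (f := fun i => ‖y i‖) (fun _ _ => norm_nonneg _) (Finset.mem_univ i)
  have hkY : ∀ i, ‖k i‖ ≤ Y := fun i => (norm_ofConv_const_le _).trans (hyY i)
  set L := ∑ c ∈ F, ‖c‖ with hL
  have hL0 : 0 ≤ L := Finset.sum_nonneg fun _ _ => norm_nonneg _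
  set δ := min (1 - ‖T‖) (ε / (2 * (L + 1))) with hδ
  have hδ0 : 0 < δ := lt_min (by linarith) (by positivity)
  -- There are `n²` matrix entries. In each, `Y² η` comes from the approximate isometries and `2 Y
  -- η` from `e²` being only almost a unit for the `y_i`.
  set m : ℝ := n * (n * (Y * Y + 2 * Y)) with hm
  have hm0 : 0 ≤ m := by positivity
  set η := δ / (m + 1) with hη
  have hη0 : 0 < η := by positivity
  obtain ⟨e, heα, hes, he1, he⟩ := α.exists_invariant_unit hA (Finset.univ.image y) hη0
  let s : α.fixedPoints := ⟨e, heα⟩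
  have hs : IsSelfAdjoint s := Subtype.ext hes.star_eq
  have hss : IsSelfAdjoint (s * s) := by rw [isSelfAdjoint_iff, star_mul, hs.star_eq]
  obtain ⟨S, hS⟩ := CStarAlgebra.exists_approx_isometries hss
    (CStarAlgebra.mem_absorbedSet_self hB hs) n hη0
  -- The columns `k_i` are merged into one element. Since `S_i* s² S_j` is close to `s²` for `i = j`
  -- and to `0` otherwise, the cross terms of `x x*` disappear and `x x*` is close to `∑ k_i k_i*`.
  set x := ∑ i, k i * ofFixed α (star (S i) * s) with hx
  have hxs : star x = ∑ i, ofFixed α (s * S i) * star (k i) := by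
    rw [hx, star_sum]
    refine Finset.sum_congr rfl fun i _ => ?_
    rw [star_mul, ← map_star, star_mul, star_star, hs.star_eq]
  have hxx : x * star x = ∑ i, ∑ j, k i * ofFixed α (star (S i) * (s * s) * S j) * star (k j) := by
    rw [hxs, hx, Finset.sum_mul_sum]
    refine Finset.sum_congr rfl fun i _ => Finset.sum_congr rfl fun j _ => ?_
    simp only [map_mul, mul_assoc]
  have hTT : T = ∑ i, ∑ j, if i = j then k i * star (k j) else 0 := by
    simp [hT]
  have hka : ∀ i, ‖k i * ofFixed α (s * s) - k i‖ ≤ 2 * η := fun i => by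
    have h1 : k i * ofFixed α (s * s) - k i = ofConv α (const (y i * (e * e) - y i)) := by
      rw [hk]
      dsimp only
      rw [ofConv_const_mul_ofFixed]
      exact (map_sub (ofConv α) _ _).symm
    rw [h1]
    refine (norm_ofConv_const_le _).trans ?_
    have h2 := (he (y i) (Finset.mem_image_of_mem _ (Finset.mem_univ i))).2.le
    have e1 : y i * (e * e) - y i = (y i * e - y i) * e + (y i * e - y i) := by noncomm_ring
    rw [e1]
    have h3 := (norm_mul_le (y i * e - y i) e).trans
      (mul_le_of_le_one_right (norm_nonneg _) he1.le)
    exact (norm_add_le _ _).trans (by linarith)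
  have hdiff : ‖x * star x - T‖ < δ := by
    rw [hxx, hTT, ← Finset.sum_sub_distrib]
    have hij : ∀ i j, ‖k i * ofFixed α (star (S i) * (s * s) * S j) * star (k j) -
        (if i = j then k i * star (k j) else 0)‖ ≤ (Y * Y + 2 * Y) * η := fun i j => by
      have e1 : k i * ofFixed α (star (S i) * (s * s) * S j) * star (k j) -
          (if i = j then k i * star (k j) else 0) =
          k i * ofFixed α (star (S i) * (s * s) * S j - if i = j then s * s else 0) * star (k j) +
          (if i = j then (k i * ofFixed α (s * s) - k i) * star (k j) else 0) := by
        split_ifs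
        · rw [map_sub]; noncomm_ring
        · rw [sub_zero, sub_zero, add_zero]
      rw [e1]
      have h1 : ‖k i * ofFixed α (star (S i) * (s * s) * S j - if i = j then s * s else 0) *
          star (k j)‖ ≤ Y * η * Y := by
        refine (norm_mul_le _ _).trans (mul_le_mul ((norm_mul_le _ _).trans
          (mul_le_mul (hkY i) ?_ (norm_nonneg _) hY0)) ?_ (norm_nonneg _) (by positivity))
        · rw [norm_ofFixed]; exact (hS i j).le
        · rw [norm_star]; exact hkY j
      have h2 : ‖(if i = j then (k i * ofFixed α (s * s) - k i) * star (k j) else 0)‖ ≤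
          2 * η * Y := by
        split_ifs
        · refine (norm_mul_le _ _).trans (mul_le_mul (hka i) ?_ (norm_nonneg _) (by positivity))
          rw [norm_star]; exact hkY j
        · rw [norm_zero]; positivity
      exact (norm_add_le _ _).trans (by linarith)
    calc _ ≤ ∑ _i : Fin n, ∑ _j : Fin n, (Y * Y + 2 * Y) * η := by
          refine norm_sum_le_of_le _ fun i _ => ?_
          rw [← Finset.sum_sub_distrib]
          exact norm_sum_le_of_le _ fun j _ => hij i j
      _ = m * η := by simp [hm]; ring
      _ < (m + 1) * η := by linarith
      _ = δ := by rw [hη]; field_simp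
  refine ⟨x, ?_, fun c => ?_, fun c hc => ?_⟩
  · have h1 : ‖x‖ * ‖x‖ ≤ 1 := by
      rw [← CStarRing.norm_self_mul_star]
      have h2 := norm_add_le (x * star x - T) T
      rw [sub_add_cancel] at h2
      have h3 : δ ≤ 1 - ‖T‖ := min_le_left _ _
      linarith
    nlinarith [norm_nonneg x]
  · have hmem : ∀ z : α.fixedPoints, ofFixed α z ∈ NonUnitalStarAlgHom.range (ofFixed α) :=
      fun z => ⟨z, rfl⟩
    change star x * c * x ∈ NonUnitalStarAlgHom.range (ofFixed α)
    rw [hxs, hx, Finset.sum_mul, Finset.sum_mul]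
    refine sum_mem fun i _ => ?_
    rw [Finset.mul_sum]
    refine sum_mem fun j _ => ?_
    have e1 : ofFixed α (s * S i) * star (k i) * c * (k j * ofFixed α (star (S j) * s)) =
        ofFixed α (s * S i) * (star (k i) * c * k j) * ofFixed α (star (S j) * s) := by
      simp only [mul_assoc]
    rw [e1]
    exact mul_mem (mul_mem (hmem _) (star_const_mul_mul_const_mem α _ _ _)) (hmem _)
  · have e1 : x * star x * c - c = (x * star x - T) * c + (T * c - c) := by noncomm_ring
    rw [e1]
    have h1 : ‖(x * star x - T) * c‖ ≤ ε / 2 := by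
      have h4 : ‖c‖ ≤ L := Finset.single_le_sum (f := fun c => ‖c‖) (fun _ _ => norm_nonneg _) hc
      have h5 : δ ≤ ε / (2 * (L + 1)) := min_le_right _ _
      calc _ ≤ ‖x * star x - T‖ * ‖c‖ := norm_mul_le _ _
        _ ≤ ε / (2 * (L + 1)) * (L + 1) :=
            mul_le_mul (hdiff.le.trans h5) (by linarith) (norm_nonneg _) (by positivity)
        _ = ε / 2 := by field_simp
    have h2 := norm_add_le ((x * star x - T) * c) (T * c - c)
    have h3 := hTF c hc
    linarith

end CrossedProduct

end CStarAction

/-- An injective `*`-homomorphism of C⋆-algebras reflects positivity. -/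
theorem CStarAlgebra.nonneg_of_map_nonneg {R S : Type*} [NonUnitalCStarAlgebra R]
    [NonUnitalCStarAlgebra S] [PartialOrder R] [StarOrderedRing R] [PartialOrder S]
    [StarOrderedRing S] (f : R →⋆ₙₐ[ℂ] S) (hf : Function.Injective f) {a : R} (ha : 0 ≤ f a) :
    0 ≤ a := by
  have has : IsSelfAdjoint a := hf (by rw [map_star, ha.isSelfAdjoint.star_eq])
  set b := a⁻ with hb
  have hb0 : 0 ≤ b := CFC.negPart_nonneg a
  have hbs : star b = b := hb0.isSelfAdjoint.star_eq
  -- Conjugating by the negative part isolates `-b³`. Its image is both positive and negative, so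
  -- `b³ = 0` by injectivity, and therefore `b = 0`.
  have h1 : b * a * b = -(b * b * b) := by
    nth_rewrite 1 [← CFC.posPart_sub_negPart a has]
    rw [mul_sub, CFC.negPart_mul_posPart, zero_sub, neg_mul]
  have h2 : 0 ≤ b * b * b := by
    have := star_left_conjugate_nonneg hb0 b
    rwa [hbs] at this
  have h3 : 0 ≤ f (b * a * b) := by
    rw [map_mul, map_mul]
    have := star_left_conjugate_nonneg ha (f b)
    rwa [← map_star, hbs] at this
  have h4 : b * b * b = 0 := hf (by
    rw [map_zero]
    refine le_antisymm ?_ (map_nonneg f h2)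
    rw [h1, map_neg] at h3
    exact neg_nonneg.1 h3)
  have h5 : b * b = 0 := by
    rw [← CStarRing.star_mul_self_eq_zero_iff, star_mul, hbs, ← mul_assoc, h4, zero_mul]
  have h6 : b = 0 := by
    rw [← CStarRing.star_mul_self_eq_zero_iff, hbs, h5]
  rw [← CFC.posPart_sub_negPart a has, ← hb, h6, sub_zero]
  exact CFC.posPart_nonneg a

theorem CStarAlgebra.nonneg_iff_exists_eq_star_mul_self {S : Type*} [NonUnitalCStarAlgebra S]
    [PartialOrder S] [StarOrderedRing S] {a : S} : 0 ≤ a ↔ ∃ b, a = star b * b :=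
  CStarAlgebra.nonneg_iff_eq_star_mul_self

theorem CStarAlgebra.integral_nonneg {S : Type*} [NonUnitalCStarAlgebra S]
    [PartialOrder S] [StarOrderedRing S] {X : Type*} [MeasurableSpace X] (μ : Measure X)
    {f : X → S} (hf : ∀ x, 0 ≤ f x) : 0 ≤ ∫ x, f x ∂μ :=
  MeasureTheory.integral_nonneg hf

/-! ### Completely positive maps and permanence of nuclearity. -/

section CompletelyPositive

variable {A B C : Type*} [NonUnitalCStarAlgebra A] [NonUnitalCStarAlgebra B]
  [NonUnitalCStarAlgebra C]

/-- A linear map is completely positive if its amplifications map every matrix of the form `N* N`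
to a matrix of this form. -/
def LinearMap.IsCompletelyPositive (f : A →ₗ[ℂ] B) : Prop :=
  ∀ (k : ℕ) (N : CStarMatrix (Fin k) (Fin k) A), ∃ N' : CStarMatrix (Fin k) (Fin k) B,
    (star N * N).map f = star N' * N'

namespace LinearMap.IsCompletelyPositive

theorem comp {g : B →ₗ[ℂ] C} {f : A →ₗ[ℂ] B} (hg : g.IsCompletelyPositive)
    (hf : f.IsCompletelyPositive) : (g ∘ₗ f).IsCompletelyPositive := fun k N => by
  obtain ⟨N', hN'⟩ := hf k N
  obtain ⟨N'', hN''⟩ := hg k N'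
  refine ⟨N'', ?_⟩
  rw [← hN'', ← hN']
  rfl

theorem of_starHom (f : A →⋆ₙₐ[ℂ] B) :
    (f : A →ₗ[ℂ] B).IsCompletelyPositive := fun k N =>
  ⟨N.map f, by
    ext i j
    simp only [CStarMatrix.map_apply, CStarMatrix.mul_apply, CStarMatrix.star_apply, map_sum]
    exact Finset.sum_congr rfl fun l _ =>
      (map_mul f _ _).trans (congrArg (· * f (N l j)) (map_star f (N l i)))⟩

theorem of_forall_eq_conj {f : A →ₗ[ℂ] A} (x : A) (hf : ∀ a, f a = star x * a * x) :
    f.IsCompletelyPositive := fun k N =>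
  ⟨N.map (· * x), by
    ext i j
    simp [CStarMatrix.mul_apply, CStarMatrix.star_apply, hf, mul_assoc, Finset.mul_sum,
      Finset.sum_mul]⟩

section Order

variable [PartialOrder A] [StarOrderedRing A] [PartialOrder B] [StarOrderedRing B]
  [PartialOrder C] [StarOrderedRing C]

theorem iff_forall_nonneg {f : A →ₗ[ℂ] B} : f.IsCompletelyPositive ↔
    ∀ (k : ℕ) (M : CStarMatrix (Fin k) (Fin k) A), 0 ≤ M → 0 ≤ M.map f := by
  constructor
  · intro h k M hM
    obtain ⟨N, rfl⟩ := CStarAlgebra.nonneg_iff_exists_eq_star_mul_self.1 hM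
    exact CStarAlgebra.nonneg_iff_exists_eq_star_mul_self.2 (h k N)
  · exact fun h k N => CStarAlgebra.nonneg_iff_exists_eq_star_mul_self.1 (h k _ (star_mul_self_nonneg N))

open scoped CStarAlgebra in
/-- A completely positive linear map, as a bundled map. -/
def toCompletelyPositiveMap {f : A →ₗ[ℂ] B} (hf : f.IsCompletelyPositive) : A →CP B where
  toLinearMap := f
  map_cstarMatrix_nonneg' := iff_forall_nonneg.1 hf

open scoped CStarAlgebra in
theorem of_completelyPositiveMap (f : A →CP B) : (f : A →ₗ[ℂ] B).IsCompletelyPositive :=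
  iff_forall_nonneg.2 f.map_cstarMatrix_nonneg'

end Order

theorem sum {ι : Type*} (t : Finset ι) {f : ι → A →ₗ[ℂ] B}
    (hf : ∀ i ∈ t, (f i).IsCompletelyPositive) : (∑ i ∈ t, f i).IsCompletelyPositive := by
  let _ := CStarAlgebra.spectralOrder A
  have := CStarAlgebra.spectralOrderedRing A
  let _ := CStarAlgebra.spectralOrder B
  have := CStarAlgebra.spectralOrderedRing B
  refine iff_forall_nonneg.2 fun k M hM => ?_
  have h1 : M.map (∑ i ∈ t, f i : A →ₗ[ℂ] B) = ∑ i ∈ t, M.map (f i) := by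
    classical
    induction t using Finset.induction_on with
    | empty => rfl
    | insert a u ha ih =>
      rw [Finset.sum_insert ha, Finset.sum_insert ha,
        ← ih fun i hi => hf i (Finset.mem_insert_of_mem hi)]
      rfl
  rw [h1]
  exact Finset.sum_nonneg fun i hi => iff_forall_nonneg.1 (hf i hi) k M hM

/-- A map is completely positive if it is so after composition with an injective
`*`-homomorphism. -/
theorem of_comp_injective (g : B →⋆ₙₐ[ℂ] C) (hg : Function.Injective g) {f : A →ₗ[ℂ] B}
    (hf : ((g : B →ₗ[ℂ] C) ∘ₗ f).IsCompletelyPositive) : f.IsCompletelyPositive := by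
  let _ := CStarAlgebra.spectralOrder A
  have := CStarAlgebra.spectralOrderedRing A
  let _ := CStarAlgebra.spectralOrder B
  have := CStarAlgebra.spectralOrderedRing B
  let _ := CStarAlgebra.spectralOrder C
  have := CStarAlgebra.spectralOrderedRing C
  refine iff_forall_nonneg.2 fun k M hM => ?_
  refine CStarAlgebra.nonneg_of_map_nonneg (CStarMatrix.mapₙₐ g) ?_
    (iff_forall_nonneg.1 hf k M hM)
  exact fun M N h => CStarMatrix.ext fun i j => hg (congrFun (congrFun h i) j)

/-- Amplification commutes with the integral entry by entry, and an integral of positive matrices is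
positive. -/
theorem integral {X : Type*} [MeasurableSpace X] (μ : Measure X) [IsProbabilityMeasure μ]
    {f : X → A →ₗ[ℂ] B} {g : A →ₗ[ℂ] B} (hf : ∀ x, (f x).IsCompletelyPositive)
    (hi : ∀ a, Integrable (fun x => f x a) μ) (hg : ∀ a, g a = ∫ x, f x a ∂μ) :
    g.IsCompletelyPositive := by
  let _ := CStarAlgebra.spectralOrder A
  have := CStarAlgebra.spectralOrderedRing A
  let _ := CStarAlgebra.spectralOrder B
  have := CStarAlgebra.spectralOrderedRing B
  refine iff_forall_nonneg.2 fun k M hM => ?_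
  have hint : Integrable (fun x => (fun i j => f x (M i j) : Fin k → Fin k → B)) μ :=
    Integrable.of_eval fun i => Integrable.of_eval fun j => hi (M i j)
  -- The C⋆-norm on matrices induces the product topology, so the integral may be computed
  -- entrywise.
  let L : (Fin k → Fin k → B) →L[ℝ] CStarMatrix (Fin k) (Fin k) B :=
    { toFun := fun N => CStarMatrix.ofMatrix N
      map_add' := fun _ _ => rfl
      map_smul' := fun _ _ => rfl
      cont := continuous_id }
  have h1 : M.map g = ∫ x, M.map (f x) ∂μ := by
    have h2 : ∫ x, M.map (f x) ∂μ = L (∫ x, (fun i j => f x (M i j)) ∂μ) :=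
      L.integral_comp_comm hint
    rw [h2]
    ext i j
    change g (M i j) = (∫ x, (fun i j => f x (M i j)) ∂μ) i j
    rw [eval_integral fun i => Integrable.eval hint i, eval_integral, hg]
    exact fun j => hi _
  rw [h1]
  exact CStarAlgebra.integral_nonneg μ fun x => iff_forall_nonneg.1 (hf x) k M hM

theorem exists_eq_star_mul_self {f : A →ₗ[ℂ] B} (hf : f.IsCompletelyPositive) (a : A) :
    ∃ b, f (star a * a) = star b * b := by
  obtain ⟨N, hN⟩ := hf 1 (CStarMatrix.ofMatrix fun _ _ => a)
  refine ⟨N 0 0, ?_⟩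
  have := congrFun (congrFun hN 0) 0
  simp only [CStarMatrix.map_apply, CStarMatrix.mul_apply, CStarMatrix.star_apply,
    Fin.sum_univ_one] at this
  exact this

end LinearMap.IsCompletelyPositive

open scoped ComplexOrder in
/-- Nuclearity passes to algebras whose identity map can be approximated by completely positive
contractions that factor through a nuclear algebra. -/
theorem IsNuclearCStar.of_forall_exists (hA : IsNuclearCStar A)
    (h : ∀ (F : Finset B) (ε : ℝ), 0 < ε → ∃ (f : B →ₗ[ℂ] A) (g : A →ₗ[ℂ] B),
      f.IsCompletelyPositive ∧ g.IsCompletelyPositive ∧ (∀ b, ‖f b‖ ≤ ‖b‖) ∧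
      (∀ a, ‖g a‖ ≤ ‖a‖) ∧ ∀ b ∈ F, ‖g (f b) - b‖ < ε) : IsNuclearCStar B := by
  classical
  intro F ε hε
  let _ := CStarAlgebra.spectralOrder A
  have := CStarAlgebra.spectralOrderedRing A
  let _ := CStarAlgebra.spectralOrder B
  have := CStarAlgebra.spectralOrderedRing B
  obtain ⟨f, g, hf, hg, hfn, hgn, hfg⟩ := h F (ε / 2) (half_pos hε)
  obtain ⟨k, φ, ψ, hφ, hψ, hφψ⟩ := hA (F.image f) (ε / 2) (half_pos hε)
  have hφ' := (LinearMap.IsCompletelyPositive.of_completelyPositiveMap φ).comp hf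
  have hψ' := hg.comp (LinearMap.IsCompletelyPositive.of_completelyPositiveMap ψ)
  refine ⟨k, hφ'.toCompletelyPositiveMap, hψ'.toCompletelyPositiveMap, ?_, ?_, ?_⟩
  · exact fun b => (hφ (f b)).trans (hfn b)
  · exact fun m => (hgn (ψ m)).trans (hψ m)
  · intro b hb
    change ‖g (ψ (φ (f b))) - b‖ < ε
    have e1 : g (ψ (φ (f b))) - b = g (ψ (φ (f b)) - f b) + (g (f b) - b) := by
      rw [map_sub]; abel
    rw [e1]
    have h1 := hgn (ψ (φ (f b)) - f b)
    have h2 := hφψ _ (Finset.mem_image_of_mem f hb)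
    have h3 := hfg b hb
    exact (norm_add_le _ _).trans_lt (by linarith)

end CompletelyPositive

/-! ### Criteria for pure infiniteness, and σ-unitality of separable algebras. -/

section CStarAlgebra

variable {A B : Type*} [NonUnitalCStarAlgebra A] [NonUnitalCStarAlgebra B]

theorem isPurelyInfinite_of_forall_exists (hχ : ∀ χ : A →⋆ₙₐ[ℂ] ℂ, χ = 0)
    (h : ∀ c d : A, star c * c ∈ closure (TwoSidedIdeal.span {star d * d} : Set A) →
      ∀ ε : ℝ, 0 < ε →
      ∃ x : A, ‖star x * (star d * d) * x - star c * c‖ < ε) : IsPurelyInfinite A := by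
  refine ⟨hχ, ?_⟩
  rintro _ _ ⟨c, rfl⟩ ⟨d, rfl⟩ hcd
  choose x hx using fun n : ℕ => h c d hcd (1 / ((n : ℝ) + 1))
    Nat.one_div_pos_of_nat
  refine ⟨x, ?_⟩
  rw [tendsto_iff_norm_sub_tendsto_zero]
  exact squeeze_zero (fun _ => norm_nonneg _) (fun n => (hx n).le)
    tendsto_one_div_add_atTop_nhds_zero_nat

theorem starHom_eq_zero_of_forall_isSelfAdjoint {χ : A →⋆ₙₐ[ℂ] ℂ}
    (h : ∀ s : A, IsSelfAdjoint s → χ s = 0) : χ = 0 := by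
  ext a
  rw [← realPart_add_I_smul_imaginaryPart a, map_add, map_smul, h _ (realPart a).2,
    h _ (imaginaryPart a).2, smul_zero, add_zero]
  rfl

namespace TwoSidedIdeal

theorem map_mem_closure_span (f : A →⋆ₙₐ[ℂ] B) {a b : A}
    (h : a ∈ closure (span {b} : Set A)) : f a ∈ closure (span {f b} : Set B) := by
  have hle : span {b} ≤ (span {f b}).comap f :=
    span_le.2 (Set.singleton_subset_iff.2 ((mem_comap f).2 (subset_span rfl)))
  exact map_mem_closure (AddMonoidHomClass.continuous_of_bound f 1 fun x => by
    rw [one_mul]; exact NonUnitalStarAlgHom.norm_apply_le f x) h fun x hx => (mem_comap f).1 (hle hx)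

end TwoSidedIdeal

theorem isSigmaUnital_of_separable [TopologicalSpace.SeparableSpace A] : IsSigmaUnital A := by
  let _ := CStarAlgebra.spectralOrder A
  have := CStarAlgebra.spectralOrderedRing A
  have hl := CStarAlgebra.increasingApproximateUnit A
  set d := TopologicalSpace.denseSeq A
  have hex : ∀ n : ℕ, ∃ e : A, 0 ≤ e ∧ ‖e‖ ≤ 1 ∧ ∀ k ∈ Finset.range (n + 1),
      ‖e * d k - d k‖ < 1 / ((n : ℝ) + 1) ∧ ‖d k * e - d k‖ < 1 / ((n : ℝ) + 1) := fun n => by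
    have hn : (0 : ℝ) < 1 / ((n : ℝ) + 1) := Nat.one_div_pos_of_nat
    have := (CStarAlgebra.increasingApproximateUnit A).neBot
    refine Eventually.exists (f := CStarAlgebra.approximateUnit A) ?_
    refine hl.eventually_nonneg.and (hl.eventually_norm.and
      ((Finset.eventually_all _).2 fun k _ => ?_))
    have h1 := (Metric.tendsto_nhds.1 (hl.tendsto_mul_right (d k))) _ hn
    have h2 := (Metric.tendsto_nhds.1 (hl.tendsto_mul_left (d k))) _ hn
    simp only [dist_eq_norm] at h1 h2
    exact h1.and h2
  choose e he0 he1 he using hex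
  refine ⟨e, fun n => ⟨he1 n, CStarAlgebra.nonneg_iff_eq_star_mul_self.1 (he0 n)⟩, fun a => ?_⟩
  have key : ∀ ε > 0, ∀ᶠ n in atTop, ‖e n * a - a‖ < ε ∧ ‖a * e n - a‖ < ε := fun ε hε => by
    obtain ⟨k, hk⟩ := (TopologicalSpace.denseRange_denseSeq A).exists_dist_lt a
      (show 0 < ε / 3 by positivity)
    rw [dist_eq_norm] at hk
    have h1 := (tendsto_one_div_add_atTop_nhds_zero_nat (𝕜 := ℝ)).eventually_lt_const
      (show 0 < ε / 3 by positivity)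
    filter_upwards [h1, eventually_ge_atTop k] with n hn hkn
    obtain ⟨h2, h3⟩ := he n k (Finset.mem_range.2 (Nat.lt_succ_of_le hkn))
    change ‖a - d k‖ < ε / 3 at hk
    constructor
    · have e1 : e n * a - a = e n * (a - d k) + (e n * d k - d k) - (a - d k) := by noncomm_ring
      have h4 := (norm_mul_le (e n) (a - d k)).trans
        (mul_le_of_le_one_left (norm_nonneg _) (he1 n))
      have h5 := norm_add_le (e n * (a - d k)) (e n * d k - d k)
      rw [e1]
      exact (norm_sub_le _ _).trans_lt (by linarith)
    · have e1 : a * e n - a = (a - d k) * e n + (d k * e n - d k) - (a - d k) := by noncomm_ring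
      have h4 := (norm_mul_le (a - d k) (e n)).trans
        (mul_le_of_le_one_right (norm_nonneg _) (he1 n))
      have h5 := norm_add_le ((a - d k) * e n) (d k * e n - d k)
      rw [e1]
      exact (norm_sub_le _ _).trans_lt (by linarith)
  constructor <;> rw [Metric.tendsto_nhds] <;> intro ε hε <;>
    filter_upwards [key ε hε] with n hn <;> rw [dist_eq_norm]
  exacts [hn.1, hn.2]

end CStarAlgebra

/-! ### Transfer of the properties from the algebra to the fixed point algebra. -/

namespace CStarAction

variable {G : Type v} {A : Type u} [Group G] [TopologicalSpace G] [IsTopologicalGroup G]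
  [CompactSpace G] [SecondCountableTopology G] [MeasurableSpace G] [BorelSpace G]
  [NonUnitalCStarAlgebra A] {α : CStarAction G A}

/-- The conditional expectation is completely positive. -/
theorem isCompletelyPositive_expect : (α.expect).IsCompletelyPositive :=
  .integral (haarProb G) (f := fun g => ((α.toAut g : A →⋆ₙₐ[ℂ] A) : A →ₗ[ℂ] A))
    (fun _ => .of_starHom _) α.integrable_orbit α.expect_apply

theorem isCompletelyPositive_of_forall_eq {ψ : A →ₗ[ℂ] A} (t : Finset G) (y : G → A)
    (h : ∀ a, ψ a = α.expect (∑ g ∈ t, y g * α.toAut g a * star (y g))) :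
    ψ.IsCompletelyPositive := by
  let c : A → A →ₗ[ℂ] A := fun x =>
    { toFun := fun a => x * a * star x
      map_add' := fun a b => by rw [mul_add, add_mul]
      map_smul' := fun z a => by
        rw [mul_smul_comm, smul_mul_assoc, RingHom.id_apply] }
  have hc : ∀ x, (c x).IsCompletelyPositive := fun x =>
    .of_forall_eq_conj (star x) fun a => by rw [star_star]; rfl
  have hψ : ψ = α.expect ∘ₗ ∑ g ∈ t, c (y g) ∘ₗ ((α.toAut g : A →⋆ₙₐ[ℂ] A) : A →ₗ[ℂ] A) := by
    ext a
    rw [h, LinearMap.comp_apply, LinearMap.sum_apply]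
    rfl
  rw [hψ]
  exact isCompletelyPositive_expect.comp (.sum t fun g _ => (hc _).comp (.of_starHom _))

/-- The fixed point algebra is an approximate retract: there are completely positive contractions
`A → A^α` that are almost the identity on given elements of `A^α` and almost multiplicative on given
elements of `A`. -/
theorem exists_approx_retraction (hα : α.HasRokhlinProperty) (hA : IsSigmaUnital A) (F : Finset A)
    {ε : ℝ} (hε : 0 < ε) : ∃ ψ : A →ₗ[ℂ] α.fixedPoints, ψ.IsCompletelyPositive ∧
      (∀ a, ψ (star a) = star (ψ a)) ∧ (∀ a, ‖ψ a‖ ≤ ‖a‖) ∧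
      (∀ u ∈ F, ∀ v ∈ F, ∀ b : α.fixedPoints, (b : A) ∈ F →
        ‖ψ (u * b * v) - ψ u * b * ψ v‖ < ε) ∧
      ∀ b : α.fixedPoints, (b : A) ∈ F → ‖ψ b - b‖ < ε := by
  classical
  let _ := CStarAlgebra.spectralOrder A
  have := CStarAlgebra.spectralOrderedRing A
  set M := ∑ c ∈ F, ‖c‖ with hM
  have hM0 : 0 ≤ M := Finset.sum_nonneg fun _ _ => norm_nonneg _
  have hFM : ∀ c ∈ F, ‖c‖ ≤ M := fun c hc =>
    Finset.single_le_sum (f := fun c => ‖c‖) (fun _ _ => norm_nonneg _) hc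
  -- Multiplicativity is applied to the splittings `(u b) v` and `u b`, so the finite set must
  -- contain all double and triple products.
  set P := Finset.image₂ (· * ·) F F with hP
  set F' := F ∪ P ∪ Finset.image₂ (· * ·) P F with hF'
  set η := ε / (1 + M + M * M) with hη
  have hη0 : 0 < η := by positivity
  obtain ⟨φ, ⟨t, y, hφ⟩, hφn, hφm, hφf⟩ := exists_approx_mul_map hα hA F' hη0
  let ψ : A →ₗ[ℂ] α.fixedPoints :=
    { toFun := fun a => ⟨φ a, by rw [hφ]; exact α.expect_mem _⟩
      map_add' := fun a b => Subtype.ext (map_add φ a b)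
      map_smul' := fun z a => Subtype.ext (map_smul φ z a) }
  have hFF : ∀ u ∈ F, u ∈ F' := fun u hu =>
    Finset.mem_union_left _ (Finset.mem_union_left _ hu)
  have hPF : ∀ u ∈ F, ∀ v ∈ F, u * v ∈ F' := fun u hu v hv =>
    Finset.mem_union_left _ (Finset.mem_union_right _ (Finset.mem_image₂_of_mem hu hv))
  have hηε : η ≤ ε := div_le_self hε.le (by nlinarith)
  refine ⟨ψ, ?_, fun a => Subtype.ext ?_, fun a => hφn a, fun u hu v hv b hb => ?_,
    fun b hb => (hφf b (hFF _ hb) b.2).trans_le hηε⟩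
  · exact .of_comp_injective (NonUnitalStarSubalgebraClass.subtype α.fixedPoints)
      Subtype.val_injective (isCompletelyPositive_of_forall_eq t y hφ)
  · change φ (star a) = star (φ a)
    rw [hφ, hφ, ← expect_star, star_sum]
    simp only [star_mul, star_star, map_star, mul_assoc]
  · change ‖φ (u * b * v) - φ u * b * φ v‖ < ε
    have h1 := hφm (u * b) (hPF _ hu _ hb) v (hFF _ hv)
      (Finset.mem_union_right _ (Finset.mem_image₂_of_mem (Finset.mem_image₂_of_mem hu hb) hv))
    have h2 := hφm u (hFF _ hu) b (hFF _ hb) (hPF _ hu _ hb)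
    have h3 := hφf b (hFF _ hb) b.2
    have e1 : φ (u * b * v) - φ u * b * φ v = (φ (u * b * v) - φ (u * b) * φ v) +
        (φ (u * b) - φ u * φ b) * φ v + φ u * (φ b - b) * φ v := by noncomm_ring
    have hu' := (hφn u).trans (hFM u hu)
    have hv' := (hφn v).trans (hFM v hv)
    have h4 : ‖(φ (u * b) - φ u * φ b) * φ v‖ ≤ η * M :=
      (norm_mul_le _ _).trans (mul_le_mul h2.le hv' (norm_nonneg _) hη0.le)
    have h5 : ‖φ u * (φ b - b) * φ v‖ ≤ M * η * M :=
      (norm_mul_le _ _).trans (mul_le_mul ((norm_mul_le _ _).trans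
        (mul_le_mul hu' h3.le (norm_nonneg _) hM0)) hv' (norm_nonneg _) (by positivity))
    have h6 := norm_add_le (φ (u * b * v) - φ (u * b) * φ v) ((φ (u * b) - φ u * φ b) * φ v)
    have h7 : η + η * M + M * η * M = ε := by rw [hη]; field_simp
    rw [e1]
    exact (norm_add_le _ _).trans_lt (by linarith)

/-- If `χ(s) ≠ 0`, then `a = s²` is properly infinite in `A`. Its two approximate isometries are
moved into `A^α` by an approximate retraction, and `χ` turns them into numbers `λ₀`, `λ₁` with
`|λ_i|² χ(a) ≈ χ(a)` and `conj(λ₀) λ₁ χ(a) ≈ 0`, which is impossible. -/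
theorem starHom_fixedPoints_eq_zero (hα : α.HasRokhlinProperty) (hA : IsSigmaUnital A)
    (hp : IsPurelyInfinite A) (χ : α.fixedPoints →⋆ₙₐ[ℂ] ℂ) : χ = 0 := by
  classical
  let _ := CStarAlgebra.spectralOrder A
  have := CStarAlgebra.spectralOrderedRing A
  refine starHom_eq_zero_of_forall_isSelfAdjoint fun s hs => ?_
  set a : α.fixedPoints := s * s with ha
  have hs' : IsSelfAdjoint (s : A) := congrArg Subtype.val hs.star_eq
  have haa : IsSelfAdjoint ((s : A) * s) := by rw [isSelfAdjoint_iff, star_mul, hs'.star_eq]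
  by_contra h0
  have hz : χ a ≠ 0 := by rw [ha, map_mul]; exact mul_ne_zero h0 h0
  set z := ‖χ a‖ with hzdef
  have hz0 : 0 < z := norm_pos_iff.2 hz
  obtain ⟨S, hS⟩ := CStarAlgebra.exists_approx_isometries haa
    (CStarAlgebra.mem_absorbedSet_self hp hs') 2 (show 0 < z / 6 by positivity)
  obtain ⟨ψ, -, hψs, hψn, hψm, hψf⟩ := exists_approx_retraction hα hA
    (insert (a : A) (Finset.univ.image S ∪ Finset.univ.image fun i => star (S i)))
    (show 0 < z / 6 by positivity)
  have hmem : ∀ i, S i ∈ insert (a : A)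
      (Finset.univ.image S ∪ Finset.univ.image fun i => star (S i)) := fun i =>
    Finset.mem_insert_of_mem (Finset.mem_union_left _
      (Finset.mem_image_of_mem _ (Finset.mem_univ i)))
  have hmem' : ∀ i, star (S i) ∈ insert (a : A)
      (Finset.univ.image S ∪ Finset.univ.image fun i => star (S i)) := fun i =>
    Finset.mem_insert_of_mem (Finset.mem_union_right _
      (Finset.mem_image_of_mem (fun i => star (S i)) (Finset.mem_univ i)))
  have key : ∀ i j, ‖star (ψ (S i)) * a * ψ (S j) - if i = j then a else 0‖ < z / 2 := fun i j => by
    have h1 := hψm _ (hmem' i) _ (hmem j) a (Finset.mem_insert_self _ _)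
    have h2 := hψf a (Finset.mem_insert_self _ _)
    have h3 := (hψn _).trans_lt (hS i j)
    rw [hψs] at h1
    rw [norm_sub_rev] at h1
    have e1 : star (ψ (S i)) * a * ψ (S j) - (if i = j then a else 0) =
        (star (ψ (S i)) * a * ψ (S j) - ψ (star (S i) * a * S j)) +
        ψ (star (S i) * ((s : A) * s) * S j - if i = j then (s : A) * s else 0) +
        if i = j then ψ a - a else 0 := by
      have : (a : A) = (s : A) * s := rfl
      rw [map_sub, ← this]
      split_ifs
      · abel
      · rw [map_zero]; abel
    have h4 : ‖if i = j then ψ a - a else 0‖ ≤ z / 6 := by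
      split_ifs
      · exact h2.le
      · rw [norm_zero]; positivity
    rw [e1]
    have h5 := norm_add_le (star (ψ (S i)) * a * ψ (S j) - ψ (star (S i) * a * S j))
      (ψ (star (S i) * ((s : A) * s) * S j - if i = j then (s : A) * s else 0))
    exact (norm_add_le _ _).trans_lt (by linarith)
  have key' : ∀ i j, ‖star (χ (ψ (S i))) * χ a * χ (ψ (S j)) - if i = j then χ a else 0‖ < z / 2 :=
    fun i j => by
      have h1 := (NonUnitalStarAlgHom.norm_apply_le χ _).trans_lt (key i j)
      rwa [map_sub, map_mul, map_mul, map_star, apply_ite χ, map_zero] at h1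
  set p := ‖χ (ψ (S 0))‖ with hp'
  set q := ‖χ (ψ (S 1))‖ with hq'
  have h00 := key' 0 0
  have h11 := key' 1 1
  have h01 := key' 0 1
  simp only [if_true, Fin.isValue, zero_ne_one, if_false, sub_zero, norm_mul,
    norm_star] at h00 h11 h01
  have t0 := norm_sub_norm_le (χ a) (star (χ (ψ (S 0))) * χ a * χ (ψ (S 0)))
  have t1 := norm_sub_norm_le (χ a) (star (χ (ψ (S 1))) * χ a * χ (ψ (S 1)))
  rw [norm_sub_rev (χ a)] at t0 t1
  simp only [norm_mul, norm_star] at t0 t1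
  rw [← hp', ← hzdef] at t0
  rw [← hq', ← hzdef] at t1
  rw [← hp', ← hq', ← hzdef] at h01
  have hp0 : 0 ≤ p := norm_nonneg _
  have hq0 : 0 ≤ q := norm_nonneg _
  -- Three errors of `z / 6` sum to `z / 2`, so `p²` and `q²` exceed `1/2` while `p q` is below
  -- `1/2`.
  have i0 : 1 / 2 < p * p := by
    by_contra! h
    nlinarith
  have i1 : 1 / 2 < q * q := by
    by_contra! h
    nlinarith
  have i2 : p * q < 1 / 2 := by
    by_contra! h
    nlinarith
  nlinarith [mul_nonneg hp0 hq0]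

theorem mem_closure_span_of_fixedPoints {a b : α.fixedPoints}
    (h : a ∈ closure (TwoSidedIdeal.span {b} : Set α.fixedPoints)) :
    (a : A) ∈ closure (TwoSidedIdeal.span {(b : A)} : Set A) :=
  TwoSidedIdeal.map_mem_closure_span (NonUnitalStarSubalgebraClass.subtype α.fixedPoints) h

/-- The comparison is solved by some `x` in `A`, and an approximate retraction maps `x` to a
solution in the fixed point algebra. -/
theorem exists_norm_conj_sub_lt_fixedPoints [PartialOrder A] [StarOrderedRing A]
    (hα : α.HasRokhlinProperty) (hA : IsSigmaUnital A) (hp : IsPurelyInfinite A)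
    {a b : α.fixedPoints} (ha : 0 ≤ (a : A)) (hb : 0 ≤ (b : A))
    (hab : a ∈ closure (TwoSidedIdeal.span {b} : Set α.fixedPoints)) {ε : ℝ} (hε : 0 < ε) :
    ∃ x : α.fixedPoints, ‖star x * b * x - a‖ < ε := by
  classical
  obtain ⟨x, hx⟩ := hp.exists_norm_conj_sub_lt ha hb (TwoSidedIdeal.mem_closedSpan.2
    (mem_closure_span_of_fixedPoints hab)) (show 0 < ε / 3 by positivity)
  obtain ⟨ψ, -, hψs, hψn, hψm, hψf⟩ := exists_approx_retraction hα hA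
    {x, star x, (a : A), (b : A)} (show 0 < ε / 3 by positivity)
  refine ⟨ψ x, ?_⟩
  have h1 := hψm (star x) (by simp) x (by simp) b (by simp)
  have h2 := hψf a (by simp)
  have h3 := (hψn _).trans_lt hx
  rw [norm_sub_rev, hψs] at h1
  have e1 : star (ψ x) * b * ψ x - a = (star (ψ x) * b * ψ x - ψ (star x * b * x)) +
      ψ (star x * b * x - a) + (ψ a - a) := by
    rw [map_sub]
    abel
  rw [e1]
  have h4 := norm_add_le (star (ψ x) * b * ψ x - ψ (star x * b * x)) (ψ (star x * b * x - a))
  exact (norm_add_le _ _).trans_lt (by linarith)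

theorem isPurelyInfinite_fixedPoints (hα : α.HasRokhlinProperty) (hA : IsSigmaUnital A)
    (hp : IsPurelyInfinite A) : IsPurelyInfinite α.fixedPoints := by
  let _ := CStarAlgebra.spectralOrder A
  have := CStarAlgebra.spectralOrderedRing A
  exact isPurelyInfinite_of_forall_exists (starHom_fixedPoints_eq_zero hα hA hp)
    fun c d hcd ε hε => exists_norm_conj_sub_lt_fixedPoints hα hA hp
      (star_mul_self_nonneg (c : A)) (star_mul_self_nonneg (d : A)) hcd hε

/-- A nonzero closed ideal contains some `b = d* d ≠ 0`. Simplicity of `A` gives `c* c ≈ ∑ v_i* b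
v_i` with `v_i` in `A`, and an approximate retraction moves the `v_i` into the fixed point algebra
while fixing `b` approximately. -/
theorem isSimpleCStar_fixedPoints (hα : α.HasRokhlinProperty) (hA : IsSigmaUnital A)
    (hs : IsSimpleCStar A) : IsSimpleCStar α.fixedPoints := by
  classical
  let _ := CStarAlgebra.spectralOrder A
  have := CStarAlgebra.spectralOrderedRing A
  have := hs.1
  refine ⟨?_, fun I hI => or_iff_not_imp_left.2 fun hne => ?_⟩
  · obtain ⟨a, ha⟩ := exists_ne (0 : A)
    obtain ⟨e, heα, -, -, he⟩ := α.exists_invariant_unit hA {a} (norm_pos_iff.2 ha)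
    refine ⟨⟨⟨e, heα⟩, 0, fun h => ?_⟩⟩
    have h0 : e = 0 := congrArg Subtype.val h
    have := (he a (Finset.mem_singleton_self a)).1
    rw [h0, zero_mul, zero_sub, norm_neg] at this
    exact lt_irrefl _ this
  · obtain ⟨d, hdI, hd0⟩ : ∃ d ∈ I, d ≠ 0 := by
      by_contra! h
      exact hne (le_bot_iff.1 fun d hd => (TwoSidedIdeal.mem_bot _).2 (h d hd))
    set b := star d * d with hb
    have hbI : b ∈ I := I.mul_mem_left _ _ hdI
    have hb0 : (star (d : A) * d) ≠ 0 := fun h =>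
      hd0 (Subtype.ext ((CStarRing.star_mul_self_eq_zero_iff _).1 h))
    have htop : TwoSidedIdeal.closedSpan {star (d : A) * d} = ⊤ := by
      refine (hs.2 _ (TwoSidedIdeal.isClosed_closedSpan _)).resolve_left fun h => hb0 ?_
      have : star (d : A) * d ∈ TwoSidedIdeal.closedSpan {star (d : A) * d} :=
        TwoSidedIdeal.subset_closedSpan _ rfl
      rwa [h, TwoSidedIdeal.mem_bot] at this
    refine top_le_iff.1 fun c _ => ?_
    let _ := CStarAlgebra.spectralOrder α.fixedPoints
    have := CStarAlgebra.spectralOrderedRing α.fixedPoints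
    refine TwoSidedIdeal.mem_of_star_mul_self_mem hI
      (TwoSidedIdeal.mem_of_forall_norm_sub_lt hI fun ε hε => ?_)
    set a := star c * c with ha
    obtain ⟨n, v, hv⟩ := TwoSidedIdeal.exists_sum_conj_of_mem_closedSpan
      (star_mul_self_nonneg (c : A)) (star_mul_self_nonneg (d : A))
      (by rw [htop]; trivial) (show 0 < ε / 3 by positivity)
    obtain ⟨ψ, -, hψs, hψn, hψm, hψf⟩ := exists_approx_retraction hα hA
      ({(a : A), (b : A)} ∪ (Finset.univ.image v ∪ Finset.univ.image fun i => star (v i)))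
      (show 0 < ε / (3 * (n + 1)) by positivity)
    refine ⟨∑ i, star (ψ (v i)) * b * ψ (v i), sum_mem fun i _ =>
      I.mul_mem_right _ _ (I.mul_mem_left _ _ hbI), ?_⟩
    have h1 : ∀ i, ‖ψ (star (v i) * b * v i) - star (ψ (v i)) * b * ψ (v i)‖ ≤
        ε / (3 * (n + 1)) := fun i => by
      have := hψm (star (v i)) (by simp) (v i) (by simp) b (by simp)
      rw [hψs] at this
      exact this.le
    have h2 := hψf a (by simp)
    have h3 := (hψn _).trans_lt hv
    have e1 : a - ∑ i, star (ψ (v i)) * b * ψ (v i) =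
        ψ (star (c : A) * c - ∑ i, star (v i) * (star (d : A) * d) * v i) +
        (∑ i, (ψ (star (v i) * b * v i) - star (ψ (v i)) * b * ψ (v i))) - (ψ a - a) := by
      have i1 : (a : A) = star (c : A) * c := rfl
      have i2 : (b : A) = star (d : A) * d := rfl
      rw [map_sub, ← i1, ← i2, Finset.sum_sub_distrib, map_sum]
      abel
    have h4 : ‖∑ i, (ψ (star (v i) * b * v i) - star (ψ (v i)) * b * ψ (v i))‖ ≤
        n * (ε / (3 * (n + 1))) :=
      (norm_sum_le_of_le _ fun i _ => h1 i).trans_eq (by simp)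
    have h5 : (n : ℝ) * (ε / (3 * (n + 1))) + ε / (3 * (n + 1)) = ε / 3 := by field_simp
    rw [e1]
    have h6 := norm_add_le (ψ (star (c : A) * c - ∑ i, star (v i) * (star (d : A) * d) * v i))
      (∑ i, (ψ (star (v i) * b * v i) - star (ψ (v i)) * b * ψ (v i)))
    exact (norm_sub_le _ _).trans_lt (by linarith)

theorem isNuclearCStar_fixedPoints (hα : α.HasRokhlinProperty) (hA : IsSigmaUnital A)
    (hn : IsNuclearCStar A) : IsNuclearCStar α.fixedPoints := by
  classical
  refine hn.of_forall_exists fun F ε hε => ?_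
  obtain ⟨ψ, hψ, -, hψn, -, hψf⟩ := exists_approx_retraction hα hA (F.image Subtype.val) hε
  exact ⟨(NonUnitalStarSubalgebraClass.subtype α.fixedPoints : α.fixedPoints →ₗ[ℂ] A), ψ,
    .of_starHom _, hψ, fun _ => le_rfl, hψn, fun b hb => hψf b (Finset.mem_image_of_mem _ hb)⟩

theorem isKirchberg_fixedPoints (hα : α.HasRokhlinProperty) (hA : IsKirchberg A) :
    IsKirchberg α.fixedPoints := by
  have := hA.separable
  have hσ : IsSigmaUnital A := isSigmaUnital_of_separable
  have := UniformSpace.secondCountable_of_separable A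
  exact ⟨isPurelyInfinite_fixedPoints hα hσ hA.purelyInfinite,
    isSimpleCStar_fixedPoints hα hσ hA.simple, inferInstance,
    isNuclearCStar_fixedPoints hα hσ hA.nuclear⟩

end CStarAction

/-! ### Transfer of the properties from the fixed point algebra to the crossed product. -/

namespace CStarAction

variable {G : Type v} {A : Type u} [Group G] [TopologicalSpace G] [IsTopologicalGroup G]
  [CompactSpace G] [SecondCountableTopology G] [MeasurableSpace G] [BorelSpace G]
  [NonUnitalCStarAlgebra A] {α : CStarAction G A}

namespace CrossedProduct

theorem ofFixed_injective : Function.Injective (ofFixed α) := (isometry_ofFixed α).injective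

/-- If the fixed point algebra is purely infinite, then the identity map of the crossed product can
be approximated by maps `c ↦ x x* c x x*` that factor through the fixed point algebra. -/
theorem exists_factorization [T2Space G] (hα : α.HasRokhlinProperty) (hA : IsSigmaUnital A)
    (hB : IsPurelyInfinite α.fixedPoints) (F : Finset α.CrossedProduct) {ε : ℝ} (hε : 0 < ε) :
    ∃ (x : α.CrossedProduct) (f : α.CrossedProduct →ₗ[ℂ] α.fixedPoints), ‖x‖ ≤ 1 ∧
      (∀ c, ofFixed α (f c) = star x * c * x) ∧ (∀ c, ‖f c‖ ≤ ‖c‖) ∧ f.IsCompletelyPositive ∧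
      ∀ c ∈ F, ‖x * ofFixed α (f c) * star x - c‖ < ε := by
  classical
  -- Including the adjoints makes `x x*` almost a unit from the right as well.
  obtain ⟨x, hx1, hxr, hxF⟩ := exists_compression hα hA hB (F ∪ F.image star) (half_pos hε)
  choose θ hθ using hxr
  let f : α.CrossedProduct →ₗ[ℂ] α.fixedPoints :=
    { toFun := θ
      map_add' := fun a b => ofFixed_injective (by
        rw [map_add, hθ, hθ, hθ, mul_add, add_mul])
      map_smul' := fun z a => ofFixed_injective (by
        rw [map_smul, hθ, hθ, mul_smul_comm, smul_mul_assoc, RingHom.id_apply]) }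
  have hf : ∀ c, ofFixed α (f c) = star x * c * x := hθ
  have hx1' : ‖star x‖ ≤ 1 := (norm_star x).trans_le hx1
  refine ⟨x, f, hx1, hf, fun c => ?_, ?_, fun c hc => ?_⟩
  · rw [← norm_ofFixed, hf]
    exact (norm_mul_le _ _).trans ((mul_le_of_le_one_right (norm_nonneg _) hx1).trans
      ((norm_mul_le _ _).trans (mul_le_of_le_one_left (norm_nonneg _) hx1')))
  · exact .of_comp_injective (ofFixed α) ofFixed_injective (.of_forall_eq_conj x hf)
  · have h1 := hxF c (Finset.mem_union_left _ hc)
    have h2 := hxF (star c) (Finset.mem_union_right _ (Finset.mem_image_of_mem _ hc))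
    have h3 : ‖c * (x * star x) - c‖ < ε / 2 := by
      rw [← norm_star, star_sub, star_mul, star_mul, star_star]
      exact h2
    have hp : ‖x * star x‖ ≤ 1 :=
      (norm_mul_le _ _).trans (mul_le_one₀ hx1 (norm_nonneg _) hx1')
    have e1 : x * ofFixed α (f c) * star x - c =
        (x * star x * c - c) * (x * star x) + (c * (x * star x) - c) := by
      rw [hf]; noncomm_ring
    rw [e1]
    have h4 := (norm_mul_le (x * star x * c - c) (x * star x)).trans
      (mul_le_of_le_one_right (norm_nonneg _) hp)
    exact (norm_add_le _ _).trans_lt (by linarith)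

variable [T2Space G]

/-- A character vanishes on the fixed point algebra, and every element is approximated by products
with a factor from there. -/
theorem starHom_eq_zero (hα : α.HasRokhlinProperty) (hA : IsSigmaUnital A)
    (hB : IsPurelyInfinite α.fixedPoints) (χ : α.CrossedProduct →⋆ₙₐ[ℂ] ℂ) : χ = 0 := by
  ext c
  refine norm_le_zero_iff.1 (le_of_forall_pos_le_add fun ε hε => ?_)
  obtain ⟨x, f, -, -, -, -, hF⟩ := exists_factorization hα hA hB {c} hε
  have h1 := (NonUnitalStarAlgHom.norm_apply_le χ _).trans_lt (hF c (Finset.mem_singleton_self c))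
  have h2 : χ (ofFixed α (f c)) = 0 := DFunLike.congr_fun (hB.1 (χ.comp (ofFixed α))) (f c)
  rw [map_sub, map_mul, map_mul, h2, mul_zero, zero_mul, zero_sub, norm_neg] at h1
  rw [zero_add]
  exact h1.le

/-- A finite sum of conjugates of `b` is replaced by a single conjugate. Compressing by `x` gives a
sum of conjugates of `f(b)` in the fixed point algebra, where pure infiniteness yields one
conjugating element `u`; then `y = x u x*` works in the crossed product, since `x* b x` is `f(b)`.
-/
theorem exists_norm_conj_sub_lt (hα : α.HasRokhlinProperty) (hA : IsSigmaUnital A)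
    (hB : IsPurelyInfinite α.fixedPoints) {n : ℕ} (v : Fin n → α.CrossedProduct)
    (d : α.CrossedProduct) {ε : ℝ} (hε : 0 < ε) :
    ∃ y : α.CrossedProduct,
      ‖star y * (star d * d) * y - ∑ i, star (v i) * (star d * d) * v i‖ < ε := by
  classical
  let _ := CStarAlgebra.spectralOrder α.fixedPoints
  have := CStarAlgebra.spectralOrderedRing α.fixedPoints
  set b := star d * d with hb
  set a := ∑ i, star (v i) * b * v i with ha
  set M := ∑ i, ‖v i‖ * ‖v i‖ with hM
  have hM0 : 0 ≤ M := Finset.sum_nonneg fun i _ => mul_nonneg (norm_nonneg _) (norm_nonneg _)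
  obtain ⟨x, f, hx1, hf, hfn, hfcp, hF⟩ := exists_factorization hα hA hB {a, b}
    (show 0 < ε / (3 * (M + 1)) by positivity)
  have hFa := hF a (by simp)
  have hFb := hF b (by simp)
  have hx1' : ‖star x‖ ≤ 1 := (norm_star x).trans_le hx1
  obtain ⟨d', hd'⟩ := hfcp.exists_eq_star_mul_self d
  have hfb : 0 ≤ f b := by rw [hb, hd']; exact star_mul_self_nonneg d'
  set a' := ∑ i, star (f (v i)) * f b * f (v i) with ha'
  have ha'0 : 0 ≤ a' := Finset.sum_nonneg fun i _ => star_left_conjugate_nonneg hfb _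
  have ha'b : a' ∈ TwoSidedIdeal.closedSpan {f b} := sum_mem fun i _ =>
    TwoSidedIdeal.mul_mem_right _ _ _ (TwoSidedIdeal.mul_mem_left _ _ _
      (TwoSidedIdeal.subset_closedSpan _ rfl))
  obtain ⟨u, hu⟩ := hB.exists_norm_conj_sub_lt ha'0 hfb ha'b (show 0 < ε / 3 by positivity)
  have hconj : ∀ w : α.CrossedProduct, ‖x * w * star x‖ ≤ ‖w‖ := fun w =>
    (norm_mul_le _ _).trans ((mul_le_of_le_one_right (norm_nonneg _) hx1').trans
      ((norm_mul_le _ _).trans (mul_le_of_le_one_left (norm_nonneg _) hx1)))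
  have hconj' : ∀ w : α.CrossedProduct, ‖star x * w * x‖ ≤ ‖w‖ := fun w =>
    (norm_mul_le _ _).trans ((mul_le_of_le_one_right (norm_nonneg _) hx1).trans
      ((norm_mul_le _ _).trans (mul_le_of_le_one_left (norm_nonneg _) hx1')))
  refine ⟨x * ofFixed α u * star x, ?_⟩
  have e1 : star (x * ofFixed α u * star x) * b * (x * ofFixed α u * star x) =
      x * ofFixed α (star u * f b * u) * star x := by
    simp only [map_mul, hf, star_mul, star_star, map_star, mul_assoc]
  have e2 : ∀ i, ofFixed α (star (f (v i)) * f b * f (v i)) - star x * (star (v i) * b * v i) * x =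
      star x * (star (v i) * (x * ofFixed α (f b) * star x - b) * v i) * x := fun i => by
    simp only [map_mul, map_star, hf, star_mul, star_star, mul_sub, sub_mul, mul_assoc]
  have h1 : ‖ofFixed α a' - star x * a * x‖ ≤ M * (ε / (3 * (M + 1))) := by
    rw [ha', ha, map_sum, Finset.mul_sum, Finset.sum_mul, ← Finset.sum_sub_distrib, hM,
      Finset.sum_mul]
    refine norm_sum_le_of_le _ fun i _ => ?_
    rw [e2]
    refine (hconj' _).trans ((norm_mul_le _ _).trans ?_)
    have h2 := norm_mul_le (star (v i)) (x * ofFixed α (f b) * star x - b)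
    rw [norm_star] at h2
    calc _ ≤ ‖v i‖ * (ε / (3 * (M + 1))) * ‖v i‖ := by
          refine mul_le_mul_of_nonneg_right (h2.trans ?_) (norm_nonneg _)
          exact mul_le_mul_of_nonneg_left hFb.le (norm_nonneg _)
      _ = _ := by ring
  have e3 : x * ofFixed α (star u * f b * u) * star x - a =
      x * ofFixed α (star u * f b * u - a') * star x +
      x * (ofFixed α a' - star x * a * x) * star x + (x * ofFixed α (f a) * star x - a) := by
    rw [map_sub, hf a]; noncomm_ring
  have h3 := hconj (ofFixed α (star u * f b * u - a'))
  rw [norm_ofFixed] at h3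
  have h4 := hconj (ofFixed α a' - star x * a * x)
  have h5 : M * (ε / (3 * (M + 1))) + ε / (3 * (M + 1)) = ε / 3 := by field_simp
  rw [e1, e3]
  have h6 := norm_add_le (x * ofFixed α (star u * f b * u - a') * star x)
    (x * (ofFixed α a' - star x * a * x) * star x)
  exact (norm_add_le _ _).trans_lt (by linarith)

theorem isPurelyInfinite (hα : α.HasRokhlinProperty) (hA : IsSigmaUnital A)
    (hB : IsPurelyInfinite α.fixedPoints) : IsPurelyInfinite α.CrossedProduct := by
  let _ := CStarAlgebra.spectralOrder α.CrossedProduct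
  have := CStarAlgebra.spectralOrderedRing α.CrossedProduct
  refine isPurelyInfinite_of_forall_exists (starHom_eq_zero hα hA hB) fun c d hcd ε hε => ?_
  obtain ⟨n, v, hv⟩ := TwoSidedIdeal.exists_sum_conj_of_mem_closedSpan (star_mul_self_nonneg c)
    (star_mul_self_nonneg d) (TwoSidedIdeal.mem_closedSpan.2 hcd) (half_pos hε)
  obtain ⟨y, hy⟩ := exists_norm_conj_sub_lt hα hA hB v d (half_pos hε)
  refine ⟨y, ?_⟩
  rw [norm_sub_rev] at hv
  exact (norm_sub_le_norm_sub_add_norm_sub _ _ _).trans_lt (by linarith)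

/-- A nonzero closed ideal meets the fixed point algebra in a nonzero ideal, because a nonzero `d`
is approximated by `x f(d) x*`. So it contains the fixed point algebra, and then every `x f(c) x*`.
-/
theorem isSimpleCStar (hα : α.HasRokhlinProperty) (hA : IsSigmaUnital A)
    (hB : IsPurelyInfinite α.fixedPoints) (hs : IsSimpleCStar α.fixedPoints) :
    IsSimpleCStar α.CrossedProduct := by
  have := hs.1
  refine ⟨(ofFixed_injective (α := α)).nontrivial, fun I hI => or_iff_not_imp_left.2 fun hne => ?_⟩
  let _ := CStarAlgebra.spectralOrder α.CrossedProduct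
  have := CStarAlgebra.spectralOrderedRing α.CrossedProduct
  obtain ⟨d, hdI, hd0⟩ : ∃ d ∈ I, d ≠ 0 := by
    by_contra! h
    exact hne (le_bot_iff.1 fun d hd => (TwoSidedIdeal.mem_bot _).2 (h d hd))
  have hJ : IsClosed (I.comap (ofFixed α) : Set α.fixedPoints) :=
    hI.preimage (isometry_ofFixed α).continuous
  have htop : I.comap (ofFixed α) = ⊤ := by
    refine (hs.2 _ hJ).resolve_left fun h => hd0 ?_
    refine norm_le_zero_iff.1 (le_of_forall_pos_le_add fun ε hε => ?_)
    obtain ⟨x, f, -, hf, -, -, hF⟩ := exists_factorization hα hA hB {d} hε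
    have h1 : f d ∈ I.comap (ofFixed α) := by
      rw [TwoSidedIdeal.mem_comap, hf]
      exact I.mul_mem_right _ _ (I.mul_mem_left _ _ hdI)
    rw [h, TwoSidedIdeal.mem_bot] at h1
    have h2 := hF d (Finset.mem_singleton_self d)
    rw [h1, map_zero, mul_zero, zero_mul, zero_sub, norm_neg] at h2
    rw [zero_add]
    exact h2.le
  refine top_le_iff.1 fun c _ => TwoSidedIdeal.mem_of_forall_norm_sub_lt hI fun ε hε => ?_
  obtain ⟨x, f, -, hf, -, -, hF⟩ := exists_factorization hα hA hB {c} hε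
  have h1 : f c ∈ I.comap (ofFixed α) := by rw [htop]; trivial
  refine ⟨_, I.mul_mem_right _ (star x) (I.mul_mem_left x _ ((TwoSidedIdeal.mem_comap _).1 h1)), ?_⟩
  rw [norm_sub_rev]
  exact hF c (Finset.mem_singleton_self c)

theorem isNuclearCStar (hα : α.HasRokhlinProperty) (hA : IsSigmaUnital A)
    (hB : IsPurelyInfinite α.fixedPoints) (hn : IsNuclearCStar α.fixedPoints) :
    IsNuclearCStar α.CrossedProduct := by
  refine hn.of_forall_exists fun F ε hε => ?_
  obtain ⟨x, f, hx1, hf, hfn, hfcp, hF⟩ := exists_factorization hα hA hB F hε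
  have hx1' : ‖star x‖ ≤ 1 := (norm_star x).trans_le hx1
  let c : α.CrossedProduct →ₗ[ℂ] α.CrossedProduct :=
    { toFun := fun a => x * a * star x
      map_add' := fun a b => by rw [mul_add, add_mul]
      map_smul' := fun z a => by rw [mul_smul_comm, smul_mul_assoc, RingHom.id_apply] }
  have hc : c.IsCompletelyPositive := .of_forall_eq_conj (star x) fun a => by rw [star_star]; rfl
  refine ⟨f, c ∘ₗ (ofFixed α : α.fixedPoints →ₗ[ℂ] α.CrossedProduct), hfcp,
    hc.comp (.of_starHom _), hfn, fun a => ?_, hF⟩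
  change ‖x * ofFixed α a * star x‖ ≤ ‖a‖
  rw [← norm_ofFixed]
  exact (norm_mul_le _ _).trans ((mul_le_of_le_one_right (norm_nonneg _) hx1').trans
      ((norm_mul_le _ _).trans (mul_le_of_le_one_left (norm_nonneg _) hx1)))

/-- The separable space `C(G, A)` maps continuously, for the uniform norm, onto a dense subset. -/
theorem separableSpace [SecondCountableTopology A] :
    TopologicalSpace.SeparableSpace α.CrossedProduct := by
  let f : C(G, A) →+ α.CrossedProduct := (ofConv α : α.ConvAlg →+ α.CrossedProduct)
  have hf : Continuous f := AddMonoidHomClass.continuous_of_bound f 1 fun h => by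
    rw [one_mul]
    exact norm_ofConv_le_of_forall α fun s => ContinuousMap.norm_coe_le_norm h s
  exact DenseRange.separableSpace (f := f) (denseRange_ofConv α) hf

theorem isKirchberg (hα : α.HasRokhlinProperty) (hA : IsKirchberg A) :
    IsKirchberg α.CrossedProduct := by
  have := hA.separable
  have hσ : IsSigmaUnital A := isSigmaUnital_of_separable
  have := UniformSpace.secondCountable_of_separable A
  have hB := isKirchberg_fixedPoints hα hA
  exact ⟨isPurelyInfinite hα hσ hB.purelyInfinite,
    isSimpleCStar hα hσ hB.purelyInfinite hB.simple, separableSpace,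
    isNuclearCStar hα hσ hB.purelyInfinite hB.nuclear⟩

end CrossedProduct

end CStarAction

theorem mainTheorem9 {G : Type*} {A : Type*} [Group G] [TopologicalSpace G]
    [IsTopologicalGroup G] [CompactSpace G] [T2Space G] [SecondCountableTopology G]
    [MeasurableSpace G] [BorelSpace G] [NonUnitalCStarAlgebra A]
    (α : CStarAction G A) (hα : α.HasRokhlinProperty) :
    (IsSigmaUnital A → IsPurelyInfinite A →
      IsPurelyInfinite α.fixedPoints ∧ IsPurelyInfinite α.CrossedProduct) ∧
    (IsKirchberg A → IsKirchberg α.fixedPoints ∧ IsKirchberg α.CrossedProduct) := by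
  refine ⟨fun hσ hA => ?_, fun hA => ⟨CStarAction.isKirchberg_fixedPoints hα hA,
    CStarAction.CrossedProduct.isKirchberg hα hA⟩⟩
  have hB := CStarAction.isPurelyInfinite_fixedPoints hα hσ hA
  exact ⟨hB, CStarAction.CrossedProduct.isPurelyInfinite hα hσ hB⟩
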